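/- **The $\pi$-calculus with $\mathtt{Stop}$.** Over a countably infinite set of names, the set $\Pi_{\mathtt{Stop}}$ of processes is given by $$P,Q ::= \nu x.P \mid \overline{x}y.P \mid x(y).P \mid {!P} \mid P\,|\,Q \mid 0 \mid \mathtt{Stop},$$ up to $\alpha$-equivalence ($\nu x.P$ binds $x$, and $x(y).P$ binds $y$). Structural congruence $\equiv$ is the least congruence with $P|(Q|R)\equiv(P|Q)|R$, $P|Q\equiv Q|P$, $P|0\equiv P$, $\nu x.(P|Q)\equiv P|\nu x.Q$ if $x$ is not free in $P$, $\nu x.0\equiv 0$, $\nu x.\mathtt{Stop}\equiv\mathtt{Stop}$, $\nu x.\nu y.P\equiv\nu y.\nu x.P$, and $!P\equiv P|{!P}$. Reduction contexts are $\mathbb D::=[\cdot]\mid\mathbb D|P\mid P|\mathbb D\mid\nu x.\mathbb D$. Standard reduction: $P\to Q$ iff $P\equiv\mathbb D[x(y).P_1\,|\,\overline{x}z.P_2]$ and $\mathbb D[P_1[z/y]\,|\,P_2]\equiv Q$ for some $\mathbb D$. A process is successful if it is $\equiv\mathbb D[\mathtt{Stop}]$ for some $\mathbb D$. **The calculus $CH$.**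 Fix families of data constructors with arities, where each family is a type $T$ with finitely many constructors. They include the types $()$, $\mathtt{Bool}$, $\mathtt{List}$, $\mathtt{Pair}$ and $\mathtt{Channel}$, the last with the single unary constructor $\mathtt{Chan}$. Expressions are $$e ::= x\mid\lambda x.e\mid e_1\,e_2\mid c\,e_1\ldots e_{\mathrm{ar}(c)}\mid\mathtt{letrec}\ x_1{=}e_1,\ldots,x_n{=}e_n\ \mathtt{in}\ e\mid\mathtt{seq}\,e_1\,e_2\mid\mathtt{case}_T\,e\ \mathtt{of}\ \mathit{alts}\mid m,$$ $$m ::= \mathtt{return}\,e\mid e_1 \mathbin{>\!>\!=} e_2\mid\mathtt{forkIO}\,e\mid\mathtt{takeMVar}\,e\mid\mathtt{newMVar}\,e\mid\mathtt{putMVar}\,e_1\,e_2,$$ where $\mathit{alts}$ has exactly one alternative $c\,y_1\ldots y_{\mathrm{ar}(c)}\to e_c$ for each constructor $c$ of $T$. Processes are $$P ::= P_1|P_2\mid {\Leftarrow}\,e\mid {\Leftarrow^{\mathrm{main}}}\,e\mid\nu x.P\mid x\,\mathbf m\,e\mid x\,\mathbf m\,{-}\mid x=e$$ (threads, the main thread,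 restriction, filled and empty MVars, shared bindings), up to $\alpha$-equivalence. A process is well-formed if the names of MVars and the binding variables occurring in it (those introduced under different binders being different) are pairwise distinct and it has at most one main thread. Structural congruence is the least congruence with commutativity and associativity of $|$, $\nu x.\nu y.P\equiv\nu y.\nu x.P$, and $(\nu x.P_1)|P_2\equiv\nu x.(P_1|P_2)$ if $x$ is not free in $P_2$. With contexts $\mathbb M::=[\cdot]\mid\mathbb M\mathbin{>\!>\!=}e$, $\ \mathbb E::=[\cdot]\mid\mathbb E\,e\mid\mathtt{seq}\,\mathbb E\,e\mid\mathtt{case}_T\,\mathbb E\ \mathtt{of}\ \mathit{alts}$ and $\mathbb F::=\mathbb E\mid\mathtt{takeMVar}\,\mathbb E\mid\mathtt{putMVar}\,\mathbb E\,e$, the rules (capture-avoiding, for main and other threads alike) are - ${\Leftarrow}\mathbb M[\mathbb F[x]]\,|\,x=e\ \to\ {\Leftarrow}\mathbb M[\mathbb F[e]]\,|\,x=e$; - ${\Leftarrow}\mathbb M[\mathbb F[\mathtt{letrec}\ x_1{=}e_1,\ldots,x_n{=}e_n\ \mathtt{in}\ e]]\ \to\ \nu x_1\ldots x_n.({\Leftarrow}\mathbb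 M[\mathbb F[e]]\,|\,x_1=e_1|\ldots|x_n=e_n)$; - ${\Leftarrow}\mathbb M[\mathbb F[(\lambda x.e_1)\,e_2]]\to{\Leftarrow}\mathbb M[\mathbb F[e_1[e_2/x]]]$; - ${\Leftarrow}\mathbb M[\mathbb F[\mathtt{case}_T\,(c\,e_1\ldots e_n)\ \mathtt{of}\ \ldots(c\,y_1\ldots y_n\to e)\ldots]]\to{\Leftarrow}\mathbb M[\mathbb F[e[e_1/y_1,\ldots,e_n/y_n]]]$; - ${\Leftarrow}\mathbb M[\mathbb F[\mathtt{seq}\,v\,e]]\to{\Leftarrow}\mathbb M[\mathbb F[e]]$ if $v$ is an abstraction or a constructor application; - ${\Leftarrow}\mathbb M[\mathtt{return}\,e_1\mathbin{>\!>\!=}e_2]\to{\Leftarrow}\mathbb M[e_2\,e_1]$; - ${\Leftarrow}\mathbb M[\mathtt{takeMVar}\,x]\,|\,x\,\mathbf m\,e\to{\Leftarrow}\mathbb M[\mathtt{return}\,e]\,|\,x\,\mathbf m\,{-}$; - ${\Leftarrow}\mathbb M[\mathtt{putMVar}\,x\,e]\,|\,x\,\mathbf m\,{-}\to{\Leftarrow}\mathbb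 M[\mathtt{return}\,()]\,|\,x\,\mathbf m\,e$; - ${\Leftarrow}\mathbb M[\mathtt{newMVar}\,e]\to\nu x.({\Leftarrow}\mathbb M[\mathtt{return}\,x]\,|\,x\,\mathbf m\,e)$; - ${\Leftarrow}\mathbb M[\mathtt{forkIO}\,e]\to{\Leftarrow}\mathbb M[\mathtt{return}\,()]\,|\,{\Leftarrow}e$ (the new thread is not a main thread). A process is successful if it is well-formed and $\equiv\nu x_1\ldots x_n.({\Leftarrow^{\mathrm{main}}}\,\mathtt{return}\,e\,|\,P')$, where $P'$ may be absent. Standard reduction is the closure of the rules under $\equiv$ and the contexts $\mathbb D::=[\cdot]\mid\mathbb D|P\mid P|\mathbb D\mid\nu x.\mathbb D$, permitted only for well-formed processes that are not successful. **Convergence.** In both calculi, $P{\downarrow}$ (may-convergence) means that some successful $P'$ is reachable from $P$ by finitely many (possibly zero) standard reductions, and $P{\Downarrow}$ (should-convergence) means that every $P'$ so reachable from $P$ satisfies $P'{\downarrow}$. In $CH$ both also require $P$ to be well-formed. **The translation.** Let $e_1\mathbin{>\!>}e_2$ be $e_1\mathbin{>\!>\!=}\lambda\_.e_2$, let $\mathbf{do}\{x\leftarrow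 e_1;e_2\}$ be $e_1\mathbin{>\!>\!=}\lambda x.\mathbf{do}\{e_2\}$, $\mathbf{do}\{(x,y)\leftarrow e_1;e_2\}$ be $e_1\mathbin{>\!>\!=}\lambda z.\mathtt{case}_{\mathtt{Pair}}\,z\ \mathtt{of}\ (x,y)\to\mathbf{do}\{e_2\}$, $\mathbf{do}\{e_1;e_2\}$ be $e_1\mathbin{>\!>}\mathbf{do}\{e_2\}$, and $\mathbf{do}\{e\}$ be $e$. Let $\mathit{unchan}\,e$ be $\mathtt{case}_{\mathtt{Channel}}\,e\ \mathtt{of}\ (\mathtt{Chan}\,m\to m)$ and $\bot$ be $\mathtt{letrec}\ x=x\ \mathtt{in}\ x$. With a distinguished variable $\mathit{stop}$, and with $\mathit{check}$, $\mathit{chan}$, $f$ fresh, $$\begin{aligned} \tau(\overline{x}y.P)&=\mathbf{do}\{\mathit{check}\leftarrow\mathtt{newMVar}\,();\ \mathtt{putMVar}\,(\mathit{unchan}\,x)\,(y,\mathit{check});\ \mathtt{putMVar}\,\mathit{check}\,();\ \tau(P)\}\\ \tau(x(y).P)&=\mathbf{do}\{(y,\mathit{check})\leftarrow\mathtt{takeMVar}\,(\mathit{unchan}\,x);\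 \mathtt{takeMVar}\,\mathit{check};\ \tau(P)\}\\ \tau(P|Q)&=\mathbf{do}\{\mathtt{forkIO}\,\tau(Q);\ \tau(P)\}\\ \tau(\nu x.P)&=\mathbf{do}\{\mathit{chan}\leftarrow\mathtt{newMVar}\,\bot;\ \mathtt{takeMVar}\,\mathit{chan};\ \mathtt{letrec}\ x=\mathtt{Chan}\,\mathit{chan}\ \mathtt{in}\ \tau(P)\}\\ \tau(0)&=\mathtt{return}\,()\\ \tau(\mathtt{Stop})&=\mathtt{takeMVar}\,\mathit{stop}\\ \tau(!P)&=\mathtt{letrec}\ f=\mathbf{do}\{\mathtt{forkIO}\,\tau(P);\ f\}\ \mathtt{in}\ f \end{aligned}$$ and $$\tau_0(P)={\Leftarrow^{\mathrm{main}}}\,\mathbf{do}\{\mathit{stop}\leftarrow\mathtt{newMVar}\,();\ \mathtt{forkIO}\,\tau(P);\ \mathtt{putMVar}\,\mathit{stop}\,()\}.$$ For an expression $e$, write $e{\downarrow}_0$ and $e{\Downarrow}_0$ if $C[e]{\downarrow}$ and $C[e]{\Downarrow}$ hold, respectively, where $C$ is the (capturing) context $\nu\mathit{stop}.{\Leftarrow^{\mathrm{main}}}\,\mathbf{do}\{\mathit{stop}\leftarrow\mathtt{newMVar}\,();\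 \mathtt{forkIO}\,[\cdot];\ \mathtt{putMVar}\,\mathit{stop}\,()\}$. **Theorem.** Let $P\in\Pi_{\mathtt{Stop}}$ be closed (without free names). Then $$P{\downarrow}\iff\tau_0(P){\downarrow}\qquad\text{and}\qquad P{\Downarrow}\iff\tau_0(P){\Downarrow},$$ and also $$P{\downarrow}\iff\tau(P){\downarrow}_0\qquad\text{and}\qquad P{\Downarrow}\iff\tau(P){\Downarrow}_0.$$ -/

import Mathlib

/-! Both calculi are given in de Bruijn notation, so that `α`-equivalent terms are equal: a variable
or name is a natural number, a binder binds index `0` (a binder of `k` variables `x₁, …, xₖ` binds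
the indices `0, …, k - 1`, in this order), and the outer variables are shifted up accordingly.
The free names are thus drawn from the infinite set `ℕ`. -/

/-- Lifts a renaming of variables under a binder of `k` variables. -/
def upRen (k : ℕ) (ρ : ℕ → ℕ) (i : ℕ) : ℕ :=
  if i < k then i else ρ (i - k) + k

/-- Extends a map on variables by the value `z` at the newest variable `0`. -/
def consRen (z : ℕ) (ρ : ℕ → ℕ) : ℕ → ℕ
  | 0 => z
  | i + 1 => ρ i

/-- The transposition of the variables `0` and `1`. -/
def swapRen : ℕ → ℕ
  | 0 => 1
  | 1 => 0
  | i + 2 => i + 2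

/-! ### The synchronous `π`-calculus with `Stop` -/

namespace PiStop

/-- Processes: `nu P` is `νx.P`, `out x y P` is `x̄y.P`, `inp x P` is `x(y).P` (which binds `y`),
`bang P` is `!P`, `par P Q` is `P | Q`, `zero` is `0`. -/
inductive Proc : Type
  | nu (P : Proc)
  | out (x y : ℕ) (P : Proc)
  | inp (x : ℕ) (P : Proc)
  | bang (P : Proc)
  | par (P Q : Proc)
  | zero
  | Stop

namespace Proc

/-- Capture-avoiding renaming of the free names. -/
def rename (ρ : ℕ → ℕ) : Proc → Proc
  | nu P => nu (P.rename (upRen 1 ρ))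
  | out x y P => out (ρ x) (ρ y) (P.rename ρ)
  | inp x P => inp (ρ x) (P.rename (upRen 1 ρ))
  | bang P => bang (P.rename ρ)
  | par P Q => par (P.rename ρ) (Q.rename ρ)
  | zero => zero
  | Stop => Stop

/-- `P.shift` is `P` seen in the scope of one more (unused) name. -/
def shift (P : Proc) : Proc := P.rename Nat.succ

/-- `P.inst z` is `P[z/y]`, where `y` is the name bound by the prefix that guards `P`. -/
def inst (P : Proc) (z : ℕ) : Proc := P.rename (consRen z id)

/-- The free names. -/
def FN : Proc → Set ℕ
  | nu P => {i | i + 1 ∈ P.FN}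
  | out x y P => {x, y} ∪ P.FN
  | inp x P => {x} ∪ {i | i + 1 ∈ P.FN}
  | bang P => P.FN
  | par P Q => P.FN ∪ Q.FN
  | zero => ∅
  | Stop => ∅

def Closed (P : Proc) : Prop := P.FN = ∅

end Proc

open Proc in
/-- Structural congruence: the least congruence that satisfies the laws below. -/
inductive Congr : Proc → Proc → Prop
  | refl (P) : Congr P P
  | symm {P Q} : Congr P Q → Congr Q P
  | trans {P Q R} : Congr P Q → Congr Q R → Congr P R
  | nu {P Q} : Congr P Q → Congr (nu P) (nu Q)
  | out {P Q} (x y) : Congr P Q → Congr (out x y P) (out x y Q)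
  | inp {P Q} (x) : Congr P Q → Congr (inp x P) (inp x Q)
  | bang {P Q} : Congr P Q → Congr (bang P) (bang Q)
  | par {P P' Q Q'} : Congr P P' → Congr Q Q' → Congr (par P Q) (par P' Q')
  | par_assoc (P Q R) : Congr (par P (par Q R)) (par (par P Q) R)
  | par_comm (P Q) : Congr (par P Q) (par Q P)
  | par_zero (P) : Congr (par P zero) P
  | nu_par (P Q) : Congr (nu (par P.shift Q)) (par P (nu Q))
  | nu_zero : Congr (nu zero) zero
  | nu_stop : Congr (nu Stop) Stop
  | nu_nu (P) : Congr (nu (nu P)) (nu (nu (P.rename swapRen)))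
  | bang_unfold (P) : Congr (bang P) (par P (bang P))

/-- Reduction contexts `𝔻 ::= [·] | 𝔻 | P | P | 𝔻 | νx.𝔻`. -/
inductive PCtx : Type
  | hole
  | parL (D : PCtx) (P : Proc)
  | parR (P : Proc) (D : PCtx)
  | nu (D : PCtx)

def PCtx.plug : PCtx → Proc → Proc
  | hole, P => P
  | parL D Q, P => .par (D.plug P) Q
  | parR Q D, P => .par Q (D.plug P)
  | nu D, P => .nu (D.plug P)

/-- The interaction rule `x(y).P | x̄z.Q → P[z/y] | Q`. -/
inductive Interaction : Proc → Proc → Prop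
  | ia (x z : ℕ) (P Q : Proc) :
      Interaction (.par (.inp x P) (.out x z Q)) (.par (P.inst z) Q)

/-- Standard reduction. -/
def Step (P Q : Proc) : Prop :=
  ∃ (D : PCtx) (P' Q' : Proc),
    Congr P (D.plug P') ∧ Interaction P' Q' ∧ Congr (D.plug Q') Q

def Successful (P : Proc) : Prop := ∃ D : PCtx, Congr P (D.plug .Stop)

/-- May-convergence `P↓`. -/
def MayConv (P : Proc) : Prop := ∃ P', Relation.ReflTransGen Step P P' ∧ Successful P'

/-- Should-convergence `P⇓`. -/
def ShouldConv (P : Proc) : Prop := ∀ P', Relation.ReflTransGen Step P P' → MayConv P'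

end PiStop

/-! ### The calculus `CH` -/

namespace CH

/-- The algebraic data types that a program may use in addition to the five types that are always
present. -/
structure Signature where
  Extra : Type
  numCons : Extra → ℕ
  arity : (t : Extra) → Fin (numCons t) → ℕ

/-- The names of the data types: `()`, `Bool`, `List`, `Pair`,
`data Channel = Chan (MVar (Channel, MVar ()))`, and the additional ones. -/
inductive DataType (S : Signature) : Type
  | unit
  | bool
  | list
  | pair
  | channel
  | extra (t : S.Extra)

variable {S : Signature}

/-- The number `|T|` of data constructors of the type `T`. -/
def DataType.numCons : DataType S → ℕ
  | unit => 1
  | bool => 2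
  | list => 2
  | pair => 1
  | channel => 1
  | extra t => S.numCons t

/-- The arities of the data constructors of `T`; those of `List` are `Nil` and `:`. -/
def DataType.arity : (T : DataType S) → Fin T.numCons → ℕ
  | unit, _ => 0
  | bool, _ => 0
  | list, i => if i.val = 0 then 0 else 2
  | pair, _ => 2
  | channel, _ => 1
  | extra t, i => S.arity t i

/-- Expressions. `letrec k b e` is `letrec x₁ = b₁, …, xₖ = bₖ in e` and binds `k` variables in all
`bᵢ` and in `e`; the alternative `alts c` in `case T e alts` binds the `ar(c)` variables of the
pattern `c y₁ … yₙ`. -/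
inductive Expr (S : Signature) : Type
  | var (x : ℕ)
  | lam (e : Expr S)
  | app (e₁ e₂ : Expr S)
  | con (T : DataType S) (c : Fin T.numCons) (args : Fin (T.arity c) → Expr S)
  | letrec (k : ℕ) (b : Fin k → Expr S) (e : Expr S)
  | seq (e₁ e₂ : Expr S)
  | case (T : DataType S) (e : Expr S) (alts : Fin T.numCons → Expr S)
  | ret (e : Expr S)
  | bind (e₁ e₂ : Expr S)
  | fork (e : Expr S)
  | takeMVar (e : Expr S)
  | newMVar (e : Expr S)
  | putMVar (e₁ e₂ : Expr S)

namespace Expr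

/-- Capture-avoiding renaming of the free variables. -/
def rename (ρ : ℕ → ℕ) : Expr S → Expr S
  | var x => var (ρ x)
  | lam e => lam (e.rename (upRen 1 ρ))
  | app e₁ e₂ => app (e₁.rename ρ) (e₂.rename ρ)
  | con T c args => con T c fun i => (args i).rename ρ
  | letrec k b e => letrec k (fun i => (b i).rename (upRen k ρ)) (e.rename (upRen k ρ))
  | seq e₁ e₂ => seq (e₁.rename ρ) (e₂.rename ρ)
  | case T e alts => case T (e.rename ρ) fun c => (alts c).rename (upRen (T.arity c) ρ)
  | ret e => ret (e.rename ρ)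
  | bind e₁ e₂ => bind (e₁.rename ρ) (e₂.rename ρ)
  | fork e => fork (e.rename ρ)
  | takeMVar e => takeMVar (e.rename ρ)
  | newMVar e => newMVar (e.rename ρ)
  | putMVar e₁ e₂ => putMVar (e₁.rename ρ) (e₂.rename ρ)

/-- `e.shift k` is `e` seen in the scope of `k` more (unused) variables. -/
def shift (k : ℕ) (e : Expr S) : Expr S := e.rename (· + k)

/-- Lifts a substitution under a binder of `k` variables. -/
def upSubst (k : ℕ) (σ : ℕ → Expr S) (i : ℕ) : Expr S :=
  if i < k then var i else (σ (i - k)).shift k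

/-- Capture-avoiding simultaneous substitution. -/
def subst (σ : ℕ → Expr S) : Expr S → Expr S
  | var x => σ x
  | lam e => lam (e.subst (upSubst 1 σ))
  | app e₁ e₂ => app (e₁.subst σ) (e₂.subst σ)
  | con T c args => con T c fun i => (args i).subst σ
  | letrec k b e => letrec k (fun i => (b i).subst (upSubst k σ)) (e.subst (upSubst k σ))
  | seq e₁ e₂ => seq (e₁.subst σ) (e₂.subst σ)
  | case T e alts => case T (e.subst σ) fun c => (alts c).subst (upSubst (T.arity c) σ)
  | ret e => ret (e.subst σ)
  | bind e₁ e₂ => bind (e₁.subst σ) (e₂.subst σ)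
  | fork e => fork (e.subst σ)
  | takeMVar e => takeMVar (e.subst σ)
  | newMVar e => newMVar (e.subst σ)
  | putMVar e₁ e₂ => putMVar (e₁.subst σ) (e₂.subst σ)

/-- `e.inst a` is `e[a₁/y₁, …, aₖ/yₖ]`, where `y₁, …, yₖ` are the innermost bound variables. -/
def inst {k : ℕ} (e : Expr S) (a : Fin k → Expr S) : Expr S :=
  e.subst fun i => if h : i < k then a ⟨i, h⟩ else var (i - k)

/-- Functional values: abstractions and constructor applications. -/
inductive IsFunValue : Expr S → Prop
  | lam (e) : IsFunValue (lam e)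
  | con (T c args) : IsFunValue (con T c args)

/-- The value `()`. -/
def unit : Expr S := con .unit (0 : Fin 1) (![] : Fin 0 → Expr S)

/-- The pair `(e₁, e₂)`. -/
def pair (e₁ e₂ : Expr S) : Expr S := con .pair (0 : Fin 1) (![e₁, e₂] : Fin 2 → Expr S)

/-- The constructor application `Chan e`. -/
def chan (e : Expr S) : Expr S := con .channel (0 : Fin 1) (![e] : Fin 1 → Expr S)

/-- `unchan e` is `case e of (Chan m -> m)`. -/
def unchan (e : Expr S) : Expr S := case .channel e fun _ => var 0

/-- `e₁ >> e₂`, that is `e₁ >>= λ_. e₂`. -/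
def andThen (e₁ e₂ : Expr S) : Expr S := bind e₁ (lam (e₂.shift 1))

/-- The must-divergent expression `⊥`, namely `letrec x = x in x`. -/
def bot : Expr S := letrec 1 (fun _ => var 0) (var 0)

end Expr

/-- Processes. `thread true e` is the main thread `⇐ᵐᵃⁱⁿ e` and `thread false e` any other thread
`⇐ e`; `mvar x e` is the filled MVar `x m e`, `emptyMVar x` the empty MVar `x m -`, and
`share x e` the binding `x = e`. -/
inductive Proc (S : Signature) : Type
  | par (P Q : Proc S)
  | thread (main : Bool) (e : Expr S)
  | nu (P : Proc S)
  | mvar (x : ℕ) (e : Expr S)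
  | emptyMVar (x : ℕ)
  | share (x : ℕ) (e : Expr S)

namespace Proc

/-- Capture-avoiding renaming of the free variables. -/
def rename (ρ : ℕ → ℕ) : Proc S → Proc S
  | par P Q => par (P.rename ρ) (Q.rename ρ)
  | thread m e => thread m (e.rename ρ)
  | nu P => nu (P.rename (upRen 1 ρ))
  | mvar x e => mvar (ρ x) (e.rename ρ)
  | emptyMVar x => emptyMVar (ρ x)
  | share x e => share (ρ x) (e.rename ρ)

/-- `P.shift` is `P` seen in the scope of one more (unused) variable. -/
def shift (P : Proc S) : Proc S := P.rename Nat.succ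

/-- The iterated restriction `νx₁ … xₖ. P`. -/
def nus : ℕ → Proc S → Proc S
  | 0, P => P
  | k + 1, P => nus k (nu P)

/-- `P | x₁ = b₁ | … | xₖ = bₖ` for the `k` innermost bound variables `x₁, …, xₖ`. -/
def withBindings (P : Proc S) {k : ℕ} (b : Fin k → Expr S) : Proc S :=
  (List.finRange k).foldl (fun Q i => par Q (share i.val (b i))) P

/-- The free introduced variables: the names of MVars and the binding variables. -/
def introduced : Proc S → Set ℕ
  | par P Q => P.introduced ∪ Q.introduced
  | thread _ _ => ∅
  | nu P => {i | i + 1 ∈ P.introduced}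
  | mvar x _ => {x}
  | emptyMVar x => {x}
  | share x _ => {x}

/-- All introduced variables, free or bound, are pairwise distinct. (Variables bound by different
binders are different.) -/
def IntroDistinct : Proc S → Prop
  | par P Q => P.IntroDistinct ∧ Q.IntroDistinct ∧ Disjoint P.introduced Q.introduced
  | nu P => P.IntroDistinct
  | thread _ _ => True
  | mvar _ _ => True
  | emptyMVar _ => True
  | share _ _ => True

/-- The number of main threads. -/
def numMain : Proc S → ℕ
  | par P Q => P.numMain + Q.numMain
  | thread m _ => if m then 1 else 0
  | nu P => P.numMain
  | mvar _ _ => 0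
  | emptyMVar _ => 0
  | share _ _ => 0

def WellFormed (P : Proc S) : Prop := P.IntroDistinct ∧ P.numMain ≤ 1

end Proc

open Proc in
/-- Structural congruence: the least congruence that satisfies the laws below. -/
inductive Congr : Proc S → Proc S → Prop
  | refl (P) : Congr P P
  | symm {P Q} : Congr P Q → Congr Q P
  | trans {P Q R} : Congr P Q → Congr Q R → Congr P R
  | par {P P' Q Q'} : Congr P P' → Congr Q Q' → Congr (par P Q) (par P' Q')
  | nu {P Q} : Congr P Q → Congr (nu P) (nu Q)
  | par_comm (P Q) : Congr (par P Q) (par Q P)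
  | par_assoc (P Q R) : Congr (par (par P Q) R) (par P (par Q R))
  | nu_nu (P) : Congr (nu (nu P)) (nu (nu (P.rename swapRen)))
  | nu_par (P Q) : Congr (par (nu P) Q) (nu (par P Q.shift))

/-- Process contexts `𝔻 ::= [·] | 𝔻 | P | P | 𝔻 | νx.𝔻`. -/
inductive PCtx (S : Signature) : Type
  | hole
  | parL (D : PCtx S) (P : Proc S)
  | parR (P : Proc S) (D : PCtx S)
  | nu (D : PCtx S)

def PCtx.plug : PCtx S → Proc S → Proc S
  | hole, P => P
  | parL D Q, P => .par (D.plug P) Q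
  | parR Q D, P => .par Q (D.plug P)
  | nu D, P => .nu (D.plug P)

/-- Monadic contexts `𝕄 ::= [·] | 𝕄 >>= e`. -/
inductive MCtx (S : Signature) : Type
  | hole
  | bind (M : MCtx S) (e : Expr S)

namespace MCtx

def plug : MCtx S → Expr S → Expr S
  | hole, e => e
  | bind M e', e => .bind (M.plug e) e'

def shift (k : ℕ) : MCtx S → MCtx S
  | hole => hole
  | bind M e => bind (M.shift k) (e.shift k)

end MCtx

/-- Evaluation contexts `𝔼 ::= [·] | 𝔼 e | seq 𝔼 e | case 𝔼 of alts`. -/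
inductive ECtx (S : Signature) : Type
  | hole
  | app (E : ECtx S) (e : Expr S)
  | seq (E : ECtx S) (e : Expr S)
  | case (T : DataType S) (E : ECtx S) (alts : Fin T.numCons → Expr S)

namespace ECtx

def plug : ECtx S → Expr S → Expr S
  | hole, e => e
  | app E e', e => .app (E.plug e) e'
  | seq E e', e => .seq (E.plug e) e'
  | case T E alts, e => .case T (E.plug e) alts

def shift (k : ℕ) : ECtx S → ECtx S
  | hole => hole
  | app E e => app (E.shift k) (e.shift k)
  | seq E e => seq (E.shift k) (e.shift k)
  | case T E alts => case T (E.shift k) fun c => (alts c).rename (upRen (T.arity c) (· + k))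

end ECtx

/-- Forcing contexts `𝔽 ::= 𝔼 | takeMVar 𝔼 | putMVar 𝔼 e`. -/
inductive FCtx (S : Signature) : Type
  | eval (E : ECtx S)
  | takeMVar (E : ECtx S)
  | putMVar (E : ECtx S) (e : Expr S)

namespace FCtx

def plug : FCtx S → Expr S → Expr S
  | eval E, e => E.plug e
  | takeMVar E, e => .takeMVar (E.plug e)
  | putMVar E e', e => .putMVar (E.plug e) e'

def shift (k : ℕ) : FCtx S → FCtx S
  | eval E => eval (E.shift k)
  | takeMVar E => takeMVar (E.shift k)
  | putMVar E e => putMVar (E.shift k) (e.shift k)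

end FCtx

open Proc in
/-- The reduction rules (call-by-name). Every rule applies to the main thread (`m = true`) and to
the other threads (`m = false`). -/
inductive Rule : Proc S → Proc S → Prop
  | cpce (m : Bool) (M : MCtx S) (F : FCtx S) (x : ℕ) (e : Expr S) :
      Rule (par (thread m (M.plug (F.plug (.var x)))) (share x e))
        (par (thread m (M.plug (F.plug e))) (share x e))
  | mkbinds (m : Bool) (M : MCtx S) (F : FCtx S) (k : ℕ) (b : Fin k → Expr S) (e : Expr S) :
      Rule (thread m (M.plug (F.plug (.letrec k b e))))
        (nus k ((thread m ((M.shift k).plug ((F.shift k).plug e))).withBindings b))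
  | beta (m : Bool) (M : MCtx S) (F : FCtx S) (e₁ e₂ : Expr S) :
      Rule (thread m (M.plug (F.plug (.app (.lam e₁) e₂))))
        (thread m (M.plug (F.plug (e₁.inst ![e₂]))))
  | case (m : Bool) (M : MCtx S) (F : FCtx S) (T : DataType S) (c : Fin T.numCons)
      (args : Fin (T.arity c) → Expr S) (alts : Fin T.numCons → Expr S) :
      Rule (thread m (M.plug (F.plug (.case T (.con T c args) alts))))
        (thread m (M.plug (F.plug ((alts c).inst args))))
  | seq (m : Bool) (M : MCtx S) (F : FCtx S) (v e : Expr S) (hv : v.IsFunValue) :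
      Rule (thread m (M.plug (F.plug (.seq v e)))) (thread m (M.plug (F.plug e)))
  | lunit (m : Bool) (M : MCtx S) (e₁ e₂ : Expr S) :
      Rule (thread m (M.plug (.bind (.ret e₁) e₂))) (thread m (M.plug (.app e₂ e₁)))
  | tmvar (m : Bool) (M : MCtx S) (x : ℕ) (e : Expr S) :
      Rule (par (thread m (M.plug (.takeMVar (.var x)))) (mvar x e))
        (par (thread m (M.plug (.ret e))) (emptyMVar x))
  | pmvar (m : Bool) (M : MCtx S) (x : ℕ) (e : Expr S) :
      Rule (par (thread m (M.plug (.putMVar (.var x) e))) (emptyMVar x))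
        (par (thread m (M.plug (.ret .unit))) (mvar x e))
  | nmvar (m : Bool) (M : MCtx S) (e : Expr S) :
      Rule (thread m (M.plug (.newMVar e)))
        (nu (par (thread m ((M.shift 1).plug (.ret (.var 0)))) (mvar 0 (e.shift 1))))
  | fork (m : Bool) (M : MCtx S) (e : Expr S) :
      Rule (thread m (M.plug (.fork e)))
        (par (thread m (M.plug (.ret .unit))) (thread false e))

/-- A process is successful if it is well-formed and, up to structural congruence, of the form
`νx₁ … xₖ. (⇐ᵐᵃⁱⁿ return e | P')`, where the component `P'` may be absent. -/
def Successful (P : Proc S) : Prop :=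
  P.WellFormed ∧ ∃ (k : ℕ) (e : Expr S),
    Congr P (.nus k (.thread true (.ret e))) ∨
      ∃ P' : Proc S, Congr P (.nus k (.par (.thread true (.ret e)) P'))

/-- Standard reduction: the closure of the rules under process contexts and structural congruence,
permitted only for well-formed processes that are not successful. -/
def Step (P Q : Proc S) : Prop :=
  P.WellFormed ∧ ¬ Successful P ∧ ∃ (D : PCtx S) (P' Q' : Proc S),
    Congr P (D.plug P') ∧ Congr Q (D.plug Q') ∧ Rule P' Q'

/-- May-convergence `P↓`. -/
def MayConv (P : Proc S) : Prop :=
  P.WellFormed ∧ ∃ P', Relation.ReflTransGen Step P P' ∧ Successful P'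

/-- Should-convergence `P⇓`. -/
def ShouldConv (P : Proc S) : Prop :=
  P.WellFormed ∧ ∀ P', Relation.ReflTransGen Step P P' → MayConv P'

end CH

/-! ### The translation -/

namespace Translation

open CH CH.Expr

/-- The inner translation, where the free name `i` is represented by the variable `ρ i`, and the
MVar `stop` by the variable `s`. -/
def tauAux (S : Signature) (ρ : ℕ → ℕ) (s : ℕ) : PiStop.Proc → Expr S
  -- do {checkx <- newMVar (); putMVar (unchan x) (y, checkx); putMVar checkx (); P}
  | .out x y P =>
      .bind (newMVar unit) (lam
        (andThen (putMVar (unchan (var (ρ x + 1))) (pair (var (ρ y + 1)) (var 0)))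
          (andThen (putMVar (var 0) unit) (tauAux S (fun i => ρ i + 1) (s + 1) P))))
  -- do {(y, checkx) <- takeMVar (unchan x); takeMVar checkx; P}
  | .inp x P =>
      .bind (takeMVar (unchan (var (ρ x)))) (lam
        (case .pair (var 0) fun _ =>
          andThen (takeMVar (var 1)) (tauAux S (consRen 0 fun i => ρ i + 3) (s + 3) P)))
  -- do {forkIO Q; P}
  | .par P Q => andThen (fork (tauAux S ρ s Q)) (tauAux S ρ s P)
  -- do {chanx <- newMVar bot; takeMVar chanx; letrec x = Chan chanx in P}
  | .nu P =>
      .bind (newMVar bot) (lam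
        (andThen (takeMVar (var 0))
          (letrec 1 (fun _ => chan (var 1)) (tauAux S (consRen 0 fun i => ρ i + 2) (s + 2) P))))
  | .zero => ret unit
  | .Stop => takeMVar (var s)
  -- letrec f = do {forkIO P; f} in f
  | .bang P =>
      letrec 1 (fun _ => andThen (fork (tauAux S (fun i => ρ i + 1) (s + 1) P)) (var 0)) (var 0)

/-- The inner translation `τ`: its values are expressions in which the variable `0` is `stop`, and
the variable `i + 1` is the free name `i` of the process. -/
def tau (S : Signature) (P : PiStop.Proc) : Expr S := tauAux S Nat.succ 0 P

/-- The translation `τ₀(P) = ⇐ᵐᵃⁱⁿ do {stop <- newMVar (); forkIO τ(P); putMVar stop ()}`. -/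
def tau0 (S : Signature) (P : PiStop.Proc) : CH.Proc S :=
  .thread true (.bind (newMVar unit) (lam
    (andThen (fork (tau S P)) (putMVar (var 0) unit))))

/-- The context `ν stop. ⇐ᵐᵃⁱⁿ do {stop <- newMVar (); forkIO [·]; putMVar stop ()}`, filled with an
expression `e` whose variable `0` is `stop` and is captured by the inner binder of `stop`. -/
def Cout {S : Signature} (e : Expr S) : CH.Proc S :=
  .nu (.thread true (.bind (newMVar unit) (lam
    (andThen (fork (e.rename (upRen 1 Nat.succ))) (putMVar (var 0) unit)))))

/-- `e↓₀`. -/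
def MayConv0 {S : Signature} (e : Expr S) : Prop := CH.MayConv (Cout e)

/-- `e⇓₀`. -/
def ShouldConv0 {S : Signature} (e : Expr S) : Prop := CH.ShouldConv (Cout e)

end Translation

/-!
The translation is compared with the `π`-calculus through a description of all states that a
translated process can reach.

*Components.* A state of `CH` is opened by giving its restricted variables global names
(`CH.Proc.Open`). This turns it into a multiset of threads, MVars and bindings, which does not
change under structural congruence (`CH.Congr.open_iff`), and on which standard reduction is a
simple rewriting relation, since every thread has at most one redex (`CH.Step.gStep`,
`CH.GStep.step`).

*Configurations.* The components of a reachable state can be grouped into items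
(`Translation.Item`): every item is the translation of some `π`-process at a certain point of its
execution, such as a sender that has already looked up its channel. So a configuration, that is a
multiset of items, stands for a class of `π`-processes up to structural congruence
(`Translation.decode`). The reductions of a state are local steps of a thread, which the
representation ignores, and moves of the items (`Translation.Conf.backward`,
`Translation.Conf.forward`). Only the move in which a receiver takes the message of a sender is a
reduction of the `π`-process; the other moves do not change the class
(`Translation.decode_eq_of_mStep`, `Translation.stepQ_of_mStep`). Hence every computation of the
translation decodes to a computation of the process; this proves reflection of may-convergence.

*Simulation.* Conversely, a reduction of a class has to be realized by moves. As reduction is closed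
under structural congruence, it is first brought into a syntactic form: a process exposes its
redexes after finitely many unfoldings of replications and extrusions of restrictions
(`PiStop.Exp`, `PiStop.Congr.exp_iff`, `PiStop.StepQ.opens`), and the items can follow these
(`PiStop.Exp.drives`). After that the receiver and the sender of the reduction can communicate, with
one exception: another sender may already have put its message into the MVar of the channel, and
this cannot be undone. A computation that starts with no such sender never needs to produce one, so
`Translation.Good.simulates_all` realizes all reductions of the process from the initial state; this
proves preservation of may-convergence and, together with the decoding of computations, reflection
of should-convergence.

*Should-convergence.* If such a sender exists, then the communication of the given receiver with
this sender is a different reduction of the `π`-process, after which there is one committed sender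
less (`Translation.Good.simulates`). When the process should converge, it may still converge after
this reduction, and induction on the number of committed senders shows that every reachable state of
the translation may converge (`Translation.Good.may`).
-/

/-! ### Renamings -/

@[simp] theorem upRen_one_zero (ρ : ℕ → ℕ) : upRen 1 ρ 0 = 0 := rfl

@[simp] theorem upRen_one_succ (ρ : ℕ → ℕ) (i : ℕ) : upRen 1 ρ (i + 1) = ρ i + 1 := by
  simp [upRen]

@[simp] theorem consRen_zero (z : ℕ) (ρ : ℕ → ℕ) : consRen z ρ 0 = z := rfl

@[simp] theorem consRen_succ (z : ℕ) (ρ : ℕ → ℕ) (i : ℕ) : consRen z ρ (i + 1) = ρ i := rfl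

theorem upRen_id (k : ℕ) : upRen k id = id := by
  funext i
  simp only [upRen, id]
  split <;> omega

theorem upRen_comp (k : ℕ) (ρ σ : ℕ → ℕ) : upRen k ρ ∘ upRen k σ = upRen k (ρ ∘ σ) := by
  funext i
  simp only [upRen, Function.comp]
  by_cases h : i < k <;> simp [h]

theorem consRen_comp_upRen (z : ℕ) (ρ σ : ℕ → ℕ) :
    consRen z ρ ∘ upRen 1 σ = consRen z (ρ ∘ σ) := by
  funext i
  cases i <;> simp

theorem comp_consRen (z : ℕ) (ρ σ : ℕ → ℕ) : ρ ∘ consRen z σ = consRen (ρ z) (ρ ∘ σ) := by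
  funext i
  cases i <;> simp

theorem consRen_comp_succ (z : ℕ) (ρ : ℕ → ℕ) : consRen z ρ ∘ Nat.succ = ρ := rfl

theorem consRen_consRen_comp_swapRen (a b : ℕ) (ρ : ℕ → ℕ) :
    consRen a (consRen b ρ) ∘ swapRen = consRen b (consRen a ρ) := by
  funext i
  rcases i with _ | _ | i <;> rfl

/-- There are infinitely many names outside `W`. -/
def CoInf (W : Set ℕ) : Prop := Wᶜ.Infinite

theorem CoInf.union {W F : Set ℕ} (hW : CoInf W) (hF : F.Finite) : CoInf (W ∪ F) := by
  rw [CoInf, Set.compl_union, ← Set.sdiff_eq]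
  exact hW.sdiff hF

theorem CoInf.exists_notMem {W : Set ℕ} (hW : CoInf W) : ∃ a, a ∉ W := hW.nonempty

theorem Set.Finite.coInf {W : Set ℕ} (hW : W.Finite) : CoInf W := hW.infinite_compl

namespace PiStop

namespace Proc

theorem rename_rename (P : Proc) (ρ σ : ℕ → ℕ) : (P.rename σ).rename ρ = P.rename (ρ ∘ σ) := by
  induction P generalizing ρ σ <;> simp_all [rename, upRen_comp]

theorem rename_congr {P : Proc} {ρ σ : ℕ → ℕ} (h : ∀ i ∈ P.FN, ρ i = σ i) :
    P.rename ρ = P.rename σ := by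
  induction P generalizing ρ σ with
  | nu P ih =>
    simp only [rename]
    rw [ih]
    rintro (_ | i) hi
    · rfl
    · simpa using h i hi
  | inp x P ih =>
    simp only [rename]
    rw [ih, h x (by simp [FN])]
    rintro (_ | i) hi
    · rfl
    · simpa using h i (by simp [FN, hi])
  | out x y P ih =>
    simp only [rename]
    rw [ih fun i hi => h i (by simp [FN, hi]), h x (by simp [FN]), h y (by simp [FN])]
  | bang P ih => simp only [rename]; rw [ih h]
  | par P Q ih1 ih2 =>
    simp only [rename]
    rw [ih1 fun i hi => h i (by simp [FN, hi]), ih2 fun i hi => h i (by simp [FN, hi])]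
  | zero => rfl
  | Stop => rfl

@[simp] theorem rename_id (P : Proc) : P.rename id = P := by
  induction P <;> simp_all [rename, upRen_id]

theorem FN_rename (P : Proc) (ρ : ℕ → ℕ) : (P.rename ρ).FN = ρ '' P.FN := by
  have key : ∀ (s : Set ℕ) (ρ : ℕ → ℕ),
      {i | i + 1 ∈ upRen 1 ρ '' s} = ρ '' {i | i + 1 ∈ s} := by
    intro s ρ
    ext i
    constructor
    · rintro ⟨_ | j, hj, h⟩
      · simp at h
      · exact ⟨j, hj, by simpa using h⟩
    · rintro ⟨j, hj, rfl⟩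
      exact ⟨j + 1, hj, by simp⟩
  induction P generalizing ρ with
  | nu P ih => simp only [rename, FN, ih, key]
  | inp x P ih => simp only [rename, FN, ih, key, Set.image_union, Set.image_singleton]
  | out x y P ih => simp only [rename, FN, ih, Set.image_union, Set.image_pair]
  | bang P ih => simp only [rename, FN, ih]
  | par P Q ih1 ih2 => simp only [rename, FN, ih1, ih2, Set.image_union]
  | zero => simp [rename, FN]
  | Stop => simp [rename, FN]

theorem FN_finite (P : Proc) : P.FN.Finite := by
  have key : ∀ s : Set ℕ, s.Finite → {i | i + 1 ∈ s}.Finite := fun s hs =>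
    hs.preimage (Function.Injective.injOn (add_left_injective 1))
  induction P with
  | nu P ih => exact key _ ih
  | inp x P ih => exact (Set.finite_singleton x).union (key _ ih)
  | out x y P ih => exact (Set.toFinite {x, y}).union ih
  | bang P ih => exact ih
  | par P Q ih1 ih2 => exact ih1.union ih2
  | zero => exact Set.finite_empty
  | Stop => exact Set.finite_empty

theorem rename_eq_self {P : Proc} {ρ : ℕ → ℕ} (h : ∀ i ∈ P.FN, ρ i = i) : P.rename ρ = P :=
  (rename_congr (σ := id) h).trans (rename_id P)

theorem rename_of_closed {P : Proc} (h : P.Closed) (ρ : ℕ → ℕ) : P.rename ρ = P :=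
  rename_eq_self fun i hi => by rw [h] at hi; exact hi.elim

theorem mem_FN_nu {P : Proc} {i : ℕ} : i ∈ (nu P).FN ↔ i + 1 ∈ P.FN := Iff.rfl

/-- When a binder is opened with the name `a`, the other free names stay the same. -/
theorem mem_FN_rename_consRen {P : Proc} {ρ : ℕ → ℕ} {a i : ℕ}
    (h : i ∈ (P.rename (consRen a ρ)).FN) : i = a ∨ i ∈ ((nu P).rename ρ).FN := by
  rw [FN_rename] at h ⊢
  obtain ⟨_ | j, hj, rfl⟩ := h
  · exact Or.inl rfl
  · exact Or.inr ⟨j, hj, rfl⟩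

theorem mem_FN_rename_nu {P : Proc} {ρ : ℕ → ℕ} {a i : ℕ}
    (h : i ∈ ((nu P).rename ρ).FN) : i ∈ (P.rename (consRen a ρ)).FN := by
  rw [FN_rename] at h ⊢
  obtain ⟨j, hj, rfl⟩ := h
  exact ⟨j + 1, hj, rfl⟩

end Proc

open Proc

/-- Structurally congruent processes have the same free names, so that these are defined for
classes. -/
theorem Congr.FN_eq {P Q : Proc} (h : Congr P Q) : P.FN = Q.FN := by
  induction h with
  | refl => rfl
  | symm _ ih => exact ih.symm
  | trans _ _ ih1 ih2 => exact ih1.trans ih2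
  | nu _ ih => simp only [Proc.FN, ih]
  | out _ _ _ ih => simp only [Proc.FN, ih]
  | inp _ _ ih => simp only [Proc.FN, ih]
  | bang _ ih => simp only [Proc.FN, ih]
  | par _ _ ih1 ih2 => simp only [Proc.FN, ih1, ih2]
  | par_assoc => simp only [Proc.FN, Set.union_assoc]
  | par_comm => simp only [Proc.FN, Set.union_comm]
  | par_zero => simp [Proc.FN]
  | nu_par P Q =>
    simp only [Proc.FN, Proc.shift, FN_rename]
    ext i
    simp
  | nu_zero => rfl
  | nu_stop => rfl
  | nu_nu P =>
    ext i
    simp only [mem_FN_nu, FN_rename]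
    constructor
    · intro h; exact ⟨_, h, rfl⟩
    · rintro ⟨_ | _ | j, hj, h⟩ <;> simp [swapRen] at h
      subst h; exact hj
  | bang_unfold => simp [Proc.FN]

theorem Congr.rename {P Q : Proc} (h : Congr P Q) (ρ : ℕ → ℕ) :
    Congr (P.rename ρ) (Q.rename ρ) := by
  induction h generalizing ρ with
  | refl => exact .refl _
  | symm _ ih => exact (ih ρ).symm
  | trans _ _ ih1 ih2 => exact (ih1 ρ).trans (ih2 ρ)
  | nu _ ih => exact (ih _).nu
  | out _ _ _ ih => exact (ih _).out _ _
  | inp _ _ ih => exact (ih _).inp _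
  | bang _ ih => exact (ih _).bang
  | par _ _ ih1 ih2 => exact (ih1 ρ).par (ih2 ρ)
  | par_assoc => exact .par_assoc _ _ _
  | par_comm => exact .par_comm _ _
  | par_zero => exact .par_zero _
  | nu_par P Q =>
    simp only [Proc.rename, Proc.shift, rename_rename]
    have : upRen 1 ρ ∘ Nat.succ = Nat.succ ∘ ρ := by funext i; simp
    rw [this, ← rename_rename]
    exact .nu_par _ _
  | nu_zero => exact .nu_zero
  | nu_stop => exact Congr.nu_stop
  | nu_nu P =>
    simp only [Proc.rename, rename_rename]
    have : upRen 1 (upRen 1 ρ) ∘ swapRen = swapRen ∘ upRen 1 (upRen 1 ρ) := by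
      funext i; rcases i with _ | _ | i <;> simp [swapRen]
    rw [this, ← rename_rename]
    exact .nu_nu _
  | bang_unfold P => exact .bang_unfold _

/-! ### Processes up to structural congruence -/

/-- Structural congruence as a setoid. -/
def congrSetoid : Setoid Proc := ⟨Congr, .refl, .symm, .trans⟩

/-- Processes up to structural congruence. They form a commutative monoid under parallel
composition. -/
def Cls : Type := Quotient congrSetoid

/-- The class of a process. -/
def cls (P : Proc) : Cls := Quotient.mk congrSetoid P

theorem cls_eq {P Q : Proc} : cls P = cls Q ↔ Congr P Q := Quotient.eq (r := congrSetoid)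

theorem cls_surj (p : Cls) : ∃ P, cls P = p := Quotient.exists_rep p

namespace Cls

instance : Add Cls :=
  ⟨Quotient.map₂ Proc.par fun _ _ h _ _ h' => Congr.par h h'⟩

instance : Zero Cls := ⟨cls .zero⟩

theorem cls_par (P Q : Proc) : cls (.par P Q) = cls P + cls Q := rfl

theorem cls_zero : cls .zero = 0 := rfl

instance : AddCommMonoid Cls where
  add_assoc p q r := by
    obtain ⟨P, rfl⟩ := cls_surj p
    obtain ⟨Q, rfl⟩ := cls_surj q
    obtain ⟨R, rfl⟩ := cls_surj r
    exact cls_eq.2 (Congr.par_assoc P Q R).symm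
  add_comm p q := by
    obtain ⟨P, rfl⟩ := cls_surj p
    obtain ⟨Q, rfl⟩ := cls_surj q
    exact cls_eq.2 (Congr.par_comm P Q)
  add_zero p := by
    obtain ⟨P, rfl⟩ := cls_surj p
    exact cls_eq.2 (Congr.par_zero P)
  zero_add p := by
    obtain ⟨P, rfl⟩ := cls_surj p
    exact cls_eq.2 ((Congr.par_comm _ _).trans (Congr.par_zero P))
  nsmul := nsmulRec

/-- Renaming of the free names. -/
def ren (ρ : ℕ → ℕ) : Cls → Cls := Quotient.map (Proc.rename ρ) fun _ _ h => h.rename ρ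

/-- The free names; structural congruence preserves them. -/
def FN : Cls → Set ℕ := Quotient.lift Proc.FN fun _ _ h => h.FN_eq

theorem ren_cls (ρ : ℕ → ℕ) (P : Proc) : ren ρ (cls P) = cls (P.rename ρ) := rfl

theorem FN_cls (P : Proc) : FN (cls P) = P.FN := rfl

/-- `(νx)` applied to a class, where `x` is the index `0`. -/
def nu : Cls → Cls := Quotient.map Proc.nu fun _ _ h => h.nu

@[simp] theorem ren_add (ρ : ℕ → ℕ) (p q : Cls) : ren ρ (p + q) = ren ρ p + ren ρ q := by
  obtain ⟨P, rfl⟩ := cls_surj p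
  obtain ⟨Q, rfl⟩ := cls_surj q
  rfl

theorem ren_ren (ρ σ : ℕ → ℕ) (p : Cls) : ren ρ (ren σ p) = ren (ρ ∘ σ) p := by
  obtain ⟨P, rfl⟩ := cls_surj p
  simp only [ren_cls, rename_rename]

theorem ren_congr {ρ σ : ℕ → ℕ} {p : Cls} (h : ∀ i ∈ p.FN, ρ i = σ i) : ren ρ p = ren σ p := by
  obtain ⟨P, rfl⟩ := cls_surj p
  simp only [ren_cls, rename_congr h]

theorem ren_eq_self {ρ : ℕ → ℕ} {p : Cls} (h : ∀ i ∈ p.FN, ρ i = i) : ren ρ p = p := by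
  obtain ⟨P, rfl⟩ := cls_surj p
  simp only [ren_cls, rename_eq_self h]

@[simp] theorem FN_add (p q : Cls) : FN (p + q) = p.FN ∪ q.FN := by
  obtain ⟨P, rfl⟩ := cls_surj p
  obtain ⟨Q, rfl⟩ := cls_surj q
  rfl

@[simp] theorem FN_zero : FN 0 = ∅ := rfl

theorem FN_ren (ρ : ℕ → ℕ) (p : Cls) : (ren ρ p).FN = ρ '' p.FN := by
  obtain ⟨P, rfl⟩ := cls_surj p
  exact FN_rename P ρ

theorem FN_finite (p : Cls) : p.FN.Finite := by
  obtain ⟨P, rfl⟩ := cls_surj p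
  exact P.FN_finite

end Cls

/-- The renaming that turns the global name `a` into the index `0`, which is about to be bound. -/
def cloRen (a i : ℕ) : ℕ := if i = a then 0 else i + 1

theorem cloRen_self (a : ℕ) : cloRen a a = 0 := by simp [cloRen]

theorem cloRen_of_ne {a i : ℕ} (h : i ≠ a) : cloRen a i = i + 1 := by simp [cloRen, h]

namespace Cls

/-- Restriction `νa` of the *global* name `a`. -/
def nuN (a : ℕ) (p : Cls) : Cls := nu (ren (cloRen a) p)

theorem FN_nuN (a : ℕ) (p : Cls) : (nuN a p).FN = p.FN \ {a} := by
  obtain ⟨P, rfl⟩ := cls_surj p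
  show (Proc.nu (P.rename (cloRen a))).FN = _
  ext i
  rw [mem_FN_nu, FN_rename]
  constructor
  · rintro ⟨j, hj, h⟩
    by_cases hja : j = a
    · subst hja; simp [cloRen_self] at h
    · rw [cloRen_of_ne hja] at h
      obtain rfl : j = i := by omega
      exact ⟨hj, hja⟩
  · rintro ⟨hi, hia⟩
    exact ⟨i, hi, cloRen_of_ne hia⟩

theorem nuN_add {a : ℕ} {p : Cls} (h : a ∉ p.FN) (q : Cls) : nuN a (p + q) = p + nuN a q := by
  obtain ⟨P, rfl⟩ := cls_surj p
  obtain ⟨Q, rfl⟩ := cls_surj q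
  have : P.rename (cloRen a) = P.shift :=
    rename_congr fun i hi => cloRen_of_ne fun hia => h (hia ▸ hi)
  show cls (.nu (.par (P.rename (cloRen a)) _)) = cls (.par P (.nu _))
  rw [this]
  exact cls_eq.2 (Congr.nu_par _ _)

@[simp] theorem nuN_zero (a : ℕ) : nuN a 0 = 0 := cls_eq.2 Congr.nu_zero

theorem nuN_fresh {a : ℕ} {p : Cls} (h : a ∉ p.FN) : nuN a p = p := by
  simpa using nuN_add h 0

theorem nuN_comm (a b : ℕ) (p : Cls) : nuN a (nuN b p) = nuN b (nuN a p) := by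
  rcases eq_or_ne a b with rfl | hab
  · rfl
  obtain ⟨P, rfl⟩ := cls_surj p
  show cls (.nu (.nu ((P.rename _).rename _))) = cls (.nu (.nu ((P.rename _).rename _)))
  refine cls_eq.2 ((Congr.nu_nu _).trans ?_)
  rw [rename_rename, rename_rename, rename_rename]
  have : (swapRen ∘ upRen 1 (cloRen a)) ∘ cloRen b = upRen 1 (cloRen b) ∘ cloRen a := by
    funext i
    simp only [Function.comp]
    by_cases h1 : i = a
    · subst h1
      rw [cloRen_of_ne hab, cloRen_self, upRen_one_succ, cloRen_self]
      rfl
    · by_cases h2 : i = b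
      · subst h2
        rw [cloRen_self, cloRen_of_ne h1, upRen_one_succ, cloRen_self]
        rfl
      · rw [cloRen_of_ne h1, cloRen_of_ne h2, upRen_one_succ, upRen_one_succ, cloRen_of_ne h1,
          cloRen_of_ne h2]
        rfl
  rw [this]
  exact .refl _

/-- `α`-conversion of a restricted global name. -/
theorem nuN_swap {a b : ℕ} {p : Cls} (h : b ∉ p.FN) :
    nuN b (ren (Equiv.swap a b) p) = nuN a p := by
  unfold nuN
  rw [ren_ren]
  congr 1
  refine ren_congr fun i hi => ?_
  have hib : i ≠ b := fun hib => h (hib ▸ hi)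
  by_cases hia : i = a
  · subst hia; simp [cloRen]
  · simp [Equiv.swap_apply_of_ne_of_ne hia hib, cloRen, hia, hib]

theorem ren_nuN {f : ℕ → ℕ} (hf : f.Injective) (a : ℕ) (p : Cls) :
    ren f (nuN a p) = nuN (f a) (ren f p) := by
  obtain ⟨P, rfl⟩ := cls_surj p
  show cls (.nu ((P.rename _).rename _)) = cls (.nu ((P.rename _).rename _))
  rw [rename_rename, rename_rename]
  congr 3
  funext i
  by_cases h : i = a
  · subst h; simp [cloRen]
  · simp [cloRen, h, hf.ne h]

/-- A binder can be opened with any fresh global name. -/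
theorem cls_rename_nu {P : Proc} {ρ : ℕ → ℕ} {a : ℕ} (h : a ∉ ((Proc.nu P).rename ρ).FN) :
    cls ((Proc.nu P).rename ρ) = nuN a (cls (P.rename (consRen a ρ))) := by
  show cls (.nu _) = cls (.nu ((P.rename _).rename _))
  rw [rename_rename]
  congr 2
  refine rename_congr ?_
  rintro (_ | i) hi
  · simp [cloRen]
  · have : ρ i ≠ a := by
      rintro rfl
      exact h (by rw [FN_rename]; exact ⟨i, hi, rfl⟩)
    simp [cloRen, this]

instance : LeftCommutative nuN := ⟨nuN_comm⟩

/-- Restriction of a finite set of global names. -/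
def close (X : Finset ℕ) (p : Cls) : Cls := X.val.foldr nuN p

@[simp] theorem close_empty (p : Cls) : close ∅ p = p := rfl

theorem close_insert {a : ℕ} {X : Finset ℕ} (h : a ∉ X) (p : Cls) :
    close (insert a X) p = nuN a (close X p) := by
  simp [close, Finset.insert_val_of_notMem h]

theorem nuN_close (a : ℕ) (X : Finset ℕ) (p : Cls) : nuN a (close X p) = close X (nuN a p) := by
  induction X using Finset.induction_on with
  | empty => rfl
  | insert b X h ih => rw [close_insert h, close_insert h, nuN_comm, ih]

theorem close_union {X Y : Finset ℕ} (h : Disjoint X Y) (p : Cls) :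
    close (X ∪ Y) p = close X (close Y p) := by
  induction X using Finset.induction_on with
  | empty => simp
  | insert b X hb ih =>
    rw [Finset.disjoint_insert_left] at h
    rw [Finset.insert_union, close_insert hb, close_insert (by simp [hb, h.1]), ih h.2]

theorem FN_close (X : Finset ℕ) (p : Cls) : (close X p).FN = p.FN \ X := by
  induction X using Finset.induction_on with
  | empty => simp
  | insert b X h ih =>
    rw [close_insert h, FN_nuN, ih, Set.sdiff_sdiff, Finset.coe_insert, Set.union_singleton]

theorem close_add {X : Finset ℕ} {p : Cls} (h : ∀ x ∈ X, x ∉ p.FN) (q : Cls) :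
    close X (p + q) = p + close X q := by
  induction X using Finset.induction_on with
  | empty => rfl
  | insert b X hb ih =>
    rw [close_insert hb, close_insert hb, ih fun x hx => h x (by simp [hx]),
      nuN_add (h b (by simp))]

theorem close_add_right {X : Finset ℕ} {q : Cls} (h : ∀ x ∈ X, x ∉ q.FN) (p : Cls) :
    close X (p + q) = close X p + q := by
  rw [add_comm, close_add h, add_comm]

@[simp] theorem close_zero (X : Finset ℕ) : close X 0 = 0 := by
  induction X using Finset.induction_on with
  | empty => rfl
  | insert b X h ih => rw [close_insert h, ih, nuN_zero]

theorem ren_close (π : Equiv.Perm ℕ) (X : Finset ℕ) (p : Cls) :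
    ren π (close X p) = close (X.map π.toEmbedding) (ren π p) := by
  induction X using Finset.induction_on with
  | empty => simp
  | insert b X h ih =>
    rw [close_insert h, ren_nuN π.injective, ih, Finset.map_insert, close_insert (by simpa using h)]
    rfl

end Cls

end PiStop

namespace PiStop
open Proc Cls

/-! ### Exposing prefixes -/

/-- The parts of a process that take part in reductions: inputs, outputs and `Stop`, with their
continuations up to structural congruence. In `inp x p` the received name is the index `0`
of `p`. -/
inductive Pre : Type
  | inp (x : ℕ) (p : Cls)
  | out (x z : ℕ) (p : Cls)
  | halt

namespace Pre

/-- The class of the process that consists of the given prefix. -/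
def toCls : Pre → Cls
  | inp x p => Quotient.map (Proc.inp x) (fun _ _ (h : Congr _ _) => h.inp x) p
  | out x z p => Quotient.map (Proc.out x z) (fun _ _ (h : Congr _ _) => h.out x z) p
  | halt => cls .Stop

/-- The free names of a prefix. -/
def FN : Pre → Set ℕ
  | inp x p => {x} ∪ {i | i + 1 ∈ p.FN}
  | out x z p => {x, z} ∪ p.FN
  | halt => ∅

/-- Renaming of the free names. -/
def ren (ρ : ℕ → ℕ) : Pre → Pre
  | inp x p => inp (ρ x) (p.ren (upRen 1 ρ))
  | out x z p => out (ρ x) (ρ z) (p.ren ρ)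
  | halt => halt

theorem FN_toCls (a : Pre) : a.toCls.FN = a.FN := by
  cases a with
  | inp x p => obtain ⟨P, rfl⟩ := cls_surj p; rfl
  | out x z p => obtain ⟨P, rfl⟩ := cls_surj p; rfl
  | halt => rfl

theorem toCls_ren (ρ : ℕ → ℕ) (a : Pre) : (a.ren ρ).toCls = a.toCls.ren ρ := by
  cases a with
  | inp x p => obtain ⟨P, rfl⟩ := cls_surj p; rfl
  | out x z p => obtain ⟨P, rfl⟩ := cls_surj p; rfl
  | halt => rfl

theorem FN_ren (ρ : ℕ → ℕ) (a : Pre) : (a.ren ρ).FN = ρ '' a.FN := by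
  rw [← FN_toCls, toCls_ren, Cls.FN_ren, FN_toCls]

theorem ren_eq_self {ρ : ℕ → ℕ} {a : Pre} (h : ∀ i ∈ a.FN, ρ i = i) : a.ren ρ = a := by
  cases a with
  | inp x p =>
    simp only [ren]
    rw [h x (by simp [FN]), Cls.ren_eq_self]
    rintro (_ | i) hi
    · rfl
    · simpa using h i (by simp [FN, hi])
  | out x z p =>
    simp only [ren]
    rw [h x (by simp [FN]), h z (by simp [FN]), Cls.ren_eq_self fun i hi => h i (by simp [FN, hi])]
  | halt => rfl

end Pre

/-- The free names of several prefixes. -/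
def FNs (α : Multiset Pre) : Set ℕ := {i | ∃ a ∈ α, i ∈ a.FN}

@[simp] theorem FNs_zero : FNs 0 = ∅ := by simp [FNs]

@[simp] theorem FNs_add (α β : Multiset Pre) : FNs (α + β) = FNs α ∪ FNs β := by
  ext i
  simp only [FNs, Multiset.mem_add, Set.mem_ofPred_eq, Set.mem_union, or_and_right, exists_or]

@[simp] theorem FNs_singleton (a : Pre) : FNs {a} = a.FN := by simp [FNs]

theorem FNs_map_ren (ρ : ℕ → ℕ) (α : Multiset Pre) : FNs (α.map (Pre.ren ρ)) = ρ '' FNs α := by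
  ext i
  simp only [FNs, Multiset.mem_map, Set.mem_ofPred_eq, Set.mem_image]
  constructor
  · rintro ⟨_, ⟨a, ha, rfl⟩, hi⟩
    rw [Pre.FN_ren] at hi
    obtain ⟨j, hj, rfl⟩ := hi
    exact ⟨j, ⟨a, ha, hj⟩, rfl⟩
  · rintro ⟨j, ⟨a, ha, hj⟩, rfl⟩
    exact ⟨_, ⟨a, ha, rfl⟩, by rw [Pre.FN_ren]; exact ⟨j, hj, rfl⟩⟩

theorem FNs_finite (α : Multiset Pre) : (FNs α).Finite := by
  induction α using Multiset.induction_on with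
  | empty => simp
  | cons a s ih =>
    rw [← Multiset.singleton_add, FNs_add, FNs_singleton, ← Pre.FN_toCls]
    exact a.toCls.FN_finite.union ih

theorem map_ren_eq_self {ρ : ℕ → ℕ} {α : Multiset Pre} (h : ∀ i ∈ FNs α, ρ i = i) :
    α.map (Pre.ren ρ) = α :=
  (Multiset.map_congr rfl fun a ha => Pre.ren_eq_self fun i hi => h i ⟨a, ha, hi⟩).trans
    (Multiset.map_id' α)

/-- Prefixes, replications and `Stop`: the processes that an exposure may leave as they are. -/
def Proc.Rigid : Proc → Prop
  | nu _ => False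
  | par _ _ => False
  | zero => False
  | _ => True

/-- `Exp k P ρ B α r`: the process `P`, whose free name `i` is given the global name `ρ i`, exposes
the prefixes `α` while extruding the global names `B`, and leaves the residual `r`; thus `P` is
congruent to `νB. (α | r)`. If `k` is true, then a restriction on the way to the exposed prefixes is
extruded only if it binds one of their free names, and the other restrictions stay with the
residual; if `k` is false, then all of them are extruded. The first version is invariant under
structural congruence, since it does not extrude restrictions such as that of `νx.0`; the second
version is the one that the translation can follow, since its restrictions are executed eagerly. -/
inductive Exp (k : Bool) : Proc → (ℕ → ℕ) → Finset ℕ → Multiset Pre → Cls → Prop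
  | leaf {P : Proc} (ρ : ℕ → ℕ) (h : P.Rigid) : Exp k P ρ ∅ 0 (cls (P.rename ρ))
  | zero (ρ : ℕ → ℕ) : Exp k .zero ρ ∅ 0 0
  | inp (x : ℕ) (P : Proc) (ρ : ℕ → ℕ) :
      Exp k (.inp x P) ρ ∅ {.inp (ρ x) (cls (P.rename (upRen 1 ρ)))} 0
  | out (x z : ℕ) (P : Proc) (ρ : ℕ → ℕ) :
      Exp k (.out x z P) ρ ∅ {.out (ρ x) (ρ z) (cls (P.rename ρ))} 0
  | halt (ρ : ℕ → ℕ) : Exp k .Stop ρ ∅ {.halt} 0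
  | par {P Q : Proc} {ρ : ℕ → ℕ} {B C : Finset ℕ} {α β : Multiset Pre} {r t : Cls}
      (hP : Exp k P ρ B α r) (hQ : Exp k Q ρ C β t) (hd : Disjoint B C)
      (hB : ∀ x ∈ B, x ∉ (Q.rename ρ).FN) (hC : ∀ x ∈ C, x ∉ (P.rename ρ).FN) :
      Exp k (.par P Q) ρ (B ∪ C) (α + β) (r + t)
  | bang {P : Proc} {ρ : ℕ → ℕ} {B C : Finset ℕ} {α β : Multiset Pre} {r t : Cls}
      (hP : Exp k P ρ B α r) (hQ : Exp k (.bang P) ρ C β t) (hd : Disjoint B C)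
      (hB : ∀ x ∈ B, x ∉ (P.rename ρ).FN) (hC : ∀ x ∈ C, x ∉ (P.rename ρ).FN) :
      Exp k (.bang P) ρ (B ∪ C) (α + β) (r + t)
  | nuOpen {P : Proc} {ρ : ℕ → ℕ} {a : ℕ} {B : Finset ℕ} {α : Multiset Pre} {r : Cls}
      (hP : Exp k P (consRen a ρ) B α r) (haB : a ∉ B) (ha : a ∉ ((Proc.nu P).rename ρ).FN)
      (hk : k = true → a ∈ FNs α) : Exp k (.nu P) ρ (insert a B) α r
  | nuKeep {P : Proc} {ρ : ℕ → ℕ} {a : ℕ} {B : Finset ℕ} {α : Multiset Pre} {r : Cls}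
      (hP : Exp k P (consRen a ρ) B α r) (haB : a ∉ B) (ha : a ∉ ((Proc.nu P).rename ρ).FN)
      (hk : k = true) (haα : a ∉ FNs α) : Exp k (.nu P) ρ B α (nuN a r)

variable {k : Bool} {P Q : Proc} {ρ : ℕ → ℕ} {B : Finset ℕ} {α : Multiset Pre} {r : Cls}

/-- Exposure is equivariant under permutations of the global names, and it depends on the names of
the process only through the global names that they stand for. -/
theorem Exp.map {σ : ℕ → ℕ} (h : Exp k P σ B α r) (π : Equiv.Perm ℕ) {f ρ : ℕ → ℕ}
    (hf : ∀ i ∈ P.FN, π (σ i) = ρ (f i)) :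
    Exp k (P.rename f) ρ (B.map π.toEmbedding) (α.map (Pre.ren π)) (r.ren π) := by
  have key : ∀ {P : Proc} {σ ρ f : ℕ → ℕ}, (∀ i ∈ P.FN, π (σ i) = ρ (f i)) →
      (P.rename f).rename ρ = (P.rename σ).rename π := fun h => by
    rw [rename_rename, rename_rename]
    exact (rename_congr h).symm
  have hup : ∀ {P : Proc} {σ ρ f : ℕ → ℕ}, (∀ i ∈ (Proc.nu P).FN, π (σ i) = ρ (f i)) →
      ∀ i ∈ P.FN, upRen 1 π (upRen 1 σ i) = upRen 1 ρ (upRen 1 f i) := by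
    rintro P σ ρ f h (_ | i) hi
    · rfl
    · simpa using h i hi
  have hcons : ∀ {P : Proc} {σ ρ f : ℕ → ℕ} {a : ℕ}, (∀ i ∈ (Proc.nu P).FN, π (σ i) = ρ (f i)) →
      ∀ i ∈ P.FN, π (consRen a σ i) = consRen (π a) ρ (upRen 1 f i) := by
    rintro P σ ρ f a h (_ | i) hi
    · rfl
    · simpa using h i hi
  have fresh : ∀ {P : Proc} {σ ρ f : ℕ → ℕ}, (∀ i ∈ P.FN, π (σ i) = ρ (f i)) →
      ∀ {a}, a ∉ (P.rename σ).FN → π a ∉ ((P.rename f).rename ρ).FN := by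
    intro P σ ρ f h a ha
    rw [key h, FN_rename]
    rintro ⟨j, hj, hja⟩
    exact ha (π.injective hja ▸ hj)
  have memFNs : ∀ {a : ℕ} {α : Multiset Pre}, π a ∈ FNs (α.map (Pre.ren π)) ↔ a ∈ FNs α := by
    intro a α
    rw [FNs_map_ren, Set.mem_image]
    exact ⟨fun ⟨j, hj, h⟩ => π.injective h ▸ hj, fun h => ⟨a, h, rfl⟩⟩
  induction h generalizing f ρ with
  | @leaf P σ h =>
    rw [ren_cls, ← key hf]
    refine .leaf _ ?_
    cases P <;> simp_all [Rigid, Proc.rename]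
  | zero => exact .zero _
  | inp x P σ =>
    have h1 : π (σ x) = ρ (f x) := hf x (by simp [Proc.FN])
    have h2 : (P.rename (upRen 1 σ)).rename (upRen 1 π) =
        (P.rename (upRen 1 f)).rename (upRen 1 ρ) := by
      rw [rename_rename, rename_rename]
      exact rename_congr (hup fun i hi => hf i (Or.inr hi))
    simp only [Multiset.map_singleton, Pre.ren, ren_cls, h1, h2]
    exact .inp _ _ _
  | out x z P σ =>
    have h1 : π (σ x) = ρ (f x) := hf x (by simp [Proc.FN])
    have h3 : π (σ z) = ρ (f z) := hf z (by simp [Proc.FN])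
    simp only [Multiset.map_singleton, Pre.ren, ren_cls, h1, h3]
    rw [← key fun i hi => hf i (Or.inr hi)]
    exact .out _ _ _ _
  | halt => exact .halt _
  | par _ _ hd hB hC ih1 ih2 =>
    rw [Finset.map_union, Multiset.map_add, ren_add]
    have h1 := fun i hi => hf i (Or.inl hi)
    have h2 := fun i hi => hf i (Or.inr hi)
    refine .par (ih1 h1) (ih2 h2) ((Finset.disjoint_map _).2 hd) ?_ ?_
    · intro y hy
      obtain ⟨x, hx, rfl⟩ := Finset.mem_map.1 hy
      exact fresh h2 (hB x hx)
    · intro y hy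
      obtain ⟨x, hx, rfl⟩ := Finset.mem_map.1 hy
      exact fresh h1 (hC x hx)
  | bang _ _ hd hB hC ih1 ih2 =>
    rw [Finset.map_union, Multiset.map_add, ren_add]
    refine .bang (ih1 hf) (ih2 hf) ((Finset.disjoint_map _).2 hd) ?_ ?_
    · intro y hy
      obtain ⟨x, hx, rfl⟩ := Finset.mem_map.1 hy
      exact fresh hf (hB x hx)
    · intro y hy
      obtain ⟨x, hx, rfl⟩ := Finset.mem_map.1 hy
      exact fresh hf (hC x hx)
  | @nuOpen P σ a B α r _ haB ha hk ih =>
    rw [Finset.map_insert]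
    refine .nuOpen (ih (hcons hf)) (by simpa using haB) ?_ fun h => memFNs.2 (hk h)
    exact fresh hf ha
  | @nuKeep P σ a B α r _ haB ha hk haα ih =>
    rw [ren_nuN π.injective]
    exact .nuKeep (ih (hcons hf)) (by simpa using haB) (fresh hf ha) hk (memFNs.not.2 haα)

/-- The extruded names are not free in the process, and what is exposed has no other free names than
those of the process and the extruded ones. -/
theorem Exp.FN (h : Exp k P ρ B α r) :
    FNs α ⊆ (P.rename ρ).FN ∪ B ∧ r.FN ⊆ (P.rename ρ).FN ∪ B ∧ ∀ x ∈ B, x ∉ (P.rename ρ).FN := by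
  induction h with
  | leaf ρ h => simp [FN_cls]
  | zero => simp
  | inp x P ρ => simp only [FNs_singleton, Cls.FN_zero]; simp [Pre.FN, FN_cls, Proc.rename, Proc.FN]
  | out x z P ρ =>
    simp only [FNs_singleton, Cls.FN_zero]
    simp [Pre.FN, FN_cls, Proc.rename, Proc.FN]
  | halt => simp [Pre.FN]
  | par _ _ hd hB hC ih1 ih2 =>
    obtain ⟨a1, b1, c1⟩ := ih1
    obtain ⟨a2, b2, c2⟩ := ih2
    simp only [FNs_add, Cls.FN_add, Proc.rename, Proc.FN, Finset.coe_union]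
    refine ⟨?_, ?_, ?_⟩
    · rintro x (hx | hx)
      · rcases a1 hx with h | h <;> simp [h]
      · rcases a2 hx with h | h <;> simp [h]
    · rintro x (hx | hx)
      · rcases b1 hx with h | h <;> simp [h]
      · rcases b2 hx with h | h <;> simp [h]
    · intro x hx
      rcases Finset.mem_union.1 hx with h | h
      · simp [c1 x h, hB x h]
      · simp [c2 x h, hC x h]
  | bang _ _ hd hB hC ih1 ih2 =>
    obtain ⟨a1, b1, c1⟩ := ih1
    obtain ⟨a2, b2, c2⟩ := ih2
    simp only [FNs_add, Cls.FN_add, Proc.rename, Proc.FN, Finset.coe_union] at *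
    refine ⟨?_, ?_, ?_⟩
    · rintro x (hx | hx)
      · rcases a1 hx with h | h <;> simp [h]
      · rcases a2 hx with h | h <;> simp [h]
    · rintro x (hx | hx)
      · rcases b1 hx with h | h <;> simp [h]
      · rcases b2 hx with h | h <;> simp [h]
    · intro x hx
      rcases Finset.mem_union.1 hx with h | h
      · exact hB x h
      · exact hC x h
  | nuOpen _ haB ha hk ih =>
    obtain ⟨a1, b1, c1⟩ := ih
    refine ⟨fun x hx => ?_, fun x hx => ?_, fun x hx h => ?_⟩
    · rcases a1 hx with h | h
      · rcases mem_FN_rename_consRen h with rfl | h <;> simp_all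
      · simp_all
    · rcases b1 hx with h | h
      · rcases mem_FN_rename_consRen h with rfl | h <;> simp_all
      · simp_all
    · rcases Finset.mem_insert.1 hx with rfl | hx
      · exact ha h
      · exact c1 x hx (mem_FN_rename_nu h)
  | nuKeep _ haB ha hk haα ih =>
    obtain ⟨a1, b1, c1⟩ := ih
    rw [FN_nuN]
    refine ⟨fun x hx => ?_, fun x hx => ?_, fun x hx h => c1 x hx (mem_FN_rename_nu h)⟩
    · rcases a1 hx with h | h
      · rcases mem_FN_rename_consRen h with rfl | h <;> simp_all
      · simp_all
    · rcases b1 hx.1 with h | h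
      · rcases mem_FN_rename_consRen h with rfl | h <;> simp_all
      · simp_all

theorem exists_fresh {s : Set ℕ} (hs : s.Finite) : ∃ a, a ∉ s := hs.exists_notMem

/-- The special case of `Exp.map` without a permutation of the global names. -/
theorem Exp.env {σ : ℕ → ℕ} (h : Exp k P σ B α r) (f : ℕ → ℕ) {ρ : ℕ → ℕ}
    (hf : ∀ i ∈ P.FN, σ i = ρ (f i)) : Exp k (P.rename f) ρ B α r := by
  have h2 := h.map 1 (f := f) (ρ := ρ) hf
  have e1 : B.map (1 : Equiv.Perm ℕ).toEmbedding = B := Finset.map_refl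
  rwa [e1, map_ren_eq_self (ρ := ⇑(1 : Equiv.Perm ℕ)) fun _ _ => rfl,
    Cls.ren_eq_self (ρ := ⇑(1 : Equiv.Perm ℕ)) fun _ _ => rfl] at h2

/-- Exposing nothing. -/
theorem Exp.none (P : Proc) (ρ : ℕ → ℕ) : Exp true P ρ ∅ 0 (cls (P.rename ρ)) := by
  induction P generalizing ρ with
  | nu P ih =>
    obtain ⟨a, ha⟩ := exists_fresh ((Proc.nu P).rename ρ).FN_finite
    rw [cls_rename_nu ha]
    exact .nuKeep (ih _) (by simp) ha rfl (by simp)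
  | par P Q ih1 ih2 =>
    exact .par (ih1 ρ) (ih2 ρ) (by simp) (by simp) (by simp)
  | zero => exact .zero ρ
  | _ => exact .leaf ρ trivial

theorem Finset.map_swap_eq_self {a b : ℕ} {B : Finset ℕ} (ha : a ∉ B) (hb : b ∉ B) :
    B.map (Equiv.swap a b).toEmbedding = B := by
  ext x
  simp only [Finset.mem_map, Equiv.coe_toEmbedding]
  constructor
  · rintro ⟨y, hy, rfl⟩
    rwa [Equiv.swap_apply_of_ne_of_ne (by rintro rfl; exact ha hy) (by rintro rfl; exact hb hy)]
  · intro hx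
    exact ⟨x, hx, Equiv.swap_apply_of_ne_of_ne (by rintro rfl; exact ha hx)
      (by rintro rfl; exact hb hx)⟩

theorem swap_eq_self_of_notMem {s : Set ℕ} {a b : ℕ} (ha : a ∉ s) (hb : b ∉ s) :
    ∀ i ∈ s, Equiv.swap a b i = i := fun _ hi =>
  Equiv.swap_apply_of_ne_of_ne (fun h => ha (h ▸ hi)) (fun h => hb (h ▸ hi))

/-- A restriction is either extruded, or kept under a name that can be chosen fresh. -/
theorem Exp.nu_inv (h : Exp true (.nu P) ρ B α r) {W : Set ℕ} (hW : W.Finite) :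
    (∃ a B', B = insert a B' ∧ a ∉ B' ∧ a ∉ ((Proc.nu P).rename ρ).FN ∧ a ∈ FNs α ∧
      Exp true P (consRen a ρ) B' α r) ∨
    ∃ a r', a ∉ W ∧ r = nuN a r' ∧ a ∉ B ∧ a ∉ ((Proc.nu P).rename ρ).FN ∧ a ∉ FNs α ∧
      Exp true P (consRen a ρ) B α r' := by
  cases h with
  | leaf _ h => exact h.elim
  | @nuOpen _ _ a B' _ _ hP haB ha hk => exact Or.inl ⟨a, B', rfl, haB, ha, hk rfl, hP⟩
  | @nuKeep _ _ a _ _ r' hP haB ha hk haα =>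
    right
    obtain ⟨b, hb⟩ := exists_fresh ((hW.union (B.finite_toSet.union (FNs_finite α))).union
      (((Proc.nu P).rename ρ).FN_finite.union r'.FN_finite))
    simp only [Set.mem_union, not_or] at hb
    obtain ⟨⟨h1, h2, h3⟩, h4, h5⟩ := hb
    refine ⟨b, r'.ren (Equiv.swap a b), h1, (nuN_swap h5).symm, h2, h4, h3, ?_⟩
    have := hP.map (Equiv.swap a b) (f := id) (ρ := consRen b ρ) ?_
    · rwa [Finset.map_swap_eq_self haB h2, map_ren_eq_self (swap_eq_self_of_notMem haα h3),
        rename_id] at this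
    · rintro (_ | i) hi
      · simp
      · have hm : ρ i ∈ ((Proc.nu P).rename ρ).FN := by
          rw [FN_rename]; exact ⟨i, hi, rfl⟩
        exact Equiv.swap_apply_of_ne_of_ne (fun h => ha (h ▸ hm)) (fun h => h4 (h ▸ hm))

/-- A congruence below a replication, by induction on the number of unfoldings. -/
theorem Exp.bang_mono (hc : Congr P Q) (ih : ∀ ρ B α r, Exp true P ρ B α r → Exp true Q ρ B α r)
    (h : Exp true (.bang P) ρ B α r) : Exp true (.bang Q) ρ B α r := by
  generalize hR : Proc.bang P = R at h
  induction h with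
  | leaf ρ h =>
    subst hR
    rw [cls_eq.2 (hc.bang.rename ρ)]
    exact .leaf ρ trivial
  | bang hP hQ hd hB hC ih1 ih2 =>
    cases hR
    exact .bang (ih _ _ _ _ hP) (ih2 rfl) hd (fun x hx => (hc.rename _).FN_eq ▸ hB x hx)
      fun x hx => (hc.rename _).FN_eq ▸ hC x hx
  | _ => cases hR

theorem Exp.nu_mono (hc : Congr P Q) (ih : ∀ ρ B α r, Exp true P ρ B α r → Exp true Q ρ B α r)
    (h : Exp true (.nu P) ρ B α r) : Exp true (.nu Q) ρ B α r := by
  have := (hc.nu.rename ρ).FN_eq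
  rcases h.nu_inv Set.finite_empty with
      ⟨a, B', rfl, h1, h2, h3, h4⟩ | ⟨a, r', -, rfl, h1, h2, h3, h4⟩
  · exact .nuOpen (ih _ _ _ _ h4) h1 (this ▸ h2) fun _ => h3
  · exact .nuKeep (ih _ _ _ _ h4) h1 (this ▸ h2) rfl h3

theorem Exp.par_inv {R : Proc → Proc → Proc} (hR : R = .par) (h : Exp k (R P Q) ρ B α r) :
    ∃ B1 B2 α1 α2 r1 r2, Exp k P ρ B1 α1 r1 ∧ Exp k Q ρ B2 α2 r2 ∧ Disjoint B1 B2 ∧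
      (∀ x ∈ B1, x ∉ (Q.rename ρ).FN) ∧ (∀ x ∈ B2, x ∉ (P.rename ρ).FN) ∧
      B = B1 ∪ B2 ∧ α = α1 + α2 ∧ r = r1 + r2 := by
  subst hR
  cases h with
  | leaf _ h => exact h.elim
  | par h1 h2 h3 h4 h5 => exact ⟨_, _, _, _, _, _, h1, h2, h3, h4, h5, rfl, rfl, rfl⟩

/-- Invariance under `νx.νy.P ≡ νy.νx.P`: the two binders are opened in the other order. -/
theorem Exp.swap_mono (h : Exp true (.nu (.nu P)) ρ B α r) :
    Exp true (.nu (.nu (P.rename swapRen))) ρ B α r := by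
  have hFN : ((Proc.nu (.nu (P.rename swapRen))).rename ρ).FN = ((Proc.nu (.nu P)).rename ρ).FN :=
    ((Congr.nu_nu P).symm.rename ρ).FN_eq
  have hin : ∀ {a b : ℕ}, a ≠ b → a ∉ ((Proc.nu (.nu P)).rename ρ).FN →
      a ∉ ((Proc.nu (P.rename swapRen)).rename (consRen b ρ)).FN := by
    intro a b hab ha h
    rcases mem_FN_rename_consRen h with h | h
    · exact hab h
    · exact ha (hFN ▸ h)
  have hsw : ∀ {a b B α r}, Exp true P (consRen b (consRen a ρ)) B α r →
      Exp true (P.rename swapRen) (consRen a (consRen b ρ)) B α r := fun {a b B α r} h =>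
    h.env swapRen fun i _ => congrFun (consRen_consRen_comp_swapRen a b ρ).symm i
  rcases h.nu_inv Set.finite_empty with
      ⟨a, B', rfl, h1, h2, h3, h4⟩ | ⟨a, r', -, rfl, h1, h2, h3, h4⟩
  · rcases h4.nu_inv (Set.finite_singleton a) with
      ⟨b, B'', rfl, k1, k2, k3, k4⟩ | ⟨b, r', kb, rfl, k1, k2, k3, k4⟩
    · simp only [Finset.mem_insert, not_or] at h1
      rw [Finset.insert_comm]
      refine .nuOpen (.nuOpen (hsw k4) h1.2 (hin h1.1 h2) fun _ => h3) ?_ ?_ fun _ => k3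
      · simp [Ne.symm h1.1, k1]
      · rw [hFN]; exact fun h => k2 (mem_FN_rename_nu h)
    · refine .nuKeep (.nuOpen (hsw k4) h1 (hin (fun h => kb (h ▸ rfl)) h2) fun _ => h3) ?_ ?_ rfl k3
      · simp [k1]; exact kb
      · rw [hFN]; exact fun h => k2 (mem_FN_rename_nu h)
  · rcases h4.nu_inv (Set.finite_singleton a) with
      ⟨b, B'', rfl, k1, k2, k3, k4⟩ | ⟨b, r', kb, rfl, k1, k2, k3, k4⟩
    · simp only [Finset.mem_insert, not_or] at h1
      refine .nuOpen (.nuKeep (hsw k4) h1.2 (hin h1.1 h2) rfl h3) k1 ?_ fun _ => k3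
      rw [hFN]; exact fun h => k2 (mem_FN_rename_nu h)
    · rw [nuN_comm]
      refine .nuKeep (.nuKeep (hsw k4) h1 (hin (fun h => kb (h ▸ rfl)) h2) rfl h3) k1 ?_ rfl k3
      rw [hFN]; exact fun h => k2 (mem_FN_rename_nu h)

theorem rename_shift_consRen (P : Proc) (a : ℕ) (ρ : ℕ → ℕ) :
    (P.shift.rename (consRen a ρ)) = P.rename ρ := by
  rw [Proc.shift, rename_rename, consRen_comp_succ]

theorem Exp.shift_iff {a : ℕ} : Exp true P.shift (consRen a ρ) B α r ↔ Exp true P ρ B α r := by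
  constructor
  · intro h
    have := h.env Nat.pred (ρ := ρ) ?_
    · rwa [Proc.shift, rename_rename, show Nat.pred ∘ Nat.succ = id from rfl, rename_id] at this
    · intro i hi
      rw [Proc.shift, FN_rename] at hi
      obtain ⟨j, -, rfl⟩ := hi
      rfl
  · intro h
    exact h.env Nat.succ fun i _ => rfl

theorem FN_rename_nu_par (P Q : Proc) (ρ : ℕ → ℕ) :
    ((Proc.nu (.par P.shift Q)).rename ρ).FN = (P.rename ρ).FN ∪ ((Proc.nu Q).rename ρ).FN :=
  ((Congr.nu_par P Q).rename ρ).FN_eq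

/-- Invariance under scope extrusion, from left to right. -/
theorem Exp.nu_par_mp (h : Exp true (.nu (.par P.shift Q)) ρ B α r) :
    Exp true (.par P (.nu Q)) ρ B α r := by
  have hFN := FN_rename_nu_par P Q ρ
  rcases h.nu_inv Set.finite_empty with
      ⟨a, B', rfl, h1, h2, h3, h4⟩ | ⟨a, r', -, rfl, h1, h2, h3, h4⟩
  all_goals
    rw [hFN] at h2
    simp only [Set.mem_union, not_or] at h2
    obtain ⟨B1, B2, α1, α2, r1, r2, e1, e2, hd, hB, hC, rfl, rfl, rfl⟩ := h4.par_inv rfl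
    rw [shift_iff] at e1
    rw [rename_shift_consRen] at hC
    simp only [Finset.mem_union, not_or] at h1
    have hB' : ∀ x ∈ B1, x ∉ ((Proc.nu Q).rename ρ).FN := fun x hx h => hB x hx (mem_FN_rename_nu h)
  · have h3' : a ∈ FNs α2 := by
      rw [FNs_add] at h3
      refine h3.resolve_left fun h => ?_
      rcases e1.FN.1 h with h | h
      · exact h2.1 h
      · exact h1.1 h
    rw [← Finset.union_insert]
    refine .par e1 (.nuOpen e2 h1.2 h2.2 fun _ => h3') ?_ hB' ?_
    · simp [hd, h1.1]
    · simpa [h2.1] using hC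
  · simp only [FNs_add, Set.mem_union, not_or] at h3
    rw [nuN_add]
    · exact .par e1 (.nuKeep e2 h1.2 h2.2 rfl h3.2) hd hB' hC
    · intro h
      rcases e1.FN.2.1 h with h | h
      · exact h2.1 h
      · exact h1.1 h

/-- Invariance under scope extrusion, from right to left. -/
theorem Exp.nu_par_mpr (h : Exp true (.par P (.nu Q)) ρ B α r) :
    Exp true (.nu (.par P.shift Q)) ρ B α r := by
  have hFN := FN_rename_nu_par P Q ρ
  obtain ⟨B1, B2, α1, α2, r1, r2, e1, e2, hd, hB, hC, rfl, rfl, rfl⟩ := h.par_inv rfl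
  rcases e2.nu_inv ((P.rename ρ).FN_finite.union B1.finite_toSet) with
    ⟨a, B', rfl, h1, h2, h3, h4⟩ | ⟨a, r', hW, rfl, h1, h2, h3, h4⟩
  · rw [Finset.disjoint_insert_right] at hd
    have haP := hC a (by simp)
    rw [Finset.union_insert]
    refine .nuOpen (.par (shift_iff.2 e1) h4 hd.2 ?_ ?_) ?_ ?_ fun _ => ?_
    · intro x hx h
      rcases mem_FN_rename_consRen h with rfl | h
      · exact hd.1 hx
      · exact hB x hx h
    · rw [rename_shift_consRen]
      exact fun x hx => hC x (by simp [hx])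
    · simp [hd.1, h1]
    · simp [hFN, haP, h2]
    · simp [h3]
  · simp only [Set.mem_union, not_or] at hW
    have hn : ∀ x, x ∈ FNs α1 ∨ x ∈ r1.FN → x ≠ a := by
      rintro x (hx | hx) rfl
      · rcases e1.FN.1 hx with h | h
        · exact hW.1 h
        · exact hW.2 h
      · rcases e1.FN.2.1 hx with h | h
        · exact hW.1 h
        · exact hW.2 h
    rw [← nuN_add fun h => hn a (Or.inr h) rfl]
    refine .nuKeep (.par (shift_iff.2 e1) h4 hd ?_ ?_) ?_ ?_ rfl ?_
    · intro x hx h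
      rcases mem_FN_rename_consRen h with rfl | h
      · exact hW.2 hx
      · exact hB x hx h
    · rwa [rename_shift_consRen]
    · simp only [Finset.mem_union, not_or]; exact ⟨hW.2, h1⟩
    · rw [hFN]; simp only [Set.mem_union, not_or]; exact ⟨hW.1, h2⟩
    · simp only [FNs_add, Set.mem_union, not_or]
      exact ⟨fun h => hn a (Or.inl h) rfl, h3⟩

/-- Structurally congruent processes expose the same prefixes with the same residuals. -/
theorem Congr.exp_iff (h : Congr P Q) :
    ∀ ρ B α r, Exp true P ρ B α r ↔ Exp true Q ρ B α r := by
  induction h with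
  | refl => exact fun _ _ _ _ => Iff.rfl
  | symm _ ih => exact fun _ _ _ _ => (ih _ _ _ _).symm
  | trans _ _ ih1 ih2 => exact fun _ _ _ _ => (ih1 _ _ _ _).trans (ih2 _ _ _ _)
  | nu hc ih =>
    exact fun _ _ _ _ => ⟨Exp.nu_mono hc fun _ _ _ _ => (ih _ _ _ _).1,
      Exp.nu_mono hc.symm fun _ _ _ _ => (ih _ _ _ _).2⟩
  | bang hc ih =>
    exact fun _ _ _ _ => ⟨Exp.bang_mono hc fun _ _ _ _ => (ih _ _ _ _).1,
      Exp.bang_mono hc.symm fun _ _ _ _ => (ih _ _ _ _).2⟩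
  | out x y hc ih =>
    have key : ∀ {P Q : Proc}, Congr P Q → ∀ {ρ B α r}, Exp true (.out x y P) ρ B α r →
        Exp true (.out x y Q) ρ B α r := by
      intro P Q hc ρ B α r h
      cases h with
      | leaf ρ h => rw [cls_eq.2 ((hc.out x y).rename ρ)]; exact .leaf ρ trivial
      | out => rw [cls_eq.2 (hc.rename ρ)]; exact .out _ _ _ _
    exact fun _ _ _ _ => ⟨key hc, key hc.symm⟩
  | inp x hc ih =>
    have key : ∀ {P Q : Proc}, Congr P Q → ∀ {ρ B α r}, Exp true (.inp x P) ρ B α r →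
        Exp true (.inp x Q) ρ B α r := by
      intro P Q hc ρ B α r h
      cases h with
      | leaf ρ h => rw [cls_eq.2 ((hc.inp x).rename ρ)]; exact .leaf ρ trivial
      | inp => rw [cls_eq.2 (hc.rename _)]; exact .inp _ _ _
    exact fun _ _ _ _ => ⟨key hc, key hc.symm⟩
  | par hc1 hc2 ih1 ih2 =>
    have key : ∀ {P P' Q Q' : Proc}, Congr P P' → Congr Q Q' →
        (∀ ρ B α r, Exp true P ρ B α r → Exp true P' ρ B α r) →
        (∀ ρ B α r, Exp true Q ρ B α r → Exp true Q' ρ B α r) →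
        ∀ {ρ B α r}, Exp true (.par P Q) ρ B α r → Exp true (.par P' Q') ρ B α r := by
      intro P P' Q Q' hc1 hc2 ih1 ih2 ρ B α r h
      obtain ⟨B1, B2, α1, α2, r1, r2, e1, e2, hd, hB, hC, rfl, rfl, rfl⟩ := h.par_inv rfl
      exact .par (ih1 _ _ _ _ e1) (ih2 _ _ _ _ e2) hd ((hc2.rename ρ).FN_eq ▸ hB)
        ((hc1.rename ρ).FN_eq ▸ hC)
    exact fun _ _ _ _ =>
      ⟨key hc1 hc2 (fun _ _ _ _ => (ih1 _ _ _ _).1) fun _ _ _ _ => (ih2 _ _ _ _).1,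
      key hc1.symm hc2.symm (fun _ _ _ _ => (ih1 _ _ _ _).2) fun _ _ _ _ => (ih2 _ _ _ _).2⟩
  | par_assoc P Q R =>
    intro ρ B α r
    constructor
    · intro h
      obtain ⟨B1, B2, α1, α2, r1, r2, e1, e2, hd, hB, hC, rfl, rfl, rfl⟩ := h.par_inv rfl
      obtain ⟨C1, C2, β1, β2, t1, t2, d1, d2, hd', hB', hC', rfl, rfl, rfl⟩ := e2.par_inv rfl
      simp only [Proc.rename, Proc.FN, Set.mem_union, not_or, Finset.mem_union,
        Finset.disjoint_union_right] at *
      rw [← Finset.union_assoc, ← add_assoc, ← add_assoc]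
      refine .par (.par e1 d1 hd.1 (fun x hx => (hB x hx).1) fun x hx => hC x (.inl hx)) d2
        (by simp [hd.2, hd']) ?_ fun x hx => ?_
      · intro x hx
        rcases Finset.mem_union.1 hx with h | h
        · exact (hB x h).2
        · exact hB' x h
      · simp only [Proc.rename, Proc.FN, Set.mem_union, not_or]
        exact ⟨hC x (.inr hx), hC' x hx⟩
    · intro h
      obtain ⟨B1, B2, α1, α2, r1, r2, e1, e2, hd, hB, hC, rfl, rfl, rfl⟩ := h.par_inv rfl
      obtain ⟨C1, C2, β1, β2, t1, t2, d1, d2, hd', hB', hC', rfl, rfl, rfl⟩ := e1.par_inv rfl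
      simp only [Proc.rename, Proc.FN, Set.mem_union, not_or, Finset.mem_union,
        Finset.disjoint_union_left] at *
      rw [Finset.union_assoc, add_assoc, add_assoc]
      refine .par d1 (.par d2 e2 hd.2 (fun x hx => hB x (.inr hx)) fun x hx => (hC x hx).2)
        (by simp [hd.1, hd']) (fun x hx => ?_) ?_
      · simp only [Proc.rename, Proc.FN, Set.mem_union, not_or]
        exact ⟨hB' x hx, hB x (.inl hx)⟩
      · intro x hx
        rcases Finset.mem_union.1 hx with h | h
        · exact hC' x h
        · exact (hC x h).1
  | par_comm P Q =>
    have key : ∀ {P Q : Proc} {ρ B α r},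
        Exp true (.par P Q) ρ B α r → Exp true (.par Q P) ρ B α r := by
      intro P Q ρ B α r h
      obtain ⟨B1, B2, α1, α2, r1, r2, e1, e2, hd, hB, hC, rfl, rfl, rfl⟩ := h.par_inv rfl
      rw [Finset.union_comm, add_comm α1, add_comm r1]
      exact .par e2 e1 hd.symm hC hB
    exact fun _ _ _ _ => ⟨key, key⟩
  | par_zero P =>
    intro ρ B α r
    constructor
    · intro h
      obtain ⟨B1, B2, α1, α2, r1, r2, e1, e2, hd, hB, hC, rfl, rfl, rfl⟩ := h.par_inv rfl
      cases e2 with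
      | leaf => exact (‹Proc.Rigid .zero› : False).elim
      | zero => simpa using e1
    · intro h
      simpa using Exp.par h (.zero ρ) (by simp) (by simp [Proc.rename, Proc.FN]) (by simp)
  | nu_par P Q => exact fun _ _ _ _ => ⟨Exp.nu_par_mp, Exp.nu_par_mpr⟩
  | nu_zero =>
    intro ρ B α r
    constructor
    · intro h
      rcases h.nu_inv Set.finite_empty with
          ⟨a, B', rfl, h1, h2, h3, h4⟩ | ⟨a, r', -, rfl, h1, h2, h3, h4⟩
      all_goals cases h4 with
        | leaf => exact (‹Proc.Rigid .zero› : False).elim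
        | zero => ?_
      · simp at h3
      · rw [nuN_zero]; exact .zero ρ
    · intro h
      cases h with
      | leaf => exact (‹Proc.Rigid .zero› : False).elim
      | zero =>
        have := Exp.none (.nu .zero) ρ
        rwa [cls_eq.2 (Congr.nu_zero.rename ρ)] at this
  | nu_stop =>
    intro ρ B α r
    constructor
    · intro h
      rcases h.nu_inv Set.finite_empty with
          ⟨a, B', rfl, h1, h2, h3, h4⟩ | ⟨a, r', -, rfl, h1, h2, h3, h4⟩
      all_goals cases h4
      · simp at h3
      · simp [Pre.FN] at h3
      · rw [nuN_fresh (by simp [FN_cls, Proc.rename, Proc.FN])]; exact .leaf ρ trivial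
      · rw [nuN_zero]; exact .halt ρ
    · intro h
      cases h with
      | leaf _ h =>
        have := Exp.none (.nu .Stop) ρ
        rwa [cls_eq.2 (Congr.nu_stop.rename ρ)] at this
      | halt =>
        rw [← nuN_zero 0]
        exact .nuKeep (.halt _) (by simp) (by simp [Proc.rename, Proc.FN]) rfl (by simp [Pre.FN])
  | nu_nu P =>
    refine fun _ _ _ _ => ⟨Exp.swap_mono, fun h => ?_⟩
    have := h.swap_mono
    rwa [rename_rename, show swapRen ∘ swapRen = id by
      funext i; rcases i with _ | _ | i <;> rfl, rename_id] at this
  | bang_unfold P =>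
    intro ρ B α r
    constructor
    · intro h
      cases h with
      | leaf _ h =>
        have := Exp.par (Exp.none P ρ) (Exp.leaf (P := .bang P) ρ trivial) (by simp) (by simp)
          (by simp)
        simp only [Finset.union_idempotent, add_zero] at this
        rwa [cls_eq.2 ((Congr.bang_unfold P).rename ρ)]
      | bang h1 h2 h3 h4 h5 => exact .par h1 h2 h3 h4 h5
    · intro h
      obtain ⟨B1, B2, α1, α2, r1, r2, e1, e2, hd, hB, hC, rfl, rfl, rfl⟩ := h.par_inv rfl
      exact .bang e1 e2 hd hB hC

end PiStop

namespace PiStop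
open Proc Cls

variable {k : Bool} {P Q : Proc} {ρ : ℕ → ℕ} {B : Finset ℕ} {α : Multiset Pre} {r : Cls}

/-! ### Reduction of classes -/

/-- `p[z/y]`, where `y` is the index `0`. -/
def Cls.inst (p : Cls) (z : ℕ) : Cls := p.ren (consRen z id)

/-- Standard reduction of processes up to structural congruence. -/
def StepQ (p q : Cls) : Prop := ∃ P Q, cls P = p ∧ cls Q = q ∧ Step P Q

/-- Success of processes up to structural congruence. -/
def SuccQ (p : Cls) : Prop := ∃ P, cls P = p ∧ Successful P

theorem Step.congr {P P' Q Q' : Proc} (h : Step P Q) (hP : Congr P' P) (hQ : Congr Q Q') :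
    Step P' Q' := by
  obtain ⟨D, R, R', h1, h2, h3⟩ := h
  exact ⟨D, R, R', hP.trans h1, h2, h3.trans hQ⟩

theorem stepQ_cls : StepQ (cls P) (cls Q) ↔ Step P Q := by
  constructor
  · rintro ⟨P', Q', h1, h2, h⟩
    exact h.congr (cls_eq.1 h1.symm) (cls_eq.1 h2)
  · exact fun h => ⟨P, Q, rfl, rfl, h⟩

theorem succQ_cls : SuccQ (cls P) ↔ Successful P := by
  constructor
  · rintro ⟨P', h1, D, h⟩
    exact ⟨D, (cls_eq.1 h1.symm).trans h⟩
  · exact fun h => ⟨P, rfl, h⟩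

theorem reflTransGen_stepQ {P : Proc} {q : Cls} :
    Relation.ReflTransGen StepQ (cls P) q ↔
      ∃ Q, cls Q = q ∧ Relation.ReflTransGen Step P Q := by
  constructor
  · intro h
    generalize hp : cls P = p at h
    induction h with
    | refl => exact ⟨P, hp, .refl⟩
    | @tail q' q _ h ih =>
      obtain ⟨Q, rfl, hQ⟩ := ih
      obtain ⟨R, rfl⟩ := cls_surj q
      exact ⟨R, rfl, hQ.tail (stepQ_cls.1 h)⟩
  · rintro ⟨Q, rfl, h⟩
    exact h.lift cls fun _ _ => stepQ_cls.2

/-- May-convergence of processes up to structural congruence. -/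
def MayQ (p : Cls) : Prop := ∃ q, Relation.ReflTransGen StepQ p q ∧ SuccQ q

/-- Should-convergence of processes up to structural congruence. -/
def ShouldQ (p : Cls) : Prop := ∀ q, Relation.ReflTransGen StepQ p q → MayQ q

theorem mayQ_cls : MayQ (cls P) ↔ MayConv P := by
  constructor
  · rintro ⟨q, h, hq⟩
    obtain ⟨Q, rfl, h'⟩ := reflTransGen_stepQ.1 h
    exact ⟨Q, h', succQ_cls.1 hq⟩
  · rintro ⟨Q, h, hQ⟩
    exact ⟨cls Q, reflTransGen_stepQ.2 ⟨Q, rfl, h⟩, succQ_cls.2 hQ⟩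

theorem shouldQ_cls : ShouldQ (cls P) ↔ ShouldConv P := by
  constructor
  · intro h Q hQ
    exact mayQ_cls.1 (h _ (reflTransGen_stepQ.2 ⟨Q, rfl, hQ⟩))
  · intro h q hq
    obtain ⟨Q, rfl, hQ⟩ := reflTransGen_stepQ.1 hq
    exact mayQ_cls.2 (h _ hQ)

theorem PCtx.rename_plug (D : PCtx) (ρ : ℕ → ℕ) :
    ∃ (D' : PCtx) (ρ' : ℕ → ℕ), ∀ P, (D.plug P).rename ρ = D'.plug (P.rename ρ') := by
  induction D generalizing ρ with
  | hole => exact ⟨.hole, ρ, fun _ => rfl⟩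
  | parL D Q ih =>
    obtain ⟨D', ρ', h⟩ := ih ρ
    exact ⟨.parL D' (Q.rename ρ), ρ', fun P => by simp [PCtx.plug, Proc.rename, h]⟩
  | parR Q D ih =>
    obtain ⟨D', ρ', h⟩ := ih ρ
    exact ⟨.parR (Q.rename ρ) D', ρ', fun P => by simp [PCtx.plug, Proc.rename, h]⟩
  | nu D ih =>
    obtain ⟨D', ρ', h⟩ := ih (upRen 1 ρ)
    exact ⟨.nu D', ρ', fun P => by simp [PCtx.plug, Proc.rename, h]⟩

theorem Interaction.rename {P Q : Proc} (h : Interaction P Q) (ρ : ℕ → ℕ) :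
    Interaction (P.rename ρ) (Q.rename ρ) := by
  cases h with
  | ia x z P Q =>
    have : (P.inst z).rename ρ = (P.rename (upRen 1 ρ)).inst (ρ z) := by
      simp only [Proc.inst, rename_rename, comp_consRen, consRen_comp_upRen]
      rfl
    simp only [Proc.rename, this]
    exact .ia _ _ _ _

theorem Step.rename {P Q : Proc} (h : Step P Q) (ρ : ℕ → ℕ) : Step (P.rename ρ) (Q.rename ρ) := by
  obtain ⟨D, R, R', h1, h2, h3⟩ := h
  obtain ⟨D', ρ', hD⟩ := D.rename_plug ρ
  exact ⟨D', _, _, hD R ▸ h1.rename ρ, h2.rename ρ', hD R' ▸ h3.rename ρ⟩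

theorem StepQ.add_right {p q : Cls} (h : StepQ p q) (t : Cls) : StepQ (p + t) (q + t) := by
  obtain ⟨P, Q, rfl, rfl, D, R, R', h1, h2, h3⟩ := h
  obtain ⟨T, rfl⟩ := cls_surj t
  exact stepQ_cls.2 ⟨.parL D T, R, R', h1.par (.refl T), h2, h3.par (.refl T)⟩

theorem StepQ.nuN {p q : Cls} (h : StepQ p q) (a : ℕ) : StepQ (nuN a p) (nuN a q) := by
  obtain ⟨P, Q, rfl, rfl, h⟩ := h
  obtain ⟨D, R, R', h1, h2, h3⟩ := h.rename (cloRen a)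
  exact stepQ_cls.2 ⟨.nu D, R, R', h1.nu, h2, h3.nu⟩

theorem StepQ.close {p q : Cls} (h : StepQ p q) (X : Finset ℕ) :
    StepQ (close X p) (close X q) := by
  induction X using Finset.induction_on with
  | empty => exact h
  | insert a X ha ih => rw [close_insert ha, close_insert ha]; exact ih.nuN a

theorem StepQ.react (x z : ℕ) (p q : Cls) :
    StepQ ((Pre.inp x p).toCls + (Pre.out x z q).toCls) (p.inst z + q) := by
  obtain ⟨P, rfl⟩ := cls_surj p
  obtain ⟨Q, rfl⟩ := cls_surj q
  exact stepQ_cls.2 ⟨.hole, _, _, .refl _, .ia x z P Q, .refl _⟩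

theorem SuccQ.stop_add (p : Cls) : SuccQ (cls .Stop + p) := by
  obtain ⟨P, rfl⟩ := cls_surj p
  exact succQ_cls.2 ⟨.parL .hole P, .refl _⟩

theorem SuccQ.close_stop_add (X : Finset ℕ) (p : Cls) : SuccQ (close X (cls .Stop + p)) := by
  rw [close_add]
  · exact .stop_add _
  · intro x _ h
    exact h

/-! ### Reductions and successes are visible as exposed prefixes -/

/-- The class of a collection of prefixes. -/
def preSum (α : Multiset Pre) : Cls := (α.map Pre.toCls).sum

@[simp] theorem preSum_zero : preSum 0 = 0 := rfl

@[simp] theorem preSum_add (α β : Multiset Pre) : preSum (α + β) = preSum α + preSum β := by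
  simp [preSum]

@[simp] theorem preSum_singleton (a : Pre) : preSum {a} = a.toCls := by simp [preSum]

theorem FN_preSum (α : Multiset Pre) : (preSum α).FN = FNs α := by
  induction α using Multiset.induction_on with
  | empty => simp
  | cons a s ih => rw [← Multiset.singleton_add, preSum_add, Cls.FN_add, ih, FNs_add,
      preSum_singleton, FNs_singleton, Pre.FN_toCls]

theorem close_union_add {X Y : Finset ℕ} {p q : Cls} (h : Disjoint X Y) (hX : ∀ x ∈ X, x ∉ q.FN)
    (hY : ∀ y ∈ Y, y ∉ p.FN) : close (X ∪ Y) (p + q) = close X p + close Y q := by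
  rw [close_union h, close_add hY, close_add_right]
  intro x hx hq
  rw [FN_close] at hq
  exact hX x hx hq.1

/-- What is exposed, together with the residual, has no other free names than those of the process
and the extruded ones. -/
theorem Exp.FN_sum (h : Exp k P ρ B α r) : (preSum α + r).FN ⊆ (P.rename ρ).FN ∪ B := by
  rw [Cls.FN_add, FN_preSum]
  exact Set.union_subset h.FN.1 h.FN.2.1

/-- Exposure is sound: the process is congruent to the closure of what it exposes. -/
theorem Exp.sound (h : Exp k P ρ B α r) : cls (P.rename ρ) = close B (preSum α + r) := by
  induction h with
  | leaf => simp
  | zero => simp; rfl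
  | inp => simp; rfl
  | out => simp; rfl
  | halt => simp [Pre.toCls]; rfl
  | @par P Q ρ B C α β r t hP hQ hd hB hC ih1 ih2 =>
    rw [preSum_add, add_add_add_comm, close_union_add hd, ← ih1, ← ih2]
    · rfl
    · intro x hx h
      rcases hQ.FN_sum h with h | h
      · exact hB x hx h
      · exact Finset.disjoint_left.1 hd hx h
    · intro x hx h
      rcases hP.FN_sum h with h | h
      · exact hC x hx h
      · exact Finset.disjoint_left.1 hd h hx
  | @bang P ρ B C α β r t hP hQ hd hB hC ih1 ih2 =>
    rw [preSum_add, add_add_add_comm, close_union_add hd, ← ih1, ← ih2,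
      ← Cls.cls_par]
    · exact cls_eq.2 ((Congr.bang_unfold P).rename ρ)
    · intro x hx h
      rcases hQ.FN_sum h with h | h
      · exact hB x hx h
      · exact Finset.disjoint_left.1 hd hx h
    · intro x hx h
      rcases hP.FN_sum h with h | h
      · exact hC x hx h
      · exact Finset.disjoint_left.1 hd h hx
  | nuOpen hP haB ha hk ih => rw [cls_rename_nu ha, ih, close_insert haB]
  | nuKeep hP haB ha hk haα ih =>
    rw [cls_rename_nu ha, ih, nuN_close, nuN_add]
    rwa [FN_preSum]

theorem FN_react (x z : ℕ) (p q : Cls) :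
    (p.inst z + q).FN ⊆ FNs ({Pre.inp x p} + {Pre.out x z q}) := by
  simp only [Cls.FN_add, FNs_add, FNs_singleton, Pre.FN, Cls.inst, Cls.FN_ren]
  rintro i (⟨_ | j, hj, rfl⟩ | h)
  · simp
  · exact Or.inl (Or.inr hj)
  · simp [h]

/-- A redex in a context is exposed, with its contractum given by the same names and residual. -/
theorem PCtx.exp_redex (D : PCtx) (x₀ z₀ : ℕ) (P Q : Proc) (ρ : ℕ → ℕ) {W : Set ℕ} (hW : CoInf W) :
    ∃ B x z p q r, Exp true (D.plug (.par (.inp x₀ P) (.out x₀ z₀ Q))) ρ B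
        ({.inp x p} + {.out x z q}) r ∧
      cls ((D.plug (.par (P.inst z₀) Q)).rename ρ) = close B (p.inst z + q + r) ∧
      ∀ b ∈ B, b ∉ W := by
  induction D generalizing ρ W with
  | hole =>
    refine ⟨_, _, _, _, _, _, .par (.inp _ _ _) (.out _ _ _ _) (by simp) (by simp) (by simp), ?_,
      by simp⟩
    have : (P.inst z₀).rename ρ = (P.rename (upRen 1 ρ)).inst (ρ z₀) := by
      simp only [Proc.inst, rename_rename, comp_consRen, consRen_comp_upRen]
      rfl
    simp only [PCtx.plug, Proc.rename, this, add_zero, Finset.union_idempotent, close_empty]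
    rfl
  | parL D R ih =>
    obtain ⟨B, x, z, p, q, r, h1, h2, h3⟩ := ih ρ (hW.union (R.rename ρ).FN_finite)
    refine ⟨B, x, z, p, q, r + cls (R.rename ρ), ?_, ?_, fun b hb h => h3 b hb (.inl h)⟩
    · have := Exp.par h1 (.none R ρ) (by simp) (fun b hb h => h3 b hb (.inr h)) (by simp)
      rwa [Finset.union_empty, add_zero] at this
    · rw [← add_assoc, close_add_right, ← h2]
      · rfl
      · exact fun b hb h => h3 b hb (.inr h)
  | parR R D ih =>
    obtain ⟨B, x, z, p, q, r, h1, h2, h3⟩ := ih ρ (hW.union (R.rename ρ).FN_finite)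
    refine ⟨B, x, z, p, q, cls (R.rename ρ) + r, ?_, ?_, fun b hb h => h3 b hb (.inl h)⟩
    · have := Exp.par (.none R ρ) h1 (by simp) (by simp) (fun b hb h => h3 b hb (.inr h))
      rwa [Finset.empty_union, zero_add] at this
    · rw [add_left_comm, close_add, ← h2]
      · rfl
      · exact fun b hb h => h3 b hb (.inr h)
  | nu D ih =>
    obtain ⟨a, ha⟩ := (hW.union
      (((D.nu.plug (.par (.inp x₀ P) (.out x₀ z₀ Q))).rename ρ).FN_finite.union
        ((D.nu.plug (.par (P.inst z₀) Q)).rename ρ).FN_finite)).exists_notMem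
    simp only [Set.mem_union, not_or] at ha
    obtain ⟨haW, ha1, ha2⟩ := ha
    obtain ⟨B, x, z, p, q, r, h1, h2, h3⟩ := ih (consRen a ρ) (hW.union (Set.finite_singleton a))
    have haB : a ∉ B := fun h => h3 a h (.inr rfl)
    have hW' : ∀ b ∈ B, b ∉ W := fun b hb h => h3 b hb (.inl h)
    have e : cls ((D.nu.plug (.par (P.inst z₀) Q)).rename ρ) = _ := cls_rename_nu ha2
    rw [h2] at e
    by_cases haα : a ∈ FNs ({Pre.inp x p} + {Pre.out x z q})
    · exact ⟨insert a B, x, z, p, q, r, .nuOpen h1 haB ha1 fun _ => haα, by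
        rw [e, close_insert haB], by simpa [haW] using hW'⟩
    · refine ⟨B, x, z, p, q, nuN a r, .nuKeep h1 haB ha1 rfl haα, ?_, hW'⟩
      rw [e, nuN_close, nuN_add]
      exact fun h => haα (FN_react x z p q h)

/-- Every reduction is a communication between two exposed prefixes, where the restrictions that do
not concern them stay with the residual. -/
theorem StepQ.exp {q : Cls} (h : StepQ (cls P) q) {W : Set ℕ} (hW : CoInf W) :
    ∃ B x z p p' r, Exp true P id B ({.inp x p} + {.out x z p'}) r ∧
      q = Cls.close B (p.inst z + p' + r) ∧ ∀ b ∈ B, b ∉ W := by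
  obtain ⟨Q, rfl⟩ := cls_surj q
  obtain ⟨D, _, _, h1, ⟨x, z, P', Q'⟩, h3⟩ := stepQ_cls.1 h
  obtain ⟨B, x, z, p, p', r, e1, e2, e3⟩ := D.exp_redex x z P' Q' id hW
  refine ⟨B, x, z, p, p', r, (h1.exp_iff _ _ _ _).2 e1, ?_, e3⟩
  rw [← e2, rename_id, cls_eq.2 h3]

theorem PCtx.exp_halt (D : PCtx) (ρ : ℕ → ℕ) : ∃ r, Exp true (D.plug .Stop) ρ ∅ {.halt} r := by
  induction D generalizing ρ with
  | hole => exact ⟨0, .halt ρ⟩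
  | parL D R ih =>
    obtain ⟨r, h⟩ := ih ρ
    have := Exp.par h (.none R ρ) (by simp) (by simp) (by simp)
    rw [Finset.union_empty, add_zero] at this
    exact ⟨_, this⟩
  | parR R D ih =>
    obtain ⟨r, h⟩ := ih ρ
    have := Exp.par (.none R ρ) h (by simp) (by simp) (by simp)
    rw [Finset.empty_union, zero_add] at this
    exact ⟨_, this⟩
  | nu D ih =>
    obtain ⟨a, ha⟩ := exists_fresh ((D.nu.plug .Stop).rename ρ).FN_finite
    obtain ⟨r, h⟩ := ih (consRen a ρ)
    exact ⟨_, .nuKeep h (by simp) ha rfl (by simp [Pre.FN])⟩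

/-- A successful process exposes `Stop`. -/
theorem SuccQ.exp (h : SuccQ (cls P)) : ∃ r, Exp true P id ∅ {.halt} r := by
  obtain ⟨D, h⟩ := succQ_cls.1 h
  obtain ⟨r, hr⟩ := D.exp_halt id
  exact ⟨r, (h.exp_iff _ _ _ _).2 hr⟩

/-- Exposures of a restriction, read back as exposures of the process with the free global name. -/
theorem Exp.unclose {a b : ℕ} (hb : b ≠ a) (hbP : b ∉ ((cls P).nuN a).FN) (haB : a ∉ B)
    (hbB : b ∉ B) (h : Exp k (P.rename (cloRen a)) (consRen b id) B α r) :
    Exp k P id (B.map (Equiv.swap b a).toEmbedding) (α.map (Pre.ren (Equiv.swap b a)))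
      (r.ren (Equiv.swap b a)) := by
  have hcl : consRen a id ∘ cloRen a = id := by
    funext i
    by_cases h : i = a
    · subst h; simp [cloRen_self]
    · simp [cloRen_of_ne h]
  have := h.map (Equiv.swap b a) (f := consRen a id) (ρ := id) ?_
  · rwa [rename_rename, hcl, rename_id] at this
  · intro i hi
    rw [FN_rename] at hi
    obtain ⟨j, hj, rfl⟩ := hi
    by_cases hja : j = a
    · subst hja; simp [cloRen_self]
    · rw [cloRen_of_ne hja]
      refine Equiv.swap_apply_of_ne_of_ne (fun hjb : j = b => ?_) hja
      subst hjb
      exact hbP (by rw [FN_nuN]; exact ⟨hj, hja⟩)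

/-- A reduction of a restricted process comes from a reduction under the restriction. -/
theorem StepQ.of_nuN {a : ℕ} {p q : Cls} (h : StepQ (Cls.nuN a p) q) :
    ∃ q', StepQ p q' ∧ q = Cls.nuN a q' := by
  obtain ⟨P, rfl⟩ := cls_surj p
  obtain ⟨B, x, z, p, p', r, h1, rfl, hB⟩ := StepQ.exp (P := .nu (P.rename (cloRen a))) h
    (Set.finite_singleton a).coInf
  have haB : a ∉ B := fun h => hB a h rfl
  have key : ∃ b B' r', b ≠ a ∧ b ∉ B' ∧ a ∉ B' ∧ b ∉ ((cls P).nuN a).FN ∧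
      Exp true (P.rename (cloRen a)) (consRen b id) B' ({.inp x p} + {.out x z p'}) r' ∧
      Cls.close B (p.inst z + p' + r) = Cls.nuN b (Cls.close B' (p.inst z + p' + r')) := by
    have hFN : ((Proc.nu (P.rename (cloRen a))).rename id).FN = ((cls P).nuN a).FN := by
      rw [rename_id]; rfl
    rcases h1.nu_inv (Set.finite_singleton a) with
      ⟨b, B', rfl, k1, k2, k3, k4⟩ | ⟨b, r', hb, rfl, k1, k2, k3, k4⟩
    · simp only [Finset.mem_insert, not_or] at haB
      exact ⟨b, B', r, Ne.symm haB.1, k1, haB.2, hFN ▸ k2, k4, close_insert k1 _⟩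
    · refine ⟨b, B, r', hb, k1, haB, hFN ▸ k2, k4, ?_⟩
      rw [nuN_close, nuN_add]
      exact fun h => k3 (FN_react x z p p' h)
  obtain ⟨b, B', r', hb, hbB, haB', hbP, h2, e⟩ := key
  have h3 := h2.unclose hb hbP haB' hbB
  refine ⟨(Cls.close B' (p.inst z + p' + r')).ren (Equiv.swap b a), ?_, ?_⟩
  · have h4 := h3.sound
    rw [rename_id] at h4
    rw [h4, ren_close, ren_add]
    refine StepQ.close ?_ _
    refine StepQ.add_right ?_ _
    simp only [Multiset.map_add, Multiset.map_singleton, preSum_add, preSum_singleton, Pre.ren]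
    have : (p.inst z).ren (Equiv.swap b a) =
        (p.ren (upRen 1 (Equiv.swap b a))).inst (Equiv.swap b a z) := by
      simp only [Cls.inst, ren_ren, comp_consRen, consRen_comp_upRen]
      rfl
    rw [ren_add, this]
    exact .react _ _ _ _
  · rw [e, nuN_swap]
    rw [FN_close]
    rintro ⟨hh, -⟩
    have : a ∈ ((P.rename (cloRen a)).rename (consRen b id)).FN ∪ B' := by
      rw [Cls.FN_add] at hh
      rcases hh with hh | hh
      · exact h2.FN.1 (FN_react x z p p' hh)
      · exact h2.FN.2.1 hh
    rcases this with h | h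
    · rcases mem_FN_rename_consRen h with h | h
      · exact hb h.symm
      · rw [rename_id] at h
        have : a ∈ ((cls P).nuN a).FN := h
        rw [FN_nuN] at this
        exact this.2 rfl
    · exact haB' h

theorem StepQ.of_close {X : Finset ℕ} {p q : Cls} (h : StepQ (Cls.close X p) q) :
    ∃ q', StepQ p q' ∧ q = Cls.close X q' := by
  induction X using Finset.induction_on generalizing q with
  | empty => exact ⟨q, h, rfl⟩
  | insert a X ha ih =>
    rw [close_insert ha] at h
    obtain ⟨q', h1, rfl⟩ := h.of_nuN
    obtain ⟨q'', h2, rfl⟩ := ih h1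
    exact ⟨q'', h2, (close_insert ha _).symm⟩

theorem SuccQ.of_nuN {a : ℕ} {p : Cls} (h : SuccQ (Cls.nuN a p)) : SuccQ p := by
  obtain ⟨P, rfl⟩ := cls_surj p
  obtain ⟨r, h1⟩ := SuccQ.exp (P := .nu (P.rename (cloRen a))) h
  have hFN : ((Proc.nu (P.rename (cloRen a))).rename id).FN = ((cls P).nuN a).FN := by
    rw [rename_id]; rfl
  rcases h1.nu_inv (Set.finite_singleton a) with
    ⟨b, B', k0, k1, k2, k3, k4⟩ | ⟨b, r', hb, rfl, k1, k2, k3, k4⟩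
  · simp [Pre.FN] at k3
  · have h4 := (k4.unclose hb (hFN ▸ k2) (by simp) (by simp)).sound
    rw [rename_id] at h4
    rw [h4]
    simp only [Multiset.map_singleton, preSum_singleton, Pre.ren]
    exact .close_stop_add _ _

theorem SuccQ.of_close {X : Finset ℕ} {p : Cls} (h : SuccQ (Cls.close X p)) : SuccQ p := by
  induction X using Finset.induction_on with
  | empty => exact h
  | insert a X ha ih =>
    rw [close_insert ha] at h
    exact ih h.of_nuN

/-- The residual `r` of an exposure can be opened further, with fresh names. -/
def Opens (P : Proc) (ρ : ℕ → ℕ) (B : Finset ℕ) (α : Multiset Pre) (r : Cls) : Prop :=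
  ∀ W : Set ℕ, CoInf W → ∃ K r', Exp false P ρ (B ∪ K) α r' ∧ Disjoint B K ∧ (∀ x ∈ K, x ∉ W) ∧
    r = Cls.close K r'

/-- Two exposures that can be opened further can be opened together, with disjoint names. -/
theorem Opens.combine {B C : Finset ℕ} {α β : Multiset Pre} {r t : Cls}
    (ih1 : Opens P ρ B α r) (ih2 : Opens Q ρ C β t) (hd : Disjoint B C)
    (hB : ∀ x ∈ B, x ∉ (Q.rename ρ).FN) (hC : ∀ x ∈ C, x ∉ (P.rename ρ).FN)
    (W : Set ℕ) (hW : CoInf W) :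
    ∃ K L r' t', Exp false P ρ (B ∪ K) α r' ∧ Exp false Q ρ (C ∪ L) β t' ∧
      Disjoint (B ∪ K) (C ∪ L) ∧ (∀ x ∈ B ∪ K, x ∉ (Q.rename ρ).FN) ∧
      (∀ x ∈ C ∪ L, x ∉ (P.rename ρ).FN) ∧ Disjoint (B ∪ C) (K ∪ L) ∧ (∀ x ∈ K ∪ L, x ∉ W) ∧
      r + t = Cls.close (K ∪ L) (r' + t') := by
  obtain ⟨K1, r1, e1, d1, w1, rfl⟩ := ih1 _
    (hW.union ((Q.rename ρ).FN_finite.union C.finite_toSet))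
  obtain ⟨K2, r2, e2, d2, w2, rfl⟩ := ih2 _
    (hW.union ((P.rename ρ).FN_finite.union (B ∪ K1).finite_toSet))
  simp only [Set.mem_union, not_or, Finset.coe_union, Finset.mem_coe] at w1 w2
  have dK : Disjoint K1 K2 := Finset.disjoint_right.2 fun x hx => (w2 x hx).2.2.2
  have dBK : Disjoint B K2 := Finset.disjoint_right.2 fun x hx => (w2 x hx).2.2.1
  have dCK : Disjoint C K1 := Finset.disjoint_right.2 fun x hx => (w1 x hx).2.2
  refine ⟨K1, K2, r1, r2, e1, e2, ?_, ?_, ?_, ?_, ?_, (close_union_add dK ?_ ?_).symm⟩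
  · simp only [Finset.disjoint_union_left, Finset.disjoint_union_right]
    exact ⟨⟨hd, dCK.symm⟩, dBK, dK⟩
  · intro x hx
    rcases Finset.mem_union.1 hx with h | h
    · exact hB x h
    · exact (w1 x h).2.1
  · intro x hx
    rcases Finset.mem_union.1 hx with h | h
    · exact hC x h
    · exact (w2 x h).2.1
  · simp only [Finset.disjoint_union_left, Finset.disjoint_union_right]
    exact ⟨⟨d1, dCK⟩, dBK, d2⟩
  · intro x hx
    rcases Finset.mem_union.1 hx with h | h
    · exact (w1 x h).1
    · exact (w2 x h).1
  · intro x hx h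
    rcases e2.FN.2.1 h with h | h
    · exact (w1 x hx).2.1 h
    · rcases Finset.mem_union.1 h with h | h
      · exact (w1 x hx).2.2 h
      · exact Finset.disjoint_left.1 dK hx h
  · intro x hx h
    rcases e1.FN.2.1 h with h | h
    · exact (w2 x hx).2.1 h
    · rcases Finset.mem_union.1 h with h | h
      · exact (w2 x hx).2.2.1 h
      · exact (w2 x hx).2.2.2 h

/-- The restrictions that stay with the residual can be extruded as well. -/
theorem Exp.openAll (h : Exp true P ρ B α r) : Opens P ρ B α r := by
  induction h with
  | leaf ρ h => exact fun W hW => ⟨∅, _, .leaf ρ h, by simp, by simp, rfl⟩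
  | zero ρ => exact fun W hW => ⟨∅, _, .zero ρ, by simp, by simp, rfl⟩
  | inp x P ρ => exact fun W hW => ⟨∅, _, .inp x P ρ, by simp, by simp, rfl⟩
  | out x z P ρ => exact fun W hW => ⟨∅, _, .out x z P ρ, by simp, by simp, rfl⟩
  | halt ρ => exact fun W hW => ⟨∅, _, .halt ρ, by simp, by simp, rfl⟩
  | par hP hQ hd hB hC ih1 ih2 =>
    intro W hW
    obtain ⟨K, L, r', t', e1, e2, d, hB', hC', d', hW', e⟩ :=
      ih1.combine ih2 hd hB hC W hW
    refine ⟨K ∪ L, r' + t', ?_, d', hW', e⟩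
    rw [Finset.union_union_union_comm]
    exact .par e1 e2 d hB' hC'
  | bang hP hQ hd hB hC ih1 ih2 =>
    intro W hW
    obtain ⟨K, L, r', t', e1, e2, d, hB', hC', d', hW', e⟩ :=
      ih1.combine ih2 hd hB hC W hW
    refine ⟨K ∪ L, r' + t', ?_, d', hW', e⟩
    rw [Finset.union_union_union_comm]
    exact .bang e1 e2 d hB' hC'
  | @nuOpen P ρ a B α r hP haB ha hk' ih =>
    intro W hW
    obtain ⟨K, r', e, d, w, rfl⟩ := ih _ (hW.union (Set.finite_singleton a))
    have haK : a ∉ K := fun h => w a h (.inr rfl)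
    refine ⟨K, r', ?_, ?_, fun x hx h => w x hx (.inl h), rfl⟩
    · rw [Finset.insert_union]
      exact .nuOpen e (by simp [haB, haK]) ha (by simp)
    · simp [haK, d]
  | @nuKeep P ρ a B α r hP haB ha hk' haα ih =>
    intro W hW
    obtain ⟨K, r', e, d, w, rfl⟩ := ih _ (hW.union (Set.finite_singleton a))
    have haK : a ∉ K := fun h => w a h (.inr rfl)
    -- The name `a` of the kept restriction may lie in `W`, so it is replaced by a fresh name `b`.
    obtain ⟨b, hb⟩ := CoInf.exists_notMem
      ((hW.union ((B ∪ K).finite_toSet.union (FNs_finite α))).union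
      (((Proc.nu P).rename ρ).FN_finite.union r'.FN_finite))
    simp only [Set.mem_union, not_or, Finset.mem_coe, Finset.mem_union] at hb
    obtain ⟨⟨h1, ⟨h2, h2'⟩, h3⟩, h4, h5⟩ := hb
    refine ⟨insert b K, r'.ren (Equiv.swap a b), ?_, ?_, ?_, ?_⟩
    · rw [Finset.union_insert]
      refine .nuOpen ?_ (by simp [h2, h2']) h4 (by simp)
      have := e.map (Equiv.swap a b) (f := id) (ρ := consRen b ρ) ?_
      · rwa [Finset.map_swap_eq_self (by simp [haB, haK]) (by simp [h2, h2']),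
          map_ren_eq_self (swap_eq_self_of_notMem haα h3), rename_id] at this
      · rintro (_ | i) hi
        · simp
        · have hm : ρ i ∈ ((Proc.nu P).rename ρ).FN := by
            rw [FN_rename]; exact ⟨i, hi, rfl⟩
          exact Equiv.swap_apply_of_ne_of_ne (fun h => ha (h ▸ hm)) (fun h => h4 (h ▸ hm))
    · simp [h2, d]
    · intro x hx
      rcases Finset.mem_insert.1 hx with rfl | hx
      · exact h1
      · exact fun h => w x hx (.inl h)
    · have : (Cls.close K r').ren (Equiv.swap a b) = Cls.close K (r'.ren (Equiv.swap a b)) := by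
        rw [ren_close, Finset.map_swap_eq_self haK h2']
      rw [close_insert h2', ← this, nuN_swap]
      rw [FN_close]
      exact fun h => h5 h.1

/-- Every reduction is a communication between two exposed prefixes, where all restrictions on the
way are extruded. -/
theorem StepQ.opens {q : Cls} (h : StepQ (cls P) q) {W : Set ℕ} (hW : CoInf W) :
    ∃ B x z p p' r, Exp false P id B ({.inp x p} + {.out x z p'}) r ∧
      q = Cls.close B (p.inst z + p' + r) ∧ ∀ b ∈ B, b ∉ W := by
  obtain ⟨B, x, z, p, p', r, h1, rfl, h3⟩ := h.exp hW
  obtain ⟨K, r', h4, h5, h6, rfl⟩ := h1.openAll _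
    (hW.union (FNs_finite ({Pre.inp x p} + {Pre.out x z p'})))
  refine ⟨B ∪ K, x, z, p, p', r', h4, ?_, ?_⟩
  · rw [close_union h5, ← close_add]
    exact fun y hy h => h6 y hy (.inr (FN_react x z p p' h))
  · intro b hb
    rcases Finset.mem_union.1 hb with h | h
    · exact h3 b h
    · exact fun h' => h6 b h (.inl h')

/-- A successful process exposes `Stop` even if all restrictions on the way are extruded. -/
theorem SuccQ.opens (h : SuccQ (cls P)) {W : Set ℕ} (hW : CoInf W) :
    ∃ B r, Exp false P id B {.halt} r ∧ ∀ b ∈ B, b ∉ W := by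
  obtain ⟨r, h1⟩ := h.exp
  obtain ⟨K, r', h4, -, h6, -⟩ := h1.openAll _ hW
  exact ⟨_, r', h4, by simpa using h6⟩

end PiStop

namespace CH
variable {S : Signature}

/-! ### Renaming and substitution in `CH` -/

theorem upRen_comp_add (k : ℕ) (ρ : ℕ → ℕ) : upRen k ρ ∘ (· + k) = (· + k) ∘ ρ := by
  funext i
  simp [upRen]

namespace Expr

theorem rename_rename (e : Expr S) (ρ σ : ℕ → ℕ) : (e.rename σ).rename ρ = e.rename (ρ ∘ σ) := by
  induction e generalizing ρ σ <;> simp_all [rename, upRen_comp]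

@[simp] theorem rename_id (e : Expr S) : e.rename id = e := by
  induction e <;> simp_all [rename, upRen_id]

theorem rename_shift (k : ℕ) (e : Expr S) (ρ : ℕ → ℕ) :
    (e.shift k).rename (upRen k ρ) = (e.rename ρ).shift k := by
  simp only [shift, rename_rename, upRen_comp_add]

theorem upSubst_comp_upRen (k : ℕ) (σ : ℕ → Expr S) (ρ : ℕ → ℕ) :
    upSubst k σ ∘ upRen k ρ = upSubst k (σ ∘ ρ) := by
  funext i
  simp only [upSubst, upRen, Function.comp]
  by_cases h : i < k <;> simp [h]

theorem subst_rename (e : Expr S) (σ : ℕ → Expr S) (ρ : ℕ → ℕ) :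
    (e.rename ρ).subst σ = e.subst (σ ∘ ρ) := by
  induction e generalizing ρ σ <;> simp_all [rename, subst, upSubst_comp_upRen]

theorem rename_upSubst (k : ℕ) (σ : ℕ → Expr S) (ρ : ℕ → ℕ) :
    (fun i => (upSubst k σ i).rename (upRen k ρ)) = upSubst k fun i => (σ i).rename ρ := by
  funext i
  simp only [upSubst]
  by_cases h : i < k
  · simp [h, rename, upRen]
  · simp [h, rename_shift]

theorem rename_subst (e : Expr S) (σ : ℕ → Expr S) (ρ : ℕ → ℕ) :
    (e.subst σ).rename ρ = e.subst fun i => (σ i).rename ρ := by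
  induction e generalizing ρ σ <;> simp_all [rename, subst, rename_upSubst]

theorem upSubst_var (k : ℕ) : upSubst (S := S) k var = var := by
  funext i
  simp only [upSubst]
  split
  · rfl
  · simp only [shift, rename]
    congr 1
    omega

@[simp] theorem subst_var (e : Expr S) : e.subst var = e := by
  induction e <;> simp_all [subst, upSubst_var]

theorem upSubst_comp_var (k : ℕ) (f : ℕ → ℕ) :
    upSubst (S := S) k (var ∘ f) = var ∘ upRen k f := by
  funext i
  simp only [upSubst, upRen, Function.comp, shift, rename]
  split <;> rfl

theorem subst_comp_var (e : Expr S) (f : ℕ → ℕ) : e.subst (var ∘ f) = e.rename f := by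
  induction e generalizing f <;> simp_all [subst, rename, upSubst_comp_var]

/-- The substitution performed by `Expr.inst`. -/
theorem inst_eq_subst {k : ℕ} (e : Expr S) (a : Fin k → Expr S) :
    e.inst a = e.subst fun i => if h : i < k then a ⟨i, h⟩ else var (i - k) := rfl

theorem inst_rename {k : ℕ} (e : Expr S) (a : Fin k → Expr S) (ρ : ℕ → ℕ) :
    (e.inst a).rename ρ = (e.rename (upRen k ρ)).inst fun i => (a i).rename ρ := by
  rw [inst_eq_subst, inst_eq_subst, rename_subst, subst_rename]
  congr 1
  funext i
  simp only [Function.comp, upRen]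
  by_cases h : i < k
  · simp [h]
  · simp [h, rename]

theorem inst_shift {k : ℕ} (e : Expr S) (a : Fin k → Expr S) : (e.shift k).inst a = e := by
  rw [inst_eq_subst, shift, subst_rename]
  convert subst_var e
  funext i
  simp

end Expr

/-- Extends a map on variables by the values `a` at the newest variables `0, …, k - 1`. -/
def consRens {k : ℕ} (a : Fin k → ℕ) (ρ : ℕ → ℕ) (i : ℕ) : ℕ :=
  if h : i < k then a ⟨i, h⟩ else ρ (i - k)

theorem consRens_one (a : Fin 1 → ℕ) (ρ : ℕ → ℕ) : consRens a ρ = consRen (a 0) ρ := by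
  funext i
  rcases i with _ | i
  · rfl
  · simp [consRens]

theorem consRens_succ {k : ℕ} (a : Fin (k + 1) → ℕ) (ρ : ℕ → ℕ) :
    consRens a ρ = consRen (a 0) (consRens (fun i => a i.succ) ρ) := by
  funext i
  rcases i with _ | i
  · rfl
  · simp only [consRens, consRen_succ, Nat.add_lt_add_iff_right, Nat.reduceSubDiff]
    rfl

theorem consRens_comp_add {k : ℕ} (a : Fin k → ℕ) (ρ : ℕ → ℕ) : consRens a ρ ∘ (· + k) = ρ := by
  funext i
  simp [consRens]

theorem Expr.rename_consRens {k : ℕ} (e : Expr S) (a : Fin k → ℕ) (ρ : ℕ → ℕ) :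
    e.rename (consRens a ρ) = (e.rename (upRen k ρ)).inst fun i => var (a i) := by
  rw [inst_eq_subst, subst_rename, ← subst_comp_var]
  congr 1
  funext i
  simp only [Function.comp, consRens, upRen]
  by_cases h : i < k
  · simp [h]
  · simp [h]

namespace MCtx

/-- Renaming of a monadic context. -/
def rename (ρ : ℕ → ℕ) : MCtx S → MCtx S
  | hole => hole
  | bind M e => bind (M.rename ρ) (e.rename ρ)

theorem plug_rename (M : MCtx S) (e : Expr S) (ρ : ℕ → ℕ) :
    (M.plug e).rename ρ = (M.rename ρ).plug (e.rename ρ) := by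
  induction M <;> simp_all [plug, rename, Expr.rename]

theorem rename_consRens_shift {k : ℕ} (M : MCtx S) (a : Fin k → ℕ) (ρ : ℕ → ℕ) :
    (M.shift k).rename (consRens a ρ) = M.rename ρ := by
  induction M <;> simp_all [shift, rename, Expr.shift, Expr.rename_rename, consRens_comp_add]

theorem rename_eq_plug {M : MCtx S} {e r : Expr S} {ρ : ℕ → ℕ} (h : e.rename ρ = M.plug r) :
    ∃ M' r', e = MCtx.plug M' r' ∧ M'.rename ρ = M ∧ r'.rename ρ = r := by
  induction M generalizing e with
  | hole => exact ⟨hole, e, rfl, rfl, h⟩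
  | bind M d ih =>
    cases e <;> simp only [Expr.rename, plug, reduceCtorEq, Expr.bind.injEq] at h
    obtain ⟨M', r', rfl, rfl, rfl⟩ := ih h.1
    exact ⟨bind M' _, r', rfl, by rw [rename, h.2], rfl⟩

end MCtx

namespace ECtx

/-- Renaming of an evaluation context. -/
def rename (ρ : ℕ → ℕ) : ECtx S → ECtx S
  | hole => hole
  | app E e => app (E.rename ρ) (e.rename ρ)
  | seq E e => seq (E.rename ρ) (e.rename ρ)
  | case T E alts => case T (E.rename ρ) fun c => (alts c).rename (upRen (T.arity c) ρ)

theorem plug_rename (E : ECtx S) (e : Expr S) (ρ : ℕ → ℕ) :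
    (E.plug e).rename ρ = (E.rename ρ).plug (e.rename ρ) := by
  induction E <;> simp_all [plug, rename, Expr.rename]

theorem rename_consRens_shift {k : ℕ} (E : ECtx S) (a : Fin k → ℕ) (ρ : ℕ → ℕ) :
    (E.shift k).rename (consRens a ρ) = E.rename ρ := by
  induction E <;>
    simp_all [shift, rename, Expr.shift, Expr.rename_rename, consRens_comp_add, upRen_comp]

theorem rename_eq_plug {E : ECtx S} {e r : Expr S} {ρ : ℕ → ℕ} (h : e.rename ρ = E.plug r) :
    ∃ E' r', e = ECtx.plug E' r' ∧ E'.rename ρ = E ∧ r'.rename ρ = r := by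
  induction E generalizing e with
  | hole => exact ⟨hole, e, rfl, rfl, h⟩
  | app E d ih =>
    cases e <;> simp only [Expr.rename, plug, reduceCtorEq, Expr.app.injEq] at h
    obtain ⟨E', r', rfl, rfl, rfl⟩ := ih h.1
    exact ⟨app E' _, r', rfl, by rw [rename, h.2], rfl⟩
  | seq E d ih =>
    cases e <;> simp only [Expr.rename, plug, reduceCtorEq, Expr.seq.injEq] at h
    obtain ⟨E', r', rfl, rfl, rfl⟩ := ih h.1
    exact ⟨seq E' _, r', rfl, by rw [rename, h.2], rfl⟩
  | case T E alts ih =>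
    cases e <;> simp only [Expr.rename, plug, reduceCtorEq, Expr.case.injEq] at h
    obtain ⟨rfl, h1, h2⟩ := h
    obtain ⟨E', r', rfl, rfl, rfl⟩ := ih h1
    exact ⟨case _ E' _, r', rfl, by rw [rename, eq_of_heq h2], rfl⟩

end ECtx

namespace FCtx

/-- Renaming of a forcing context. -/
def rename (ρ : ℕ → ℕ) : FCtx S → FCtx S
  | eval E => eval (E.rename ρ)
  | takeMVar E => takeMVar (E.rename ρ)
  | putMVar E e => putMVar (E.rename ρ) (e.rename ρ)

theorem plug_rename (F : FCtx S) (e : Expr S) (ρ : ℕ → ℕ) :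
    (F.plug e).rename ρ = (F.rename ρ).plug (e.rename ρ) := by
  cases F <;> simp [plug, rename, Expr.rename, ECtx.plug_rename]

theorem rename_consRens_shift {k : ℕ} (F : FCtx S) (a : Fin k → ℕ) (ρ : ℕ → ℕ) :
    (F.shift k).rename (consRens a ρ) = F.rename ρ := by
  cases F <;> simp [shift, rename, ECtx.rename_consRens_shift, Expr.shift, Expr.rename_rename,
    consRens_comp_add]

theorem rename_eq_plug {F : FCtx S} {e r : Expr S} {ρ : ℕ → ℕ} (h : e.rename ρ = F.plug r) :
    ∃ F' r', e = FCtx.plug F' r' ∧ F'.rename ρ = F ∧ r'.rename ρ = r := by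
  cases F with
  | eval E =>
    obtain ⟨E', r', rfl, rfl, rfl⟩ := ECtx.rename_eq_plug h
    exact ⟨eval E', r', rfl, rfl, rfl⟩
  | takeMVar E =>
    cases e <;> simp only [Expr.rename, plug, reduceCtorEq, Expr.takeMVar.injEq] at h
    obtain ⟨E', r', rfl, rfl, rfl⟩ := ECtx.rename_eq_plug h
    exact ⟨takeMVar E', r', rfl, rfl, rfl⟩
  | putMVar E d =>
    cases e <;> simp only [Expr.rename, plug, reduceCtorEq, Expr.putMVar.injEq] at h
    obtain ⟨E', r', rfl, rfl, rfl⟩ := ECtx.rename_eq_plug h.1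
    exact ⟨putMVar E' _, r', rfl, by rw [rename, h.2], rfl⟩

end FCtx

/-! ### The next action of a thread -/

/-- What a thread does next: a step of its own (`loc`), the lookup of a binding, the introduction of
bindings, an operation on MVars, or a fork. The function argument is the context of the redex. The
action `take x K` stands for `takeMVar x` with a variable `x`, and it also covers the case that `x`
is bound, so that the thread looks it up; likewise for `put x v K`. -/
inductive Act (S : Signature) : Type
  | loc (e : Expr S)
  | look (x : ℕ) (K : Expr S → Expr S)
  | letrec (k : ℕ) (b : Fin k → Expr S) (e : Expr S) (K : Expr S → Expr S)
  | new (v : Expr S) (K : Expr S → Expr S)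
  | fork (e : Expr S) (K : Expr S → Expr S)
  | take (x : ℕ) (K : Expr S → Expr S)
  | put (x : ℕ) (v : Expr S) (K : Expr S → Expr S)
  | stuck

namespace Act

/-- Puts the context `f` around a thread. -/
def map (f : Expr S → Expr S) : Act S → Act S
  | loc e => loc (f e)
  | look x K => look x (f ∘ K)
  | letrec k b e K => letrec k b e (f ∘ K)
  | new v K => new v (f ∘ K)
  | fork e K => fork e (f ∘ K)
  | take x K => take x (f ∘ K)
  | put x v K => put x v (f ∘ K)
  | stuck => stuck

theorem map_map (f g : Expr S → Expr S) (a : Act S) : (a.map g).map f = a.map (f ∘ g) := by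
  cases a <;> rfl

theorem map_id (a : Act S) : a.map id = a := by cases a <;> rfl

theorem map_eq_stuck {f : Expr S → Expr S} {a : Act S} : a.map f = stuck ↔ a = stuck := by
  cases a <;> simp [map]

end Act

namespace Expr

/-- `(alts c).inst args` for a constructor of a type that equals the type of the alternatives. -/
def instAlt {T' T : DataType S} (h : T' = T) (c : Fin T'.numCons)
    (args : Fin (T'.arity c) → Expr S) (alts : Fin T.numCons → Expr S) : Expr S :=
  (h ▸ alts : Fin T'.numCons → Expr S) c |>.inst args

open Classical in
/-- The action of `case T (con T' c args) alts`. -/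
noncomputable def caseCon (T' : DataType S) (c : Fin T'.numCons) (args : Fin (T'.arity c) → Expr S)
    (T : DataType S) (alts : Fin T.numCons → Expr S) : Act S :=
  if h : T' = T then .loc (instAlt h c args alts) else .stuck

theorem caseCon_self (T : DataType S) (c : Fin T.numCons) (args : Fin (T.arity c) → Expr S)
    (alts : Fin T.numCons → Expr S) : caseCon T c args T alts = .loc ((alts c).inst args) := by
  simp [caseCon, instAlt]

/-- The action of an expression in a functional position. -/
noncomputable def eact : Expr S → Act S
  | var x => .look x id
  | app e₁ e₂ =>
    match e₁ with
    | lam b => .loc (b.inst ![e₂])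
    | _ => (eact e₁).map (app · e₂)
  | letrec k b e => .letrec k b e id
  | seq e₁ e₂ =>
    match e₁ with
    | lam _ => .loc e₂
    | con _ _ _ => .loc e₂
    | _ => (eact e₁).map (seq · e₂)
  | case T e alts =>
    match e with
    | con T' c args => caseCon T' c args T alts
    | _ => (eact e).map (case T · alts)
  | _ => .stuck

/-- The action of a thread. -/
noncomputable def act : Expr S → Act S
  | bind e₁ e₂ =>
    match e₁ with
    | ret v => .loc (app e₂ v)
    | _ => (act e₁).map (bind · e₂)
  | takeMVar e =>
    match e with
    | var x => .take x id
    | _ => (eact e).map takeMVar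
  | putMVar e₁ e₂ =>
    match e₁ with
    | var x => .put x e₂ id
    | _ => (eact e₁).map (putMVar · e₂)
  | newMVar e => .new e id
  | fork e => .fork e id
  | e => eact e

/-- The redexes of functional positions, with their actions. -/
inductive EHead : Expr S → Act S → Prop
  | var (x) : EHead (var x) (.look x id)
  | letrec (k b e) : EHead (letrec k b e) (.letrec k b e id)
  | beta (e₁ e₂) : EHead (app (lam e₁) e₂) (.loc (e₁.inst ![e₂]))
  | case (T c args alts) : EHead (case T (con T c args) alts) (.loc ((alts c).inst args))
  | seq (v e) (hv : v.IsFunValue) : EHead (seq v e) (.loc e)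

theorem EHead.ne_stuck {r : Expr S} {a : Act S} (h : EHead r a) : a ≠ .stuck := by
  cases h <;> simp

theorem eact_eq_stuck_of_isFunValue {v : Expr S} (h : v.IsFunValue) : eact v = .stuck := by
  cases h <;> rfl

theorem eact_app {e : Expr S} (h : ∀ b, e ≠ lam b) (d : Expr S) :
    eact (app e d) = (eact e).map (app · d) := by
  cases e <;> first | rfl | exact (h _ rfl).elim

theorem eact_seq {e : Expr S} (h : ¬ e.IsFunValue) (d : Expr S) :
    eact (seq e d) = (eact e).map (seq · d) := by
  cases e <;> first | rfl | exact (h (.lam _)).elim | exact (h (.con _ _ _)).elim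

theorem eact_case {e : Expr S} (h : ∀ T c args, e ≠ con T c args) (T : DataType S)
    (alts : Fin T.numCons → Expr S) : eact (case T e alts) = (eact e).map (case T · alts) := by
  cases e <;> first | rfl | exact (h _ _ _ rfl).elim

theorem EHead.eact_plug {r : Expr S} {a : Act S} (h : EHead r a) (E : ECtx S) :
    eact (E.plug r) = a.map E.plug := by
  have hE : ∀ E : ECtx S, eact (E.plug r) = a.map E.plug → eact (E.plug r) ≠ .stuck := by
    intro E hE
    rw [hE]
    exact Act.map_eq_stuck.not.2 h.ne_stuck
  induction E with
  | hole =>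
    show eact r = a.map id
    rw [Act.map_id]
    cases h with
    | var | letrec | beta => rfl
    | case T c args alts => exact caseCon_self T c args alts
    | seq v e hv => cases hv <;> rfl
  | app E d ih =>
    have := eact_app (e := E.plug r) (fun b hb => hE E ih (hb ▸ rfl)) d
    rw [ih, Act.map_map] at this
    exact this
  | seq E d ih =>
    have := eact_seq (e := E.plug r) (fun hv => hE E ih (eact_eq_stuck_of_isFunValue hv)) d
    rw [ih, Act.map_map] at this
    exact this
  | case T E alts ih =>
    have := eact_case (e := E.plug r) (fun T c args hc => hE E ih (hc ▸ rfl)) T alts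
    rw [ih, Act.map_map] at this
    exact this

theorem exists_eHead {e : Expr S} (h : eact e ≠ .stuck) :
    ∃ E r a, e = ECtx.plug E r ∧ EHead r a ∧ eact e = a.map E.plug := by
  suffices hs : ∃ E r a, e = ECtx.plug E r ∧ EHead r a by
    obtain ⟨E, r, a, rfl, hr⟩ := hs
    exact ⟨E, r, a, rfl, hr, hr.eact_plug E⟩
  induction e with
  | var x => exact ⟨.hole, _, _, rfl, .var x⟩
  | letrec k b e => exact ⟨.hole, _, _, rfl, .letrec k b e⟩
  | app e d ih1 ih2 =>
    by_cases he : ∃ b, e = lam b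
    · obtain ⟨b, rfl⟩ := he
      exact ⟨.hole, _, _, rfl, .beta b d⟩
    · rw [eact_app (not_exists.1 he)] at h
      obtain ⟨E, r, a, rfl, hr⟩ := ih1 (mt Act.map_eq_stuck.2 h)
      exact ⟨.app E d, r, a, rfl, hr⟩
  | seq e d ih1 ih2 =>
    by_cases he : e.IsFunValue
    · exact ⟨.hole, _, _, rfl, .seq e d he⟩
    · rw [eact_seq he] at h
      obtain ⟨E, r, a, rfl, hr⟩ := ih1 (mt Act.map_eq_stuck.2 h)
      exact ⟨.seq E d, r, a, rfl, hr⟩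
  | case T e alts ih1 ih2 =>
    by_cases he : ∃ T' c args, e = con T' c args
    · obtain ⟨T', c, args, rfl⟩ := he
      by_cases hT : T' = T
      · subst hT
        exact ⟨.hole, _, _, rfl, .case T' c args alts⟩
      · exact (h (by simp [eact, caseCon, hT])).elim
    · simp only [not_exists] at he
      rw [eact_case he] at h
      obtain ⟨E, r, a, rfl, hr⟩ := ih1 (mt Act.map_eq_stuck.2 h)
      exact ⟨.case T E alts, r, a, rfl, hr⟩
  | _ => exact (h rfl).elim

/-- The redexes of threads, with their actions. -/
inductive Head : Expr S → Act S → Prop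
  | force (F : FCtx S) (r a) (h : EHead r a) (hF : ∀ x, r = var x → F ≠ .takeMVar .hole ∧
      ∀ v, F ≠ .putMVar .hole v) : Head (F.plug r) (a.map F.plug)
  | lunit (e₁ e₂) : Head (bind (ret e₁) e₂) (.loc (app e₂ e₁))
  | take (x) : Head (takeMVar (var x)) (.take x id)
  | put (x v) : Head (putMVar (var x) v) (.put x v id)
  | new (v) : Head (newMVar v) (.new v id)
  | fork (e) : Head (fork e) (.fork e id)

theorem Head.ne_stuck {r : Expr S} {a : Act S} (h : Head r a) : a ≠ .stuck := by
  cases h with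
  | force F r a h => exact Act.map_eq_stuck.not.2 h.ne_stuck
  | _ => simp

theorem act_eq_eact {e : Expr S} (h : eact e ≠ .stuck) : act e = eact e := by
  cases e <;> first | rfl | exact (h rfl).elim

theorem act_bind {e : Expr S} (h : ∀ v, e ≠ ret v) (d : Expr S) :
    act (bind e d) = (act e).map (bind · d) := by
  cases e <;> first | rfl | exact (h _ rfl).elim

theorem ECtx.plug_eq_var {E : ECtx S} {r : Expr S} {x : ℕ} (h : E.plug r = var x) :
    E = .hole ∧ r = var x := by
  cases E <;> simp_all [ECtx.plug]

theorem act_takeMVar {e : Expr S} (h : ∀ x, e ≠ var x) :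
    act (takeMVar e) = (eact e).map takeMVar := by
  cases e <;> first | rfl | exact (h _ rfl).elim

theorem act_putMVar {e : Expr S} (h : ∀ x, e ≠ var x) (d : Expr S) :
    act (putMVar e d) = (eact e).map (putMVar · d) := by
  cases e <;> first | rfl | exact (h _ rfl).elim

theorem Head.act_plug {r : Expr S} {a : Act S} (h : Head r a) (M : MCtx S) :
    act (M.plug r) = a.map M.plug := by
  induction M with
  | hole =>
    show act r = a.map id
    rw [Act.map_id]
    cases h with
    | force F r a h hF =>
      cases F with
      | eval E =>
        have := h.eact_plug E
        show act (E.plug r) = a.map E.plug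
        rw [act_eq_eact, this]
        rw [this]
        exact Act.map_eq_stuck.not.2 h.ne_stuck
      | takeMVar E =>
        show act (takeMVar (E.plug r)) = _
        rw [act_takeMVar, h.eact_plug E, Act.map_map]
        · rfl
        · intro x hx
          obtain ⟨rfl, rfl⟩ := ECtx.plug_eq_var hx
          exact (hF x rfl).1 rfl
      | putMVar E d =>
        show act (putMVar (E.plug r) d) = _
        rw [act_putMVar, h.eact_plug E, Act.map_map]
        · rfl
        · intro x hx
          obtain ⟨rfl, rfl⟩ := ECtx.plug_eq_var hx
          exact (hF x rfl).2 d rfl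
    | _ => rfl
  | bind M d ih =>
    have hM : act (M.plug r) ≠ .stuck := by
      rw [ih]
      exact Act.map_eq_stuck.not.2 h.ne_stuck
    have := act_bind (e := M.plug r) (fun v hv => hM (hv ▸ rfl)) d
    rw [ih, Act.map_map] at this
    exact this

theorem exists_head {e : Expr S} (h : act e ≠ .stuck) :
    ∃ M r a, e = MCtx.plug M r ∧ Head r a ∧ act e = a.map M.plug := by
  suffices hs : ∃ M r a, e = MCtx.plug M r ∧ Head r a by
    obtain ⟨M, r, a, rfl, hr⟩ := hs
    exact ⟨M, r, a, rfl, hr, hr.act_plug M⟩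
  have hE : ∀ {e : Expr S}, eact e ≠ .stuck → ∃ M r a, e = MCtx.plug M r ∧ Head r a := by
    intro e h
    obtain ⟨E, r, a, rfl, hr, -⟩ := exists_eHead h
    exact ⟨.hole, _, _, rfl, .force (.eval E) r a hr (by simp)⟩
  induction e with
  | bind e d ih1 ih2 =>
    by_cases he : ∃ v, e = ret v
    · obtain ⟨v, rfl⟩ := he
      exact ⟨.hole, _, _, rfl, .lunit v d⟩
    · rw [act_bind (not_exists.1 he)] at h
      obtain ⟨M, r, a, rfl, hr⟩ := ih1 (mt Act.map_eq_stuck.2 h)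
      exact ⟨.bind M d, r, a, rfl, hr⟩
  | takeMVar e ih =>
    by_cases he : ∃ x, e = var x
    · obtain ⟨x, rfl⟩ := he
      exact ⟨.hole, _, _, rfl, .take x⟩
    · push Not at he
      rw [act_takeMVar he] at h
      obtain ⟨E, r, a, rfl, hr, -⟩ := exists_eHead (mt Act.map_eq_stuck.2 h)
      refine ⟨.hole, _, _, rfl, .force (.takeMVar E) r a hr fun x hx => ⟨?_, by simp⟩⟩
      rintro hE
      cases hE
      exact he x hx
  | putMVar e d ih =>
    by_cases he : ∃ x, e = var x
    · obtain ⟨x, rfl⟩ := he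
      exact ⟨.hole, _, _, rfl, .put x d⟩
    · push Not at he
      rw [act_putMVar he] at h
      obtain ⟨E, r, a, rfl, hr, -⟩ := exists_eHead (mt Act.map_eq_stuck.2 h)
      refine ⟨.hole, _, _, rfl, .force (.putMVar E d) r a hr fun x hx => ⟨by simp, ?_⟩⟩
      rintro v hE
      cases hE
      exact he x hx
  | newMVar v => exact ⟨.hole, _, _, rfl, .new v⟩
  | fork e => exact ⟨.hole, _, _, rfl, .fork e⟩
  | _ => exact hE h

end Expr

end CH

namespace CH
variable {S : Signature}

/-! ### Opening processes of `CH` -/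

/-- The components of a process: threads, MVars and bindings. -/
inductive Comp (S : Signature) : Type
  | thread (main : Bool) (e : Expr S)
  | mvar (x : ℕ) (e : Expr S)
  | empty (x : ℕ)
  | share (x : ℕ) (e : Expr S)

namespace Comp

/-- Renaming of the free variables. -/
def rename (ρ : ℕ → ℕ) : Comp S → Comp S
  | thread m e => thread m (e.rename ρ)
  | mvar x e => mvar (ρ x) (e.rename ρ)
  | empty x => empty (ρ x)
  | share x e => share (ρ x) (e.rename ρ)

/-- A component as a process. -/
def toProc : Comp S → Proc S
  | thread m e => .thread m e
  | mvar x e => .mvar x e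
  | empty x => .emptyMVar x
  | share x e => .share x e

/-- The introduced variable of a component, if there is one. -/
def name : Comp S → Option ℕ
  | thread _ _ => none
  | mvar x _ => some x
  | empty x => some x
  | share x _ => some x

/-- Whether a component is a main thread. -/
def isMain : Comp S → Prop
  | thread m _ => m = true
  | _ => False

theorem rename_rename (c : Comp S) (ρ σ : ℕ → ℕ) : (c.rename σ).rename ρ = c.rename (ρ ∘ σ) := by
  cases c <;> simp [rename, Expr.rename_rename]

theorem toProc_rename (c : Comp S) (ρ : ℕ → ℕ) : c.toProc.rename ρ = (c.rename ρ).toProc := by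
  cases c <;> rfl

instance : DecidablePred (isMain (S := S)) := fun c => by
  cases c <;> unfold isMain <;> infer_instance

end Comp

/-- The introduced variables of a collection of components. -/
def names (L : Multiset (Comp S)) : Multiset ℕ := L.filterMap Comp.name

@[simp] theorem names_add (L M : Multiset (Comp S)) : names (L + M) = names L + names M :=
  Multiset.filterMap_add ..

namespace Proc

/-- `P.Open ρ A L`: the process `P`, whose free variable `i` is given the global name `ρ i`, has the
components `L` when its restricted variables are given the distinct global names `A`. -/
def Open : Proc S → (ℕ → ℕ) → Finset ℕ → Multiset (Comp S) → Prop
  | par P Q, ρ, A, L => ∃ A₁ A₂ L₁ L₂, Disjoint A₁ A₂ ∧ A = A₁ ∪ A₂ ∧ L = L₁ + L₂ ∧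
      P.Open ρ A₁ L₁ ∧ Q.Open ρ A₂ L₂
  | thread m e, ρ, A, L => A = ∅ ∧ L = {.thread m (e.rename ρ)}
  | nu P, ρ, A, L => ∃ a A', a ∉ A' ∧ A = insert a A' ∧ P.Open (consRen a ρ) A' L
  | mvar x e, ρ, A, L => A = ∅ ∧ L = {.mvar (ρ x) (e.rename ρ)}
  | emptyMVar x, ρ, A, L => A = ∅ ∧ L = {.empty (ρ x)}
  | share x e, ρ, A, L => A = ∅ ∧ L = {.share (ρ x) (e.rename ρ)}

theorem rename_rename (P : Proc S) (ρ σ : ℕ → ℕ) : (P.rename σ).rename ρ = P.rename (ρ ∘ σ) := by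
  induction P generalizing ρ σ <;> simp_all [rename, upRen_comp, Expr.rename_rename]

@[simp] theorem rename_id (P : Proc S) : P.rename id = P := by
  induction P <;> simp_all [rename, upRen_id]

theorem open_toProc (c : Comp S) (ρ : ℕ → ℕ) : c.toProc.Open ρ ∅ {c.rename ρ} := by
  cases c <;> exact ⟨rfl, rfl⟩

theorem open_rename {P : Proc S} {f ρ : ℕ → ℕ} {A : Finset ℕ} {L : Multiset (Comp S)} :
    (P.rename f).Open ρ A L ↔ P.Open (ρ ∘ f) A L := by
  induction P generalizing f ρ A L with
  | par P Q ih1 ih2 => simp only [rename, Open, ih1, ih2]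
  | nu P ih => simp only [rename, Open, ih, consRen_comp_upRen]
  | _ => simp only [rename, Open, Expr.rename_rename, Function.comp]

theorem open_shift {P : Proc S} {a : ℕ} {ρ : ℕ → ℕ} {A : Finset ℕ} {L : Multiset (Comp S)} :
    P.shift.Open (consRen a ρ) A L ↔ P.Open ρ A L := by
  rw [shift, open_rename, consRen_comp_succ]

end Proc

open Proc

/-- Structurally congruent processes have the same openings. -/
theorem Congr.open_iff {P Q : Proc S} (h : Congr P Q) :
    ∀ (ρ : ℕ → ℕ) (A : Finset ℕ) (L : Multiset (Comp S)), P.Open ρ A L ↔ Q.Open ρ A L := by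
  induction h with
  | refl => exact fun _ _ _ => Iff.rfl
  | symm _ ih => exact fun _ _ _ => (ih _ _ _).symm
  | trans _ _ ih1 ih2 => exact fun _ _ _ => (ih1 _ _ _).trans (ih2 _ _ _)
  | par _ _ ih1 ih2 => intro ρ A L; simp only [Proc.Open, ih1, ih2]
  | nu _ ih => intro ρ A L; simp only [Proc.Open, ih]
  | par_comm P Q =>
    have key : ∀ {P Q : Proc S} {ρ A L}, (Proc.par P Q).Open ρ A L → (Proc.par Q P).Open ρ A L := by
      rintro P Q ρ A L ⟨A₁, A₂, L₁, L₂, h, rfl, rfl, h1, h2⟩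
      exact ⟨A₂, A₁, L₂, L₁, h.symm, Finset.union_comm _ _, add_comm _ _, h2, h1⟩
    exact fun _ _ _ => ⟨key, key⟩
  | par_assoc P Q R =>
    intro ρ A L
    constructor
    · rintro ⟨_, A₃, _, L₃, h, rfl, rfl, ⟨A₁, A₂, L₁, L₂, h', rfl, rfl, h1, h2⟩, h3⟩
      rw [Finset.disjoint_union_left] at h
      exact ⟨A₁, A₂ ∪ A₃, L₁, L₂ + L₃, Finset.disjoint_union_right.2 ⟨h', h.1⟩,
        Finset.union_assoc _ _ _, add_assoc _ _ _, h1, A₂, A₃, L₂, L₃, h.2, rfl, rfl, h2, h3⟩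
    · rintro ⟨A₁, _, L₁, _, h, rfl, rfl, h1, ⟨A₂, A₃, L₂, L₃, h', rfl, rfl, h2, h3⟩⟩
      rw [Finset.disjoint_union_right] at h
      exact ⟨A₁ ∪ A₂, A₃, L₁ + L₂, L₃, Finset.disjoint_union_left.2 ⟨h.2, h'⟩,
        (Finset.union_assoc _ _ _).symm, (add_assoc _ _ _).symm,
        ⟨A₁, A₂, L₁, L₂, h.1, rfl, rfl, h1, h2⟩, h3⟩
  | nu_nu P =>
    have key : ∀ {P : Proc S} {ρ A L}, (Proc.nu (Proc.nu P)).Open ρ A L →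
        (Proc.nu (Proc.nu (P.rename swapRen))).Open ρ A L := by
      rintro P ρ A L ⟨a, _, ha, rfl, b, A, hb, rfl, h⟩
      simp only [Finset.mem_insert, not_or] at ha
      refine ⟨b, insert a A, ?_, Finset.insert_comm _ _ _, a, A, ha.2, rfl, ?_⟩
      · simp [Ne.symm ha.1, hb]
      · rwa [open_rename, consRen_consRen_comp_swapRen]
    refine fun _ _ _ => ⟨key, fun h => ?_⟩
    have h2 := key h
    simp only [Proc.Open, open_rename, Function.comp_assoc,
      show swapRen ∘ swapRen = id by funext i; rcases i with _ | _ | i <;> rfl,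
      Function.comp_id] at h2
    exact h2
  | nu_par P Q =>
    intro ρ A L
    constructor
    · rintro ⟨_, A₂, L₁, L₂, h, rfl, rfl, ⟨a, A₁, ha, rfl, h1⟩, h2⟩
      rw [Finset.disjoint_insert_left] at h
      exact ⟨a, A₁ ∪ A₂, by simp [ha, h.1], Finset.insert_union _ _ _, A₁, A₂, L₁, L₂, h.2, rfl, rfl,
        h1, open_shift.2 h2⟩
    · rintro ⟨a, _, ha, rfl, A₁, A₂, L₁, L₂, h, rfl, rfl, h1, h2⟩
      simp only [Finset.mem_union, not_or] at ha
      exact ⟨insert a A₁, A₂, L₁, L₂, Finset.disjoint_insert_left.2 ⟨ha.2, h⟩,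
        (Finset.insert_union _ _ _).symm, rfl, ⟨a, A₁, ha.1, rfl, h1⟩, open_shift.1 h2⟩

/-! ### Well-formedness and success of opened processes -/

/-- The introduced variables of a process are those of its components, without the restricted ones.
-/
theorem Proc.Open.introduced {P : Proc S} {ρ : ℕ → ℕ} {A : Finset ℕ} {L : Multiset (Comp S)}
    (h : P.Open ρ A L) {x : ℕ} (hx : x ∈ P.introduced) : ρ x ∈ names L := by
  induction P generalizing ρ A L x with
  | par P Q ih1 ih2 =>
    obtain ⟨A₁, A₂, L₁, L₂, -, -, rfl, h1, h2⟩ := h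
    rw [names_add, Multiset.mem_add]
    exact hx.imp (ih1 h1) (ih2 h2)
  | nu P ih =>
    obtain ⟨a, A', -, -, h⟩ := h
    exact ih h hx
  | thread m e => exact hx.elim
  | mvar y e => obtain ⟨-, rfl⟩ := h; obtain rfl := hx; simp [names, Comp.name]
  | emptyMVar y => obtain ⟨-, rfl⟩ := h; obtain rfl := hx; simp [names, Comp.name]
  | share y e => obtain ⟨-, rfl⟩ := h; obtain rfl := hx; simp [names, Comp.name]

/-- The condition on distinct introduced variables, in terms of the components. -/
theorem Proc.Open.introDistinct {P : Proc S} {ρ : ℕ → ℕ} {A : Finset ℕ} {L : Multiset (Comp S)}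
    (h : P.Open ρ A L) (hL : (names L).Nodup) : P.IntroDistinct := by
  induction P generalizing ρ A L with
  | par P Q ih1 ih2 =>
    obtain ⟨A₁, A₂, L₁, L₂, -, -, rfl, h1, h2⟩ := h
    rw [names_add, Multiset.nodup_add] at hL
    refine ⟨ih1 h1 hL.1, ih2 h2 hL.2.1, Set.disjoint_left.2 fun x hx hx' => ?_⟩
    exact Multiset.disjoint_left.1 hL.2.2 (h1.introduced hx) (h2.introduced hx')
  | nu P ih =>
    obtain ⟨a, A', -, -, h⟩ := h
    exact ih h hL
  | _ => trivial

theorem Proc.Open.numMain {P : Proc S} {ρ : ℕ → ℕ} {A : Finset ℕ} {L : Multiset (Comp S)}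
    (h : P.Open ρ A L) : P.numMain = L.countP Comp.isMain := by
  induction P generalizing ρ A L with
  | par P Q ih1 ih2 =>
    obtain ⟨A₁, A₂, L₁, L₂, -, -, rfl, h1, h2⟩ := h
    rw [Multiset.countP_add, ← ih1 h1, ← ih2 h2]
    rfl
  | nu P ih =>
    obtain ⟨a, A', -, -, h⟩ := h
    exact ih h
  | thread m e => obtain ⟨-, rfl⟩ := h; cases m <;> rfl
  | mvar y e => obtain ⟨-, rfl⟩ := h; rfl
  | emptyMVar y => obtain ⟨-, rfl⟩ := h; rfl
  | share y e => obtain ⟨-, rfl⟩ := h; rfl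

theorem Proc.Open.wellFormed {P : Proc S} {ρ : ℕ → ℕ} {A : Finset ℕ} {L : Multiset (Comp S)}
    (h : P.Open ρ A L) (hL : (names L).Nodup) (hm : L.countP Comp.isMain ≤ 1) : P.WellFormed :=
  ⟨h.introDistinct hL, h.numMain.trans_le hm⟩

theorem Proc.nus_succ' (k : ℕ) (P : Proc S) : nus (k + 1) P = nu (nus k P) := by
  induction k generalizing P with
  | zero => rfl
  | succ k ih => exact ih (nu P)

theorem Proc.Open.of_nus {k : ℕ} {P : Proc S} {ρ : ℕ → ℕ} {A : Finset ℕ} {L : Multiset (Comp S)}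
    (h : (nus k P).Open ρ A L) : ∃ ρ' A', P.Open ρ' A' L := by
  induction k generalizing ρ A with
  | zero => exact ⟨ρ, A, h⟩
  | succ k ih =>
    rw [nus_succ'] at h
    obtain ⟨a, A', -, -, h⟩ := h
    exact ih h

/-- A successful process has a main thread of the form `return e`. -/
theorem Successful.ret_mem {P : Proc S} {ρ : ℕ → ℕ} {A : Finset ℕ} {L : Multiset (Comp S)}
    (h : Successful P) (hP : P.Open ρ A L) : ∃ e, Comp.thread true (.ret e) ∈ L := by
  obtain ⟨-, k, e, h | ⟨P', h⟩⟩ := h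
  · obtain ⟨ρ', A', -, rfl⟩ := ((h.open_iff _ _ _).1 hP).of_nus
    exact ⟨e.rename ρ', by simp [Expr.rename]⟩
  · obtain ⟨ρ', A', A₁, A₂, L₁, L₂, -, -, rfl, ⟨-, rfl⟩, -⟩ := ((h.open_iff _ _ _).1 hP).of_nus
    exact ⟨e.rename ρ', by simp [Expr.rename]⟩

theorem congr_nus_par (k : ℕ) (P Q : Proc S) :
    ∃ Q', Congr (par (nus k P) Q) (nus k (par P Q')) := by
  induction k generalizing Q with
  | zero => exact ⟨Q, .refl _⟩
  | succ k ih =>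
    obtain ⟨Q', h⟩ := ih Q.shift
    simp only [nus_succ']
    exact ⟨Q', (Congr.nu_par _ _).trans h.nu⟩

theorem Congr.nus {P Q : Proc S} (h : Congr P Q) (k : ℕ) : Congr (nus k P) (nus k Q) := by
  induction k generalizing P Q with
  | zero => exact h
  | succ k ih => exact ih h.nu

/-- A well-formed process that has a main thread of the form `return e` is successful. -/
theorem Proc.Open.successful {P : Proc S} {ρ : ℕ → ℕ} {A : Finset ℕ} {L : Multiset (Comp S)}
    (h : P.Open ρ A L) (hP : P.WellFormed) {e : Expr S} (he : Comp.thread true (.ret e) ∈ L) :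
    Successful P := by
  refine ⟨hP, ?_⟩
  clear hP
  have key : ∀ {P Q : Proc S} {k e}, (Congr P (nus k (thread true (.ret e))) ∨
      ∃ P', Congr P (nus k (par (thread true (.ret e)) P'))) →
      ∃ P', Congr (par P Q) (nus k (par (thread true (.ret e)) P')) := by
    rintro P Q k e (h | ⟨P', h⟩)
    · obtain ⟨Q', h'⟩ := congr_nus_par k (thread true (.ret e)) Q
      exact ⟨Q', (h.par (.refl Q)).trans h'⟩
    · obtain ⟨Q', h'⟩ := congr_nus_par k (par (thread true (.ret e)) P') Q
      exact ⟨_, ((h.par (.refl Q)).trans h').trans (Congr.nus (Congr.par_assoc _ _ _) k)⟩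
  induction P generalizing ρ A L with
  | par P Q ih1 ih2 =>
    obtain ⟨A₁, A₂, L₁, L₂, -, -, rfl, h1, h2⟩ := h
    rcases Multiset.mem_add.1 he with he | he
    · obtain ⟨k, e, h⟩ := ih1 h1 he
      exact ⟨k, e, .inr (key h)⟩
    · obtain ⟨k, e, h⟩ := ih2 h2 he
      obtain ⟨P', h'⟩ := key (Q := P) h
      exact ⟨k, e, .inr ⟨P', (Congr.par_comm _ _).trans h'⟩⟩
  | nu P ih =>
    obtain ⟨a, A', -, -, h⟩ := h
    obtain ⟨k, e, h⟩ := ih h he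
    refine ⟨k + 1, e, ?_⟩
    simp only [nus_succ']
    exact h.imp (fun h => h.nu) fun ⟨P', h⟩ => ⟨P', h.nu⟩
  | thread m e' =>
    obtain ⟨-, rfl⟩ := h
    simp only [Multiset.mem_singleton, Comp.thread.injEq] at he
    obtain ⟨rfl, he⟩ := he
    cases e' <;> simp only [Expr.rename, reduceCtorEq] at he
    exact ⟨0, _, .inl (.refl _)⟩
  | mvar x e => obtain ⟨-, rfl⟩ := h; simp at he
  | emptyMVar x => obtain ⟨-, rfl⟩ := h; simp at he
  | share x e => obtain ⟨-, rfl⟩ := h; simp at he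

/-! ### Extracting components -/

theorem PCtx.congr {P Q : Proc S} (D : PCtx S) (h : Congr P Q) : Congr (D.plug P) (D.plug Q) := by
  induction D with
  | hole => exact h
  | parL D R ih => exact ih.par (.refl R)
  | parR R D ih => exact Congr.par (.refl R) ih
  | nu D ih => exact ih.nu

/-- Composition of process contexts. -/
def PCtx.comp : PCtx S → PCtx S → PCtx S
  | hole, D' => D'
  | parL D P, D' => parL (D.comp D') P
  | parR P D, D' => parR P (D.comp D')
  | nu D, D' => nu (D.comp D')

theorem PCtx.comp_plug (D D' : PCtx S) (P : Proc S) : (D.comp D').plug P = D.plug (D'.plug P) := by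
  induction D <;> simp_all [comp, plug]

/-- The environment `ρ` gives different global names to different variables, and does not use the
names in `A`, which can thus be given to restricted variables. -/
def EnvOK (ρ : ℕ → ℕ) (A : Finset ℕ) : Prop := ρ.Injective ∧ ∀ a ∈ A, ∀ i, ρ i ≠ a

theorem EnvOK.mono {ρ : ℕ → ℕ} {A B : Finset ℕ} (h : EnvOK ρ A) (hB : B ⊆ A) : EnvOK ρ B :=
  ⟨h.1, fun a ha => h.2 a (hB ha)⟩

theorem EnvOK.consRen {ρ : ℕ → ℕ} {a : ℕ} {A : Finset ℕ} (h : EnvOK ρ (insert a A)) (ha : a ∉ A) :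
    EnvOK (consRen a ρ) A := by
  refine ⟨?_, ?_⟩
  · rintro (_ | i) (_ | j) hij
    · rfl
    · exact (h.2 a (by simp) j hij.symm).elim
    · exact (h.2 a (by simp) i hij).elim
    · exact congrArg _ (h.1 hij)
  · rintro b hb (_ | i) hi
    · exact ha ((show a = b from hi) ▸ hb)
    · exact h.2 b (by simp [hb]) i hi

/-- The hole of `D` has the environment `ρ'`, and the components outside the hole are `M`. -/
def PCtx.Around (D : PCtx S) (ρ ρ' : ℕ → ℕ) (A : Finset ℕ) (M : Multiset (Comp S)) : Prop :=
  ∀ (R : Proc S) (B : Finset ℕ) (N : Multiset (Comp S)), Disjoint A B → R.Open ρ' B N →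
    (D.plug R).Open ρ (A ∪ B) (M + N)

theorem PCtx.Around.hole (ρ : ℕ → ℕ) : (PCtx.hole (S := S)).Around ρ ρ ∅ 0 := by
  intro R B N _ hR
  rw [Finset.empty_union, zero_add]
  exact hR

theorem PCtx.Around.nu {D : PCtx S} {ρ ρ' : ℕ → ℕ} {a : ℕ} {A : Finset ℕ}
    {M : Multiset (Comp S)} (h : D.Around (consRen a ρ) ρ' A M) (ha : a ∉ A) :
    D.nu.Around ρ ρ' (insert a A) M := by
  intro R B N hd hR
  rw [Finset.disjoint_insert_left] at hd
  exact ⟨a, A ∪ B, by simp [ha, hd.1], Finset.insert_union _ _ _, h R B N hd.2 hR⟩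

theorem PCtx.Around.parL {D : PCtx S} {ρ ρ' : ℕ → ℕ} {A A' : Finset ℕ}
    {M M' : Multiset (Comp S)} (h : D.Around ρ ρ' A M) {P : Proc S} (hP : P.Open ρ A' M')
    (hA : Disjoint A A') : (D.parL P).Around ρ ρ' (A ∪ A') (M + M') := by
  intro R B N hd hR
  rw [Finset.disjoint_union_left] at hd
  refine ⟨A ∪ B, A', M + N, M', ?_, ?_, ?_, h R B N hd.1 hR, hP⟩
  · exact Finset.disjoint_union_left.2 ⟨hA, hd.2.symm⟩
  · exact Finset.union_right_comm _ _ _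
  · exact add_right_comm _ _ _

theorem PCtx.Around.comp {D D' : PCtx S} {ρ ρ' ρ'' : ℕ → ℕ} {A A' : Finset ℕ}
    {M M' : Multiset (Comp S)} (h : D.Around ρ ρ' A M) (h' : D'.Around ρ' ρ'' A' M')
    (hA : Disjoint A A') : (D.comp D').Around ρ ρ'' (A ∪ A') (M + M') := by
  intro R B N hd hR
  rw [Finset.disjoint_union_left] at hd
  rw [comp_plug, Finset.union_assoc, add_assoc]
  exact h _ _ _ (Finset.disjoint_union_right.2 ⟨hA, hd.1⟩) (h' R B N hd.2 hR)

theorem cons_eq_singleton_iff {α : Type*} {c d : α} {M : Multiset α} :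
    c ::ₘ M = {d} ↔ c = d ∧ M = 0 := by
  constructor
  · intro h
    have h2 := congrArg Multiset.card h
    simp only [Multiset.card_cons, Multiset.card_singleton, Nat.add_eq_right,
      Multiset.card_eq_zero] at h2
    subst h2
    exact ⟨Multiset.singleton_inj.1 h, rfl⟩
  · rintro ⟨rfl, rfl⟩
    rfl

theorem cons_eq_add {α : Type*} {c : α} {M L₁ L₂ : Multiset α} (h : c ::ₘ M = L₁ + L₂) :
    (∃ L, L₁ = c ::ₘ L ∧ M = L + L₂) ∨ ∃ L, L₂ = c ::ₘ L ∧ M = L₁ + L := by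
  have hc : c ∈ L₁ + L₂ := h ▸ Multiset.mem_cons_self c M
  rcases Multiset.mem_add.1 hc with hc | hc
  · obtain ⟨L, rfl⟩ := Multiset.exists_cons_of_mem hc
    left
    rw [Multiset.cons_add, Multiset.cons_inj_right] at h
    exact ⟨L, rfl, h⟩
  · obtain ⟨L, rfl⟩ := Multiset.exists_cons_of_mem hc
    right
    rw [Multiset.add_cons, Multiset.cons_inj_right] at h
    exact ⟨L, rfl, h⟩

theorem Proc.Open.leaf {P : Proc S} {ρ : ℕ → ℕ} {A : Finset ℕ} {L : Multiset (Comp S)}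
    (h : P.Open ρ A L) : (∃ c : Comp S, P = c.toProc ∧ A = ∅ ∧ L = {c.rename ρ}) ∨
    (∃ P₁ P₂, P = par P₁ P₂) ∨ ∃ P', P = nu P' := by
  cases P with
  | par P Q => exact .inr (.inl ⟨_, _, rfl⟩)
  | nu P => exact .inr (.inr ⟨_, rfl⟩)
  | thread m e => exact .inl ⟨.thread m e, rfl, h⟩
  | mvar x e => exact .inl ⟨.mvar x e, rfl, h⟩
  | emptyMVar x => exact .inl ⟨.empty x, rfl, h⟩
  | share x e => exact .inl ⟨.share x e, rfl, h⟩

/-- A component of a process is found in a process context, without the use of congruence. -/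
theorem Proc.Open.extract {P : Proc S} {ρ : ℕ → ℕ} {A : Finset ℕ} {c : Comp S}
    {M : Multiset (Comp S)} (h : P.Open ρ A (c ::ₘ M)) (hρ : EnvOK ρ A) :
    ∃ (D : PCtx S) (c' : Comp S) (ρ' : ℕ → ℕ), P = D.plug c'.toProc ∧ c'.rename ρ' = c ∧
      ρ'.Injective ∧ D.Around ρ ρ' A M := by
  induction P generalizing ρ A M with
  | par P Q ih1 ih2 =>
    obtain ⟨A₁, A₂, L₁, L₂, hd, rfl, hL, h1, h2⟩ := h
    rcases cons_eq_add hL with ⟨L, rfl, rfl⟩ | ⟨L, rfl, rfl⟩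
    · obtain ⟨D, c', ρ', rfl, rfl, hi, hD⟩ := ih1 h1 (hρ.mono (by simp))
      exact ⟨D.parL Q, c', ρ', rfl, rfl, hi, hD.parL h2 hd⟩
    · obtain ⟨D, c', ρ', rfl, rfl, hi, hD⟩ := ih2 h2 (hρ.mono (by simp))
      refine ⟨.parR P D, c', ρ', rfl, rfl, hi, ?_⟩
      intro R B N hB hR
      have := hD.parL h1 hd.symm R B N (Finset.union_comm A₁ A₂ ▸ hB) hR
      rw [add_comm L₁, Finset.union_comm A₁]
      exact ((Congr.par_comm _ _).open_iff _ _ _).1 this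
  | nu P ih =>
    obtain ⟨a, A', ha, rfl, h⟩ := h
    obtain ⟨D, c', ρ', rfl, rfl, hi, hD⟩ := ih h (hρ.consRen ha)
    exact ⟨D.nu, c', ρ', rfl, rfl, hi, hD.nu ha⟩
  | _ =>
    rcases h.leaf with ⟨c', rfl', rfl, hL⟩ | ⟨_, _, h'⟩ | ⟨_, h'⟩
    · obtain ⟨rfl, rfl⟩ := (cons_eq_singleton_iff).1 hL
      refine ⟨.hole, c', ρ, rfl', rfl, hρ.1, .hole ρ⟩
    · cases h'
    · cases h'

/-- A component of the left part of a parallel composition can be moved next to the right part. -/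
theorem Proc.Open.extract_par {P : Proc S} {ρ : ℕ → ℕ} {A : Finset ℕ} {c : Comp S}
    {M : Multiset (Comp S)} (h : P.Open ρ A (c ::ₘ M)) (hρ : EnvOK ρ A) :
    ∃ (D : PCtx S) (c' : Comp S) (ρ' f : ℕ → ℕ),
      (∀ Q, Congr (par P Q) (D.plug (par c'.toProc (Q.rename f)))) ∧ ρ' ∘ f = ρ ∧
      c'.rename ρ' = c ∧ ρ'.Injective ∧ (∀ i, ρ' i ∈ A ∨ ∃ j, ρ' i = ρ j) ∧
      D.Around ρ ρ' A M := by
  induction P generalizing ρ A M with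
  | par P₁ P₂ ih1 ih2 =>
    obtain ⟨A₁, A₂, L₁, L₂, hd, rfl, hL, h1, h2⟩ := h
    rcases cons_eq_add hL with ⟨L, rfl, rfl⟩ | ⟨L, rfl, rfl⟩
    · obtain ⟨D, c', ρ', f, hc, rfl, rfl, hi, hr, hD⟩ := ih1 h1 (hρ.mono (by simp))
      refine ⟨D.parL P₂, c', ρ', f, fun Q => ?_, rfl, rfl, hi, fun i => ?_, hD.parL h2 hd⟩
      · refine .trans ?_ (Congr.par (hc Q) (.refl P₂))
        refine .trans (Congr.par_assoc _ _ _) (.trans ?_ (Congr.par_assoc _ _ _).symm)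
        exact Congr.par (.refl _) (Congr.par_comm _ _)
      · exact (hr i).imp_left fun h => by simp [h]
    · obtain ⟨D, c', ρ', f, hc, rfl, rfl, hi, hr, hD⟩ := ih2 h2 (hρ.mono (by simp))
      refine ⟨D.parL P₁, c', ρ', f, fun Q => ?_, rfl, rfl, hi, fun i => ?_, ?_⟩
      · refine .trans ?_ (Congr.par (hc Q) (.refl P₁))
        exact .trans (Congr.par_assoc _ _ _) (Congr.par_comm _ _)
      · exact (hr i).imp_left fun h => by simp [h]
      · rw [add_comm L₁, Finset.union_comm A₁]
        exact hD.parL h1 hd.symm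
  | nu P ih =>
    obtain ⟨a, A', ha, rfl, h⟩ := h
    obtain ⟨D, c', ρ', f, hc, hf, rfl, hi, hr, hD⟩ := ih h (hρ.consRen ha)
    refine ⟨D.nu, c', ρ', f ∘ Nat.succ, fun Q => ?_, ?_, rfl, hi, fun i => ?_, hD.nu ha⟩
    · refine .trans (Congr.nu_par _ _) (.trans (hc Q.shift).nu ?_)
      rw [shift, rename_rename]
      exact .refl _
    · rw [← Function.comp_assoc, hf, consRen_comp_succ]
    · rcases hr i with h | ⟨_ | j, h⟩
      · exact .inl (Finset.mem_insert_of_mem h)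
      · exact .inl (Finset.mem_insert.2 (.inl h))
      · exact .inr ⟨j, h⟩
  | _ =>
    rcases h.leaf with ⟨c', rfl', rfl, hL⟩ | ⟨_, _, h'⟩ | ⟨_, h'⟩
    · obtain ⟨rfl, rfl⟩ := (cons_eq_singleton_iff).1 hL
      refine ⟨.hole, c', ρ, id, fun Q => ?_, rfl, rfl, hρ.1, fun i => .inr ⟨i, rfl⟩, .hole ρ⟩
      rw [rfl', rename_id]
      exact .refl _
    · cases h'
    · cases h'

/-- Two components of a process can be brought together by structural congruence. -/
theorem Proc.Open.extract₂ {P : Proc S} {ρ : ℕ → ℕ} {A : Finset ℕ} {c₁ c₂ : Comp S}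
    {M : Multiset (Comp S)} (h : P.Open ρ A (c₁ ::ₘ c₂ ::ₘ M)) (hρ : EnvOK ρ A) :
    ∃ (D : PCtx S) (d₁ d₂ : Comp S) (ρ' : ℕ → ℕ),
      Congr P (D.plug (par d₁.toProc d₂.toProc)) ∧ d₁.rename ρ' = c₁ ∧ d₂.rename ρ' = c₂ ∧
      ρ'.Injective ∧ D.Around ρ ρ' A M := by
  induction P generalizing ρ A M c₁ c₂ with
  | par P Q ih1 ih2 =>
    have key : ∀ {P Q : Proc S} {c₁ c₂ A₁ A₂ L₁ L₂}, Disjoint A₁ A₂ → EnvOK ρ (A₁ ∪ A₂) →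
        P.Open ρ A₁ (c₁ ::ₘ L₁) → Q.Open ρ A₂ (c₂ ::ₘ L₂) →
        ∃ (D : PCtx S) (d₁ d₂ : Comp S) (ρ' : ℕ → ℕ),
          Congr (par P Q) (D.plug (par d₁.toProc d₂.toProc)) ∧ d₁.rename ρ' = c₁ ∧
          d₂.rename ρ' = c₂ ∧ ρ'.Injective ∧ D.Around ρ ρ' (A₁ ∪ A₂) (L₁ + L₂) := by
      intro P Q c₁ c₂ A₁ A₂ L₁ L₂ hd hρ h1 h2
      obtain ⟨D, c, ρ', f, hc, rfl, rfl, hi, hr, hD⟩ := h1.extract_par (hρ.mono (by simp))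
      rw [← open_rename] at h2
      obtain ⟨D', c', ρ'', f', hc', rfl, rfl, hi', -, hD'⟩ := h2.extract_par ⟨hi, by
        intro a ha i hia
        rcases hr i with h | ⟨j, h⟩
        · exact Finset.disjoint_left.1 hd h (hia ▸ ha)
        · exact hρ.2 a (by simp [ha]) j (h.symm.trans hia)⟩
      refine ⟨D.comp D', c.rename f', c', ρ'', ?_, ?_, rfl, hi', hD.comp hD' hd⟩
      · rw [PCtx.comp_plug]
        refine (hc Q).trans (D.congr ?_)
        refine .trans (Congr.par_comm _ _) (.trans (hc' _) (D'.congr ?_))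
        rw [Comp.toProc_rename]
        exact Congr.par_comm _ _
      · rw [Comp.rename_rename]
    obtain ⟨A₁, A₂, L₁, L₂, hd, rfl, hL, h1, h2⟩ := h
    rcases cons_eq_add hL with ⟨L, rfl, hL'⟩ | ⟨L, rfl, hL'⟩ <;>
      clear hL <;> rcases cons_eq_add hL' with ⟨L', rfl, rfl⟩ | ⟨L', rfl, rfl⟩
    · obtain ⟨D, d₁, d₂, ρ', hc, e1, e2, hi, hD⟩ := ih1 h1 (hρ.mono (by simp))
      exact ⟨D.parL Q, d₁, d₂, ρ', Congr.par hc (.refl Q), e1, e2, hi, hD.parL h2 hd⟩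
    · exact key hd hρ h1 h2
    · obtain ⟨D, d₁, d₂, ρ', hc, e1, e2, hi, hD⟩ := key hd hρ h1 h2
      exact ⟨D, d₂, d₁, ρ', hc.trans (D.congr (Congr.par_comm _ _)), e2, e1, hi, hD⟩
    · obtain ⟨D, d₁, d₂, ρ', hc, e1, e2, hi, hD⟩ := ih2 h2 (hρ.mono (by simp))
      refine ⟨D.parL P, d₁, d₂, ρ', (Congr.par_comm _ _).trans (Congr.par hc (.refl P)), e1, e2,
        hi, ?_⟩
      rw [add_comm L₁, Finset.union_comm A₁]
      exact hD.parL h1 hd.symm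
  | nu P ih =>
    obtain ⟨a, A', ha, rfl, h⟩ := h
    obtain ⟨D, d₁, d₂, ρ', hc, e1, e2, hi, hD⟩ := ih h (hρ.consRen ha)
    exact ⟨D.nu, d₁, d₂, ρ', hc.nu, e1, e2, hi, hD.nu ha⟩
  | _ =>
    rcases h.leaf with ⟨c', rfl', rfl, hL⟩ | ⟨_, _, h'⟩ | ⟨_, h'⟩
    · exact (Multiset.cons_ne_zero ((cons_eq_singleton_iff).1 hL).2).elim
    · cases h'
    · cases h'

/-- The components of a filled context are those of the hole and those around it. -/
theorem PCtx.open_plug {D : PCtx S} {R : Proc S} {ρ : ℕ → ℕ} {A : Finset ℕ}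
    {L : Multiset (Comp S)} (h : (D.plug R).Open ρ A L) :
    ∃ ρ' A₁ A₂ M N, Disjoint A₁ A₂ ∧ A = A₁ ∪ A₂ ∧ L = M + N ∧ R.Open ρ' A₂ N ∧
      D.Around ρ ρ' A₁ M := by
  induction D generalizing ρ A L with
  | hole => exact ⟨ρ, ∅, A, 0, L, by simp, by simp, by simp, h, .hole ρ⟩
  | parL D P ih =>
    obtain ⟨B₁, B₂, L₁, L₂, hd, rfl, rfl, h1, h2⟩ := h
    obtain ⟨ρ', A₁, A₂, M, N, hd', rfl, rfl, h, hD⟩ := ih h1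
    rw [Finset.disjoint_union_left] at hd
    exact ⟨ρ', A₁ ∪ B₂, A₂, M + L₂, N, Finset.disjoint_union_left.2 ⟨hd', hd.2.symm⟩,
      Finset.union_right_comm _ _ _, add_right_comm _ _ _, h, hD.parL h2 hd.1⟩
  | parR P D ih =>
    obtain ⟨B₂, B₁, L₂, L₁, hd, rfl, rfl, h2, h1⟩ := h
    obtain ⟨ρ', A₁, A₂, M, N, hd', rfl, rfl, h, hD⟩ := ih h1
    rw [Finset.disjoint_union_right] at hd
    refine ⟨ρ', A₁ ∪ B₂, A₂, M + L₂, N, Finset.disjoint_union_left.2 ⟨hd', hd.2⟩,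
      ?_, ?_, h, ?_⟩
    · rw [Finset.union_comm, Finset.union_right_comm]
    · rw [add_comm, add_right_comm]
    · intro R B N' hB hR
      exact ((Congr.par_comm _ _).open_iff _ _ _).1 (hD.parL h2 hd.1.symm R B N' hB hR)
  | nu D ih =>
    obtain ⟨a, A', ha, rfl, h⟩ := h
    obtain ⟨ρ', A₁, A₂, M, N, hd', rfl, rfl, h, hD⟩ := ih h
    simp only [Finset.mem_union, not_or] at ha
    exact ⟨ρ', insert a A₁, A₂, M, N, Finset.disjoint_insert_left.2 ⟨ha.2, hd'⟩,
      (Finset.insert_union _ _ _).symm, rfl, h, hD.nu ha.1⟩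
end CH

namespace CH
variable {S : Signature}
open Proc

namespace Expr

@[simp] theorem unit_rename (ρ : ℕ → ℕ) : (unit : Expr S).rename ρ = unit := by
  simp only [unit, rename]
  congr 1
  funext i
  exact i.elim0

end Expr

/-! ### Reduction of opened processes -/

/-- The bindings introduced by a `letrec` whose variables get the global names `a`. -/
def shares {k : ℕ} (a : Fin k → ℕ) (b : Fin k → Expr S) : Multiset (Comp S) :=
  (List.finRange k).map fun i => Comp.share (a i) ((b i).inst fun j => .var (a j))

/-- The reduction rules on components with global names: `GStep N B N'` replaces the components `N`
by `N'`, introducing the names `B`. -/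
inductive GStep : Multiset (Comp S) → Finset ℕ → Multiset (Comp S) → Prop
  | loc {m e e'} (h : e.act = .loc e') : GStep {.thread m e} ∅ {.thread m e'}
  | look {m e x K} (d) (h : e.act = .look x K) :
      GStep {.thread m e, .share x d} ∅ {.thread m (K d), .share x d}
  | lookTake {m e x K} (d) (h : e.act = .take x K) :
      GStep {.thread m e, .share x d} ∅ {.thread m (K (.takeMVar d)), .share x d}
  | lookPut {m e x v K} (d) (h : e.act = .put x v K) :
      GStep {.thread m e, .share x d} ∅ {.thread m (K (.putMVar d v)), .share x d}
  | letrec {m e k b d K} (a : Fin k → ℕ) (ha : a.Injective) (h : e.act = .letrec k b d K) :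
      GStep {.thread m e} (Finset.univ.image a)
        (.thread m (K (d.inst fun i => .var (a i))) ::ₘ shares a b)
  | new {m e v K} (a : ℕ) (h : e.act = .new v K) :
      GStep {.thread m e} {a} {.thread m (K (.ret (.var a))), .mvar a v}
  | fork {m e d K} (h : e.act = .fork d K) :
      GStep {.thread m e} ∅ {.thread m (K (.ret .unit)), .thread false d}
  | take {m e x K} (v) (h : e.act = .take x K) :
      GStep {.thread m e, .mvar x v} ∅ {.thread m (K (.ret v)), .empty x}
  | put {m e x v K} (h : e.act = .put x v K) :
      GStep {.thread m e, .empty x} ∅ {.thread m (K (.ret .unit)), .mvar x v}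

theorem Proc.Open.nus {k : ℕ} {P : Proc S} {ρ : ℕ → ℕ} {A : Finset ℕ} {L : Multiset (Comp S)}
    {a : Fin k → ℕ} (ha : a.Injective) (hA : ∀ i, a i ∉ A) (h : P.Open (consRens a ρ) A L) :
    (nus k P).Open ρ (Finset.univ.image a ∪ A) L := by
  induction k generalizing P A with
  | zero =>
    have : consRens a ρ = ρ := by funext i; simp [consRens]
    rw [this] at h
    simpa [Proc.nus] using h
  | succ k ih =>
    rw [consRens_succ] at h
    have h1 : (nu P).Open (consRens (fun i => a i.succ) ρ) (insert (a 0) A) L :=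
      ⟨a 0, A, hA 0, rfl, h⟩
    have h2 := ih (ha.comp (Fin.succ_injective k)) (fun i => by
      simp only [Function.comp, Finset.mem_insert, not_or]
      exact ⟨fun h => Fin.succ_ne_zero i (ha h), hA _⟩) h1
    have h3 : Finset.univ.image a ∪ A =
        Finset.univ.image (a ∘ Fin.succ) ∪ insert (a 0) A := by
      rw [Fin.univ_succ, Finset.cons_eq_insert, Finset.image_insert, Finset.map_eq_image,
        Finset.image_image,
        Finset.insert_union, Finset.union_insert]
      rfl
    rw [h3]
    exact h2

theorem Proc.Open.withBindings {k : ℕ} {P : Proc S} {ρ : ℕ → ℕ} {A : Finset ℕ}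
    {L : Multiset (Comp S)} (b : Fin k → Expr S) (h : P.Open ρ A L) :
    (P.withBindings b).Open ρ A
      (L + ((List.finRange k).map fun i : Fin k =>
        Comp.share (ρ i.val) ((b i).rename ρ) : List (Comp S))) := by
  unfold Proc.withBindings
  generalize List.finRange k = l
  induction l generalizing P L with
  | nil => simpa using h
  | cons i l ih =>
    have h1 : (par P (share i.val (b i))).Open ρ A (L + {.share (ρ i) ((b i).rename ρ)}) :=
      ⟨A, ∅, L, _, by simp, by simp, rfl, h, rfl, rfl⟩
    have h2 := ih h1
    rw [List.foldl_cons, List.map_cons, ← Multiset.cons_coe, ← Multiset.singleton_add, ← add_assoc]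
    exact h2

theorem exists_fresh_injective (k : ℕ) {W : Set ℕ} (hW : CoInf W) :
    ∃ a : Fin k → ℕ, a.Injective ∧ ∀ i, a i ∉ W := by
  exact ⟨fun i => hW.natEmbedding _ i, fun i j h =>
    Fin.ext ((hW.natEmbedding _).injective (Subtype.ext h)),
    fun i => (hW.natEmbedding _ i).2⟩

/-- The right-hand side of the rule for `letrec`, opened with the names `a`. -/
theorem open_mkbinds (m : Bool) (M : MCtx S) (F : FCtx S) {k : ℕ} (b : Fin k → Expr S)
    (e : Expr S) (ρ : ℕ → ℕ) {a : Fin k → ℕ} (ha : a.Injective) :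
    (nus k ((thread m ((M.shift k).plug ((F.shift k).plug e))).withBindings b)).Open ρ
      (Finset.univ.image a)
      (.thread m ((M.rename ρ).plug ((F.rename ρ).plug
        ((e.rename (upRen k ρ)).inst fun i => .var (a i)))) ::ₘ
        shares a fun i => (b i).rename (upRen k ρ)) := by
  rw [← Finset.union_empty (Finset.univ.image a)]
  refine Proc.Open.nus ha (by simp) ?_
  have h1 := Proc.Open.withBindings b (P := thread m ((M.shift k).plug ((F.shift k).plug e)))
    (ρ := consRens a ρ) ⟨rfl, rfl⟩
  convert h1 using 1
  rw [Multiset.singleton_add]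
  congr 1
  · simp only [MCtx.plug_rename, FCtx.plug_rename, MCtx.rename_consRens_shift,
      FCtx.rename_consRens_shift, Expr.rename_consRens]
  · unfold shares
    congr 2
    funext i
    rw [Expr.rename_consRens]
    simp [consRens]

/-- The right-hand side of the rule for `newMVar`, opened with the name `a`. -/
theorem open_nmvar (m : Bool) (M : MCtx S) (e : Expr S) (ρ : ℕ → ℕ) (a : ℕ) :
    (nu (par (thread m ((M.shift 1).plug (.ret (.var 0)))) (mvar 0 (e.shift 1)))).Open ρ {a}
      {.thread m ((M.rename ρ).plug (.ret (.var a))), .mvar a (e.rename ρ)} := by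
  refine ⟨a, ∅, by simp, rfl, ∅, ∅, _, _, by simp, by simp, ?_, ⟨rfl, rfl⟩, rfl, rfl⟩
  have h := consRens_one (fun _ => a) ρ
  rw [← h, MCtx.plug_rename, MCtx.rename_consRens_shift, Expr.shift, Expr.rename_rename,
    consRens_comp_add]
  rfl

theorem Expr.IsFunValue.rename {v : Expr S} (h : v.IsFunValue) (ρ : ℕ → ℕ) :
    (v.rename ρ).IsFunValue := by
  cases h
  · exact .lam _
  · exact .con _ _ _

theorem Expr.isFunValue_of_rename {v : Expr S} {ρ : ℕ → ℕ} (h : (v.rename ρ).IsFunValue) :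
    v.IsFunValue := by
  cases v <;> simp only [Expr.rename] at h <;> first | exact .lam _ | exact .con _ _ _ | cases h

theorem Expr.EHead.act_plug_plug {r : Expr S} {a : Act S} (h : EHead r a) (hr : ∀ x, r ≠ Expr.var x)
    (M : MCtx S) (F : FCtx S) : act (M.plug (F.plug r)) = a.map (M.plug ∘ F.plug) := by
  rw [(Head.force F r a h fun x hx => (hr x hx).elim).act_plug M, Act.map_map]

open CH.Expr in
/-- A reduction rule of the calculus, seen on the components of the redex, where the introduced
names are chosen outside `W`. -/
theorem Rule.gStep {P Q : Proc S} (h : Rule P Q) {ρ : ℕ → ℕ} {A : Finset ℕ}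
    {N : Multiset (Comp S)} (hP : P.Open ρ A N) {W : Set ℕ} (hW : CoInf W) :
    A = ∅ ∧ ∃ B N', GStep N B N' ∧ Q.Open ρ B N' ∧ ∀ b ∈ B, b ∉ W := by
  cases h with
  | cpce m M F x e =>
    obtain ⟨A₁, A₂, L₁, L₂, -, rfl, rfl, ⟨rfl, rfl⟩, rfl, rfl⟩ := hP
    refine ⟨by simp, ∅, {.thread m ((M.plug (F.plug e)).rename ρ), .share (ρ x) (e.rename ρ)},
      ?_, ⟨∅, ∅, _, _, by simp, by simp, rfl, ⟨rfl, rfl⟩, rfl, rfl⟩, by simp⟩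
    simp only [MCtx.plug_rename, FCtx.plug_rename, Expr.rename]
    by_cases h1 : F = .takeMVar .hole
    · subst h1
      exact .lookTake _ ((Head.take _).act_plug _)
    by_cases h2 : ∃ v, F = .putMVar .hole v
    · obtain ⟨v, rfl⟩ := h2
      exact .lookPut _ ((Head.put _ _).act_plug _)
    refine .look _
      ((Head.force _ _ _ (.var _) fun y _ => ⟨fun h => h1 ?_, fun v h => ?_⟩).act_plug _)
    · rcases F with _ | E | E <;> simp only [FCtx.rename, reduceCtorEq, FCtx.takeMVar.injEq] at h
      cases E <;> simp only [ECtx.rename, reduceCtorEq] at h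
      rfl
    · rcases F with _ | _ | ⟨E, d⟩ <;>
        simp only [FCtx.rename, reduceCtorEq, FCtx.putMVar.injEq] at h
      cases E <;> simp only [ECtx.rename, reduceCtorEq, false_and] at h
      exact h2 ⟨_, rfl⟩
  | mkbinds m M F k b e =>
    obtain ⟨rfl, rfl⟩ := hP
    obtain ⟨a, ha, haW⟩ := exists_fresh_injective k hW
    refine ⟨rfl, Finset.univ.image a, _, .letrec (K := (M.rename ρ).plug ∘ (F.rename ρ).plug)
      (b := fun i => (b i).rename (upRen k ρ)) (d := e.rename (upRen k ρ)) a ha ?_, ?_,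
      by simpa using haW⟩
    · rw [MCtx.plug_rename, FCtx.plug_rename, Expr.rename]
      exact (EHead.letrec k _ _).act_plug_plug (by simp) _ _
    · exact open_mkbinds m M F b e ρ ha
  | beta m M F e₁ e₂ =>
    obtain ⟨rfl, rfl⟩ := hP
    refine ⟨rfl, ∅, _, .loc ?_, ⟨rfl, rfl⟩, by simp⟩
    simp only [MCtx.plug_rename, FCtx.plug_rename, Expr.rename, inst_rename]
    refine ((EHead.beta _ _).act_plug_plug (by simp) _ _).trans ?_
    simp only [Act.map, Function.comp]
    congr 4
    funext i
    fin_cases i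
    rfl
  | case m M F T c args alts =>
    obtain ⟨rfl, rfl⟩ := hP
    refine ⟨rfl, ∅, _, .loc ?_, ⟨rfl, rfl⟩, by simp⟩
    simp only [MCtx.plug_rename, FCtx.plug_rename, Expr.rename, inst_rename]
    exact (EHead.case T _ _ _).act_plug_plug (by simp) _ _
  | seq m M F v e hv =>
    obtain ⟨rfl, rfl⟩ := hP
    refine ⟨rfl, ∅, _, .loc ?_, ⟨rfl, rfl⟩, by simp⟩
    simp only [MCtx.plug_rename, FCtx.plug_rename, Expr.rename]
    exact (EHead.seq _ _ (hv.rename ρ)).act_plug_plug (by simp) _ _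
  | lunit m M e₁ e₂ =>
    obtain ⟨rfl, rfl⟩ := hP
    refine ⟨rfl, ∅, _, .loc ?_, ⟨rfl, rfl⟩, by simp⟩
    simp only [MCtx.plug_rename, Expr.rename]
    exact (Head.lunit _ _).act_plug _
  | tmvar m M x e =>
    obtain ⟨A₁, A₂, L₁, L₂, -, rfl, rfl, ⟨rfl, rfl⟩, rfl, rfl⟩ := hP
    refine ⟨by simp, ∅, {.thread m ((M.plug (.ret e)).rename ρ), .empty (ρ x)},
      ?_, ⟨∅, ∅, _, _, by simp, by simp, rfl, ⟨rfl, rfl⟩, rfl, rfl⟩, by simp⟩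
    simp only [MCtx.plug_rename, Expr.rename]
    exact .take _ ((Head.take _).act_plug _)
  | pmvar m M x e =>
    obtain ⟨A₁, A₂, L₁, L₂, -, rfl, rfl, ⟨rfl, rfl⟩, rfl, rfl⟩ := hP
    refine ⟨by simp, ∅, {.thread m ((M.plug (.ret .unit)).rename ρ), .mvar (ρ x) (e.rename ρ)},
      ?_, ⟨∅, ∅, _, _, by simp, by simp, rfl, ⟨rfl, rfl⟩, rfl, rfl⟩, by simp⟩
    simp only [MCtx.plug_rename, Expr.rename, unit_rename]
    exact .put ((Head.put _ _).act_plug _)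
  | nmvar m M e =>
    obtain ⟨rfl, rfl⟩ := hP
    obtain ⟨a, ha⟩ := hW.exists_notMem
    refine ⟨rfl, {a}, _, .new a ?_, open_nmvar m M e ρ a, by simpa using ha⟩
    rw [MCtx.plug_rename]
    exact (Head.new _).act_plug _
  | fork m M e =>
    obtain ⟨rfl, rfl⟩ := hP
    refine ⟨rfl, ∅, {.thread m ((M.plug (.ret .unit)).rename ρ), .thread false (e.rename ρ)},
      ?_, ⟨∅, ∅, _, _, by simp, by simp, rfl, ⟨rfl, rfl⟩, rfl, rfl⟩, by simp⟩
    simp only [MCtx.plug_rename, Expr.rename, unit_rename]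
    exact .fork ((Head.fork _).act_plug _)

/-- A reduction step of a process, seen on its components. -/
theorem Step.gStep {P Q : Proc S} (h : Step P Q) {ρ : ℕ → ℕ} {A : Finset ℕ}
    {L : Multiset (Comp S)} (hP : P.Open ρ A L) {W : Set ℕ} (hW : CoInf W) :
    ∃ M N B N', L = M + N ∧ GStep N B N' ∧ Q.Open ρ (A ∪ B) (M + N') ∧ (∀ b ∈ B, b ∉ A) ∧
      ∀ b ∈ B, b ∉ W := by
  obtain ⟨-, -, D, P', Q', h1, h2, h3⟩ := h
  obtain ⟨ρ', A₁, A₂, M, N, hd, rfl, rfl, hP', hD⟩ := PCtx.open_plug ((h1.open_iff _ _ _).1 hP)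
  obtain ⟨rfl, B, N', hG, hQ, hB⟩ := h3.gStep hP' (hW.union A₁.finite_toSet)
  refine ⟨M, N, B, N', rfl, hG, ?_, ?_, fun b hb h => hB b hb (.inl h)⟩
  · rw [Finset.union_empty]
    exact (h2.open_iff _ _ _).2
      (hD _ _ _ (Finset.disjoint_right.2 fun b hb h => hB b hb (.inr h)) hQ)
  · rw [Finset.union_empty]
    exact fun b hb h => hB b hb (.inr h)

section
open CH.Expr
variable {ρ : ℕ → ℕ}

theorem Expr.rename_eq_var {e : Expr S} {x : ℕ} (h : e.rename ρ = var x) :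
    ∃ y, e = var y ∧ ρ y = x := by
  cases e <;> simp only [Expr.rename, reduceCtorEq, var.injEq] at h
  exact ⟨_, rfl, h⟩

/-- The local steps of a thread are instances of reduction rules. Here and below, the thread `e` of
a process is compared with its opening `e.rename ρ`, whose action is known. -/
theorem rule_of_loc {e e' : Expr S} (h : act (e.rename ρ) = .loc e') :
    ∃ d, d.rename ρ = e' ∧ ∀ m, Rule (thread m e) (thread m d) := by
  obtain ⟨M, r, _, he, hr, ha⟩ := exists_head (e := e.rename ρ) (by simp [h])
  obtain ⟨M, r, rfl, rfl, rfl⟩ := MCtx.rename_eq_plug he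
  rw [h] at ha
  generalize hs : r.rename ρ = s at hr
  cases hr with
  | force F r' a' h' =>
    obtain ⟨F, r, rfl, rfl, rfl⟩ := FCtx.rename_eq_plug hs
    generalize hs' : r.rename ρ = s at h'
    cases h' with
    | var | letrec => simp [Act.map] at ha
    | beta e₁ e₂ =>
      rcases r with _ | _ | ⟨e, d⟩ | _ | _ | _ | _ | _ | _ | _ | _ | _ | _ <;>
        simp only [Expr.rename, reduceCtorEq, app.injEq] at hs'
      rcases e with _ | e | _ | _ | _ | _ | _ | _ | _ | _ | _ | _ | _ <;>
        simp only [Expr.rename, reduceCtorEq, lam.injEq, false_and] at hs'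
      obtain ⟨rfl, rfl⟩ := hs'
      simp only [Act.map, Act.loc.injEq] at ha
      refine ⟨_, ?_, fun m => .beta m M F e d⟩
      rw [ha, MCtx.plug_rename, FCtx.plug_rename, inst_rename]
      congr 3
      funext i
      fin_cases i
      rfl
    | case T c args alts =>
      rcases r with _ | _ | _ | _ | _ | _ | ⟨T', e, alts'⟩ | _ | _ | _ | _ | _ | _ <;>
        simp only [Expr.rename, reduceCtorEq, case.injEq] at hs'
      obtain ⟨rfl, hs1, hs2⟩ := hs'
      rcases e with _ | _ | _ | ⟨T, c', args'⟩ | _ | _ | _ | _ | _ | _ | _ | _ | _ <;>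
        simp only [Expr.rename, reduceCtorEq, con.injEq] at hs1
      obtain ⟨rfl, h3, h4⟩ := hs1
      obtain rfl := eq_of_heq h3
      obtain rfl := eq_of_heq h4
      obtain rfl := eq_of_heq hs2
      simp only [Act.map, Act.loc.injEq] at ha
      refine ⟨_, ?_, fun m => .case m M F _ _ _ _⟩
      rw [ha, MCtx.plug_rename, FCtx.plug_rename, inst_rename]
    | seq v e hv =>
      rcases r with _ | _ | _ | _ | _ | ⟨v', e'⟩ | _ | _ | _ | _ | _ | _ | _ <;>
        simp only [Expr.rename, reduceCtorEq, seq.injEq] at hs'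
      obtain ⟨rfl, rfl⟩ := hs'
      simp only [Act.map, Act.loc.injEq] at ha
      refine ⟨_, ?_, fun m => .seq m M F _ _ (isFunValue_of_rename hv)⟩
      rw [ha, MCtx.plug_rename, FCtx.plug_rename]
  | lunit e₁ e₂ =>
    rcases r with _ | _ | _ | _ | _ | _ | _ | _ | ⟨e, d⟩ | _ | _ | _ | _ <;>
      simp only [Expr.rename, reduceCtorEq, bind.injEq] at hs
    rcases e with _ | _ | _ | _ | _ | _ | _ | e | _ | _ | _ | _ | _ <;>
      simp only [Expr.rename, reduceCtorEq, ret.injEq, false_and] at hs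
    obtain ⟨rfl, rfl⟩ := hs
    simp only [Act.map, Act.loc.injEq] at ha
    refine ⟨_, ?_, fun m => .lunit m M _ _⟩
    rw [ha, MCtx.plug_rename, Expr.rename]
  | _ => simp [Act.map] at ha

/-- A thread whose action is a lookup has a variable as its redex. -/
theorem eq_plug_of_look {e : Expr S} {x : ℕ} {K : Expr S → Expr S}
    (h : act (e.rename ρ) = .look x K) :
    ∃ (M : MCtx S) (F : FCtx S) (y : ℕ), e = M.plug (F.plug (var y)) ∧ ρ y = x ∧
      ∀ d : Expr S, K (d.rename ρ) = (M.plug (F.plug d)).rename ρ := by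
  obtain ⟨M, r, _, he, hr, ha⟩ := exists_head (e := e.rename ρ) (by simp [h])
  obtain ⟨M, r, rfl, rfl, rfl⟩ := MCtx.rename_eq_plug he
  rw [h] at ha
  generalize hs : r.rename ρ = s at hr
  cases hr with
  | force F r' a' h' =>
    obtain ⟨F, r, rfl, rfl, rfl⟩ := FCtx.rename_eq_plug hs
    generalize hs' : r.rename ρ = s at h'
    cases h' with
    | var =>
      obtain ⟨y, rfl, rfl⟩ := rename_eq_var hs'
      simp only [Act.map, Act.look.injEq] at ha
      obtain ⟨rfl, rfl⟩ := ha
      exact ⟨M, F, y, rfl, rfl, fun d => by simp [MCtx.plug_rename, FCtx.plug_rename]⟩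
    | _ => simp [Act.map] at ha
  | _ => simp [Act.map] at ha

theorem rule_of_letrec {e e' : Expr S} {k : ℕ} {b : Fin k → Expr S} {K : Expr S → Expr S}
    (h : act (e.rename ρ) = .letrec k b e' K) (m : Bool) {a : Fin k → ℕ} (hi : a.Injective) :
    ∃ Q, Rule (thread m e) Q ∧ Q.Open ρ (Finset.univ.image a)
      (.thread m (K (e'.inst fun i => .var (a i))) ::ₘ shares a b) := by
  obtain ⟨M, r, _, he, hr, ha⟩ := exists_head (e := e.rename ρ) (by simp [h])
  obtain ⟨M, r, rfl, rfl, rfl⟩ := MCtx.rename_eq_plug he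
  rw [h] at ha
  generalize hs : r.rename ρ = s at hr
  cases hr with
  | force F r' a' h' =>
    obtain ⟨F, r, rfl, rfl, rfl⟩ := FCtx.rename_eq_plug hs
    generalize hs' : r.rename ρ = s at h'
    cases h' with
    | letrec k' b' d =>
      rcases r with _ | _ | _ | _ | ⟨k, b, e⟩ | _ | _ | _ | _ | _ | _ | _ | _ <;>
        simp only [Expr.rename, reduceCtorEq, letrec.injEq] at hs'
      obtain ⟨rfl, h3, h4⟩ := hs'
      obtain rfl := eq_of_heq h3
      simp only [Act.map, Act.letrec.injEq] at ha
      obtain ⟨rfl, h5, h6, h7⟩ := ha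
      obtain rfl := eq_of_heq h5
      subst h4 h6 h7
      exact ⟨_, .mkbinds m M F _ b e, open_mkbinds m M F b e ρ hi⟩
    | _ => simp [Act.map] at ha
  | _ => simp [Act.map] at ha

theorem rule_of_new {e v : Expr S} {K : Expr S → Expr S} (h : act (e.rename ρ) = .new v K)
    (m : Bool) (a : ℕ) : ∃ Q, Rule (thread m e) Q ∧
      Q.Open ρ {a} {.thread m (K (.ret (.var a))), .mvar a v} := by
  obtain ⟨M, r, _, he, hr, ha⟩ := exists_head (e := e.rename ρ) (by simp [h])
  obtain ⟨M, r, rfl, rfl, rfl⟩ := MCtx.rename_eq_plug he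
  rw [h] at ha
  generalize hs : r.rename ρ = s at hr
  cases hr with
  | force F r' a' h' => cases h' <;> simp [Act.map] at ha
  | new v' =>
    cases r <;> simp only [Expr.rename, reduceCtorEq, newMVar.injEq] at hs
    simp only [Act.map, Act.new.injEq] at ha
    obtain ⟨rfl, rfl⟩ := ha
    subst hs
    exact ⟨_, .nmvar m M _, open_nmvar m M _ ρ a⟩
  | _ => simp [Act.map] at ha

theorem eq_plug_of_fork {e d : Expr S} {K : Expr S → Expr S}
    (h : act (e.rename ρ) = .fork d K) : ∃ (M : MCtx S) (d' : Expr S),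
      e = M.plug (fork d') ∧ d = d'.rename ρ ∧
      ∀ d : Expr S, K (d.rename ρ) = (M.plug d).rename ρ := by
  obtain ⟨M, r, _, he, hr, ha⟩ := exists_head (e := e.rename ρ) (by simp [h])
  obtain ⟨M, r, rfl, rfl, rfl⟩ := MCtx.rename_eq_plug he
  rw [h] at ha
  generalize hs : r.rename ρ = s at hr
  cases hr with
  | force F r' a' h' => cases h' <;> simp [Act.map] at ha
  | fork d' =>
    cases r <;> simp only [Expr.rename, reduceCtorEq, fork.injEq] at hs
    simp only [Act.map, Act.fork.injEq] at ha
    obtain ⟨rfl, rfl⟩ := ha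
    subst hs
    exact ⟨M, _, rfl, rfl, fun d => by simp [MCtx.plug_rename]⟩
  | _ => simp [Act.map] at ha

theorem eq_plug_of_take {e : Expr S} {x : ℕ} {K : Expr S → Expr S}
    (h : act (e.rename ρ) = .take x K) : ∃ (M : MCtx S) (y : ℕ),
      e = M.plug (takeMVar (var y)) ∧ ρ y = x ∧
      ∀ d : Expr S, K (d.rename ρ) = (M.plug d).rename ρ := by
  obtain ⟨M, r, _, he, hr, ha⟩ := exists_head (e := e.rename ρ) (by simp [h])
  obtain ⟨M, r, rfl, rfl, rfl⟩ := MCtx.rename_eq_plug he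
  rw [h] at ha
  generalize hs : r.rename ρ = s at hr
  cases hr with
  | force F r' a' h' => cases h' <;> simp [Act.map] at ha
  | take x' =>
    cases r <;> simp only [Expr.rename, reduceCtorEq, takeMVar.injEq] at hs
    obtain ⟨y, rfl, rfl⟩ := rename_eq_var hs
    simp only [Act.map, Act.take.injEq] at ha
    obtain ⟨rfl, rfl⟩ := ha
    exact ⟨M, _, rfl, rfl, fun d => by simp [MCtx.plug_rename]⟩
  | _ => simp [Act.map] at ha

theorem eq_plug_of_put {e v : Expr S} {x : ℕ} {K : Expr S → Expr S}
    (h : act (e.rename ρ) = .put x v K) : ∃ (M : MCtx S) (y : ℕ) (w : Expr S),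
      e = M.plug (putMVar (var y) w) ∧ ρ y = x ∧ v = w.rename ρ ∧
      ∀ d : Expr S, K (d.rename ρ) = (M.plug d).rename ρ := by
  obtain ⟨M, r, _, he, hr, ha⟩ := exists_head (e := e.rename ρ) (by simp [h])
  obtain ⟨M, r, rfl, rfl, rfl⟩ := MCtx.rename_eq_plug he
  rw [h] at ha
  generalize hs : r.rename ρ = s at hr
  cases hr with
  | force F r' a' h' => cases h' <;> simp [Act.map] at ha
  | put x' v' =>
    rcases r with _ | _ | _ | _ | _ | _ | _ | _ | _ | _ | _ | _ | ⟨e, w⟩ <;>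
      simp only [Expr.rename, reduceCtorEq, putMVar.injEq] at hs
    obtain ⟨y, rfl, rfl⟩ := rename_eq_var hs.1
    simp only [Act.map, Act.put.injEq] at ha
    obtain ⟨rfl, rfl, rfl⟩ := ha
    exact ⟨M, _, _, rfl, rfl, hs.2.symm, fun d => by simp [MCtx.plug_rename]⟩
  | _ => simp [Act.map] at ha

end

theorem Comp.rename_eq_thread {c : Comp S} {ρ : ℕ → ℕ} {m : Bool} {e : Expr S}
    (h : c.rename ρ = .thread m e) : ∃ d, c = .thread m d ∧ e = d.rename ρ := by
  cases c <;> simp only [rename, reduceCtorEq, thread.injEq] at h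
  exact ⟨_, by rw [h.1], h.2.symm⟩

theorem Comp.rename_eq_share {c : Comp S} {ρ : ℕ → ℕ} {x : ℕ} {e : Expr S}
    (h : c.rename ρ = .share x e) : ∃ y d, c = .share y d ∧ ρ y = x ∧ e = d.rename ρ := by
  cases c <;> simp only [rename, reduceCtorEq, share.injEq] at h
  exact ⟨_, _, rfl, h.1, h.2.symm⟩

theorem Comp.rename_eq_mvar {c : Comp S} {ρ : ℕ → ℕ} {x : ℕ} {e : Expr S}
    (h : c.rename ρ = .mvar x e) : ∃ y d, c = .mvar y d ∧ ρ y = x ∧ e = d.rename ρ := by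
  cases c <;> simp only [rename, reduceCtorEq, mvar.injEq] at h
  exact ⟨_, _, rfl, h.1, h.2.symm⟩

theorem Comp.rename_eq_empty {c : Comp S} {ρ : ℕ → ℕ} {x : ℕ}
    (h : c.rename ρ = .empty x) : ∃ y, c = .empty y ∧ ρ y = x := by
  cases c <;> simp only [rename, reduceCtorEq, empty.injEq] at h
  exact ⟨_, rfl, h⟩

/-- Reduction of a single component, which is found in the process by `Proc.Open.extract`. -/
theorem Proc.Open.step_of_rule₁ {P : Proc S} {ρ : ℕ → ℕ} {A B : Finset ℕ} {c : Comp S}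
    {M N' : Multiset (Comp S)} (hP : P.Open ρ A (c ::ₘ M)) (hρ : EnvOK ρ A)
    (hwf : P.WellFormed) (hs : ¬ Successful P) (hB : Disjoint A B)
    (h : ∀ (d : Comp S) (ρ' : ℕ → ℕ), d.rename ρ' = c →
      ∃ Q, Rule d.toProc Q ∧ Q.Open ρ' B N') :
    ∃ Q, Step P Q ∧ Q.Open ρ (A ∪ B) (M + N') := by
  obtain ⟨D, d, ρ', hc, hd, hi, hD⟩ := hP.extract hρ
  obtain ⟨Q, hr, hQ⟩ := h d ρ' hd
  exact ⟨D.plug Q, ⟨hwf, hs, D, _, Q, hc ▸ .refl _, .refl _, hr⟩, hD _ _ _ hB hQ⟩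

/-- Reduction of two components, which are brought together by `Proc.Open.extract₂`. -/
theorem Proc.Open.step_of_rule₂ {P : Proc S} {ρ : ℕ → ℕ} {A : Finset ℕ} {c₁ c₂ c₁' c₂' : Comp S}
    {M : Multiset (Comp S)} (hP : P.Open ρ A ({c₁, c₂} + M)) (hρ : EnvOK ρ A)
    (hwf : P.WellFormed) (hs : ¬ Successful P)
    (h : ∀ (d₁ d₂ : Comp S) (ρ' : ℕ → ℕ), ρ'.Injective → d₁.rename ρ' = c₁ → d₂.rename ρ' = c₂ →
      ∃ d₁' d₂' : Comp S, Rule (par d₁.toProc d₂.toProc) (par d₁'.toProc d₂'.toProc) ∧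
        d₁'.rename ρ' = c₁' ∧ d₂'.rename ρ' = c₂') :
    ∃ Q, Step P Q ∧ Q.Open ρ A (M + {c₁', c₂'}) := by
  rw [Multiset.insert_eq_cons, Multiset.cons_add, Multiset.singleton_add] at hP
  obtain ⟨D, d₁, d₂, ρ', hc, h1, h2, hi, hD⟩ := hP.extract₂ hρ
  obtain ⟨d₁', d₂', hr, rfl, rfl⟩ := h d₁ d₂ ρ' hi h1 h2
  refine ⟨D.plug _, ⟨hwf, hs, D, _, _, hc, .refl _, hr⟩, ?_⟩
  rw [← Finset.union_empty A]
  exact hD _ _ _ (by simp) ⟨∅, ∅, _, _, by simp, by simp, rfl, open_toProc _ _, open_toProc _ _⟩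

open CH.Expr in
/-- Every reduction of the components comes from a reduction of the process. -/
theorem GStep.step {N N' : Multiset (Comp S)} {B : Finset ℕ} (h : GStep N B N') {P : Proc S}
    {ρ : ℕ → ℕ} {A : Finset ℕ} {M : Multiset (Comp S)} (hP : P.Open ρ A (M + N)) (hρ : EnvOK ρ A)
    (hB : Disjoint A B) (hwf : P.WellFormed) (hs : ¬ Successful P) :
    ∃ Q, Step P Q ∧ Q.Open ρ (A ∪ B) (M + N') := by
  rw [add_comm M N] at hP
  cases h with
  | loc h =>
    refine hP.step_of_rule₁ hρ hwf hs hB fun d ρ' hd => ?_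
    obtain ⟨d, rfl, rfl⟩ := Comp.rename_eq_thread hd
    obtain ⟨e, rfl, hr⟩ := rule_of_loc h
    exact ⟨_, hr _, rfl, rfl⟩
  | letrec a ha h =>
    refine hP.step_of_rule₁ hρ hwf hs hB fun d ρ' hd => ?_
    obtain ⟨d, rfl, rfl⟩ := Comp.rename_eq_thread hd
    exact rule_of_letrec h _ ha
  | new a h =>
    refine hP.step_of_rule₁ hρ hwf hs hB fun d ρ' hd => ?_
    obtain ⟨d, rfl, rfl⟩ := Comp.rename_eq_thread hd
    exact rule_of_new h _ a
  | fork h =>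
    refine hP.step_of_rule₁ hρ hwf hs hB fun d ρ' hd => ?_
    obtain ⟨d, rfl, rfl⟩ := Comp.rename_eq_thread hd
    obtain ⟨M, d', rfl, rfl, hK⟩ := eq_plug_of_fork h
    refine ⟨_, .fork _ M d', ∅, ∅, _, _, by simp, by simp, ?_, ⟨rfl, rfl⟩, rfl, rfl⟩
    rw [← hK]
    simp only [Expr.rename, unit_rename]
    rfl
  | look d h =>
    rw [Finset.union_empty]
    refine hP.step_of_rule₂ hρ hwf hs fun d₁ d₂ ρ' hi h1 h2 => ?_
    obtain ⟨e, rfl, rfl⟩ := Comp.rename_eq_thread h1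
    obtain ⟨y, d', rfl, rfl, rfl⟩ := Comp.rename_eq_share h2
    obtain ⟨M, F, z, rfl, hz, hK⟩ := eq_plug_of_look h
    obtain rfl := hi hz
    exact ⟨.thread _ _, .share _ _, .cpce _ M F _ d', by rw [hK, Comp.rename], rfl⟩
  | lookTake d h =>
    rw [Finset.union_empty]
    refine hP.step_of_rule₂ hρ hwf hs fun d₁ d₂ ρ' hi h1 h2 => ?_
    obtain ⟨e, rfl, rfl⟩ := Comp.rename_eq_thread h1
    obtain ⟨y, d', rfl, rfl, rfl⟩ := Comp.rename_eq_share h2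
    obtain ⟨M, z, rfl, hz, hK⟩ := eq_plug_of_take h
    obtain rfl := hi hz
    have := hK (takeMVar d')
    exact ⟨.thread _ _, .share _ _, .cpce _ M (.takeMVar .hole) _ d',
      by rw [Expr.rename] at this; rw [this]; rfl, rfl⟩
  | lookPut d h =>
    rw [Finset.union_empty]
    refine hP.step_of_rule₂ hρ hwf hs fun d₁ d₂ ρ' hi h1 h2 => ?_
    obtain ⟨e, rfl, rfl⟩ := Comp.rename_eq_thread h1
    obtain ⟨y, d', rfl, rfl, rfl⟩ := Comp.rename_eq_share h2
    obtain ⟨M, z, w, rfl, hz, rfl, hK⟩ := eq_plug_of_put h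
    obtain rfl := hi hz
    have := hK (putMVar d' w)
    exact ⟨.thread _ _, .share _ _, .cpce _ M (.putMVar .hole w) _ d',
      by rw [Expr.rename] at this; rw [this]; rfl, rfl⟩
  | take v h =>
    rw [Finset.union_empty]
    refine hP.step_of_rule₂ hρ hwf hs fun d₁ d₂ ρ' hi h1 h2 => ?_
    obtain ⟨e, rfl, rfl⟩ := Comp.rename_eq_thread h1
    obtain ⟨y, d', rfl, rfl, rfl⟩ := Comp.rename_eq_mvar h2
    obtain ⟨M, z, rfl, hz, hK⟩ := eq_plug_of_take h
    obtain rfl := hi hz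
    have := hK (ret d')
    exact ⟨.thread _ _, .empty _, .tmvar _ M _ d',
      by rw [Expr.rename] at this; rw [this]; rfl, rfl⟩
  | put h =>
    rw [Finset.union_empty]
    refine hP.step_of_rule₂ hρ hwf hs fun d₁ d₂ ρ' hi h1 h2 => ?_
    obtain ⟨e, rfl, rfl⟩ := Comp.rename_eq_thread h1
    obtain ⟨y, rfl, rfl⟩ := Comp.rename_eq_empty h2
    obtain ⟨M, z, w, rfl, hz, rfl, hK⟩ := eq_plug_of_put h
    obtain rfl := hi hz
    have := hK (ret unit)
    exact ⟨.thread _ _, .mvar _ _, .pmvar _ M _ w,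
      by rw [Expr.rename, unit_rename] at this; rw [this]; rfl, rfl⟩

end CH

namespace CH.Expr
variable {S : Signature}

theorem subst_shift (e : Expr S) (k : ℕ) (σ : ℕ → Expr S) :
    (e.shift k).subst (upSubst k σ) = (e.subst σ).shift k := by
  rw [shift, subst_rename, shift, rename_subst]
  congr 1
  funext i
  simp [upSubst, shift]

@[simp] theorem unit_subst (σ : ℕ → Expr S) : (unit : Expr S).subst σ = unit := by
  simp only [unit, subst]
  congr 1
  funext i
  exact i.elim0

@[simp] theorem pair_subst (e₁ e₂ : Expr S) (σ : ℕ → Expr S) :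
    (pair e₁ e₂).subst σ = pair (e₁.subst σ) (e₂.subst σ) := by
  refine congrArg (con .pair (0 : Fin 1)) ?_
  show (fun i : Fin 2 => (![e₁, e₂] i).subst σ) = ![e₁.subst σ, e₂.subst σ]
  funext i
  fin_cases i <;> rfl

@[simp] theorem chan_subst (e : Expr S) (σ : ℕ → Expr S) :
    (chan e).subst σ = chan (e.subst σ) := by
  refine congrArg (con .channel (0 : Fin 1)) ?_
  show (fun i : Fin 1 => (![e] i).subst σ) = ![e.subst σ]
  funext i
  fin_cases i
  rfl

@[simp] theorem unchan_subst (e : Expr S) (σ : ℕ → Expr S) :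
    (unchan e).subst σ = unchan (e.subst σ) := rfl

@[simp] theorem bot_subst (σ : ℕ → Expr S) : (bot : Expr S).subst σ = bot := rfl

@[simp] theorem andThen_subst (e₁ e₂ : Expr S) (σ : ℕ → Expr S) :
    (andThen e₁ e₂).subst σ = andThen (e₁.subst σ) (e₂.subst σ) := by
  simp only [andThen, subst, subst_shift]

theorem upSubst_add {σ : ℕ → Expr S} {i j : ℕ} (h : σ i = var j) (k : ℕ) :
    upSubst k σ (i + k) = var (j + k) := by
  simp [upSubst, h, shift, rename]

theorem upSubst_of_lt (σ : ℕ → Expr S) {i k : ℕ} (h : i < k) : upSubst k σ i = var i := by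
  simp [upSubst, h]

end CH.Expr

namespace Translation
open CH CH.Expr
variable {S : Signature}

/-! ### The translation under renaming and substitution -/

/-- A substitution that maps the variables in use to variables only changes the names. -/
theorem tauAux_subst (P : PiStop.Proc) {ρ ρ' : ℕ → ℕ} {s s' : ℕ} {σ : ℕ → Expr S}
    (h : ∀ i, σ (ρ i) = var (ρ' i)) (hs : σ s = var s') :
    (tauAux S ρ s P).subst σ = tauAux S ρ' s' P := by
  induction P generalizing ρ ρ' s s' σ with
  | nu P ih =>
    simp only [tauAux, subst, andThen_subst, bot_subst, chan_subst]
    rw [upSubst_of_lt _ zero_lt_one]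
    rw [ih (ρ' := consRen 0 fun i => ρ' i + 2) (s' := s' + 2)]
    · simp [upSubst, shift, Expr.rename]
    · rintro (_ | i)
      · simp [upSubst]
      · simp [upSubst, shift, Expr.rename, h]
    · simp [upSubst, shift, Expr.rename, hs]
  | out x y P ih =>
    simp only [tauAux, subst, andThen_subst, unit_subst, pair_subst, unchan_subst]
    rw [upSubst_of_lt _ zero_lt_one, upSubst_add (h x), upSubst_add (h y),
      ih (fun i => upSubst_add (h i) 1) (upSubst_add hs 1)]
  | inp x P ih =>
    simp only [tauAux, subst, andThen_subst, unchan_subst, h]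
    congr 2
    refine congrArg₂ (case .pair) (upSubst_of_lt _ zero_lt_one) (funext fun _ => ?_)
    rw [ih (ρ' := consRen 0 fun i => ρ' i + 3) (s' := s' + 3)]
    · simp [upSubst, DataType.arity]
    · rintro (_ | i)
      · simp [upSubst, DataType.arity]
      · simp [upSubst, shift, Expr.rename, h, DataType.arity]
    · simp [upSubst, shift, Expr.rename, hs, DataType.arity]
  | par P Q ih1 ih2 => simp only [tauAux, andThen_subst, subst, ih1 h hs, ih2 h hs]
  | bang P ih =>
    simp only [tauAux, subst, andThen_subst]
    rw [upSubst_of_lt _ zero_lt_one,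
      ih (fun i => upSubst_add (h i) 1) (upSubst_add hs 1)]
  | zero => simp [tauAux, subst]
  | Stop => simp [tauAux, subst, hs]

theorem tauAux_rename (P : PiStop.Proc) (ρ : ℕ → ℕ) (s : ℕ) (f : ℕ → ℕ) :
    (tauAux S ρ s P).rename f = tauAux S (f ∘ ρ) (f s) P := by
  rw [← subst_comp_var]
  exact tauAux_subst P (fun _ => rfl) rfl

theorem tauAux_proc_rename (P : PiStop.Proc) (ρ : ℕ → ℕ) (s : ℕ) (f : ℕ → ℕ) :
    tauAux S ρ s (P.rename f) = tauAux S (ρ ∘ f) s P := by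
  induction P generalizing ρ s f with
  | nu P ih =>
    simp only [PiStop.Proc.rename, tauAux, ih, consRen_comp_upRen]
    rfl
  | inp x P ih =>
    simp only [PiStop.Proc.rename, tauAux, ih, consRen_comp_upRen]
    rfl
  | _ => simp_all [PiStop.Proc.rename, tauAux, Function.comp_def]

/-! ### Threads of translated processes -/

/-- The translation of a process whose free names are variables, with the MVar `s` for `stop`. -/
def tRun (S : Signature) (s : ℕ) (P : PiStop.Proc) : Expr S := tauAux S id s P

/-- The thread that releases the MVar `c` and then continues as `P`. -/
def tAck (S : Signature) (s c : ℕ) (P : PiStop.Proc) : Expr S :=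
  andThen (putMVar (var c) unit) (tRun S s P)

/-- The continuation of a receiver, applied to the received pair. -/
def tRecv (S : Signature) (s : ℕ) (P : PiStop.Proc) : Expr S :=
  lam (case .pair (var 0) fun _ =>
    andThen (takeMVar (var 1)) (tauAux S (consRen 0 fun i => i + 3) (s + 3) P))

/-- The thread that binds a new channel with the MVar `m` and then continues as `P`. -/
def tBind (S : Signature) (s m : ℕ) (P : PiStop.Proc) : Expr S :=
  letrec 1 (fun _ => chan (var (m + 1))) (tauAux S (consRen 0 fun i => i + 1) (s + 1) P)

/-- `e` becomes `e'` by local steps: those that need no other component. -/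
def LocStar (e e' : Expr S) : Prop := Relation.ReflTransGen (fun a b => act a = .loc b) e e'

theorem LocStar.refl (e : Expr S) : LocStar e e := Relation.ReflTransGen.refl

theorem LocStar.head {e e' e'' : Expr S} (h : act e = .loc e') (h' : LocStar e' e'') :
    LocStar e e'' := Relation.ReflTransGen.head h h'

theorem LocStar.bind_ret (v b : Expr S) : LocStar (bind (ret v) (lam b)) (b.inst ![v]) :=
  .head rfl (.head rfl (.refl _))

theorem LocStar.bind_ret_of_eq {v b e : Expr S} (h : b.inst ![v] = e) :
    LocStar (bind (ret v) (lam b)) e := h ▸ .bind_ret v b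

theorem LocStar.andThen_ret (v e : Expr S) : LocStar (andThen (ret v) e) e := by
  have := LocStar.bind_ret v (e.shift 1)
  rwa [inst_shift] at this

theorem inst_one (b : Expr S) (v : Expr S) :
    b.inst ![v] = b.subst fun i => i.casesOn v var := by
  rw [inst_eq_subst]
  congr 1
  funext i
  rcases i with _ | i
  · rfl
  · simp

/-- The unpacking of a channel in a functional position. -/
theorem act_unchan_chan (M : MCtx S) (F : FCtx S) (e : Expr S) :
    act (M.plug (F.plug (unchan (chan e)))) = .loc (M.plug (F.plug e)) :=
  (EHead.case .channel (0 : Fin 1) (![e] : Fin 1 → Expr S) fun _ => var 0).act_plug_plug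
    (by simp) M F

theorem act_run_out (s x y : ℕ) (P : PiStop.Proc) :
    ∃ K, act (tRun S s (.out x y P)) = .new unit K ∧ ∀ c, LocStar (K (ret (var c)))
      (andThen (putMVar (unchan (var x)) (pair (var y) (var c))) (tAck S s c P)) := by
  refine ⟨_, rfl, fun c => .bind_ret_of_eq ?_⟩
  rw [inst_one]
  simp only [andThen_subst, subst, unit_subst, pair_subst, unchan_subst, tAck, tRun]
  rw [tauAux_subst (ρ' := id) (s' := s)] <;> intros <;> rfl

theorem act_send_look (s c x y : ℕ) (P : PiStop.Proc) :
    ∃ K, act (andThen (putMVar (unchan (var x)) (pair (var y) (var c))) (tAck S s c P)) =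
      .look x K ∧ ∀ m, LocStar (K (chan (var m)))
        (andThen (putMVar (var m) (pair (var y) (var c))) (tAck S s c P)) :=
  ⟨_, rfl, fun _ => .head (act_unchan_chan (.bind .hole _) (.putMVar .hole _) _) (.refl _)⟩

theorem act_put (m : ℕ) (v e : Expr S) : ∃ K, act (andThen (putMVar (var m) v) e) = .put m v K ∧
    LocStar (K (ret unit)) e :=
  ⟨_, rfl, .andThen_ret _ _⟩

theorem act_take (m : ℕ) (e : Expr S) : ∃ K, act (andThen (takeMVar (var m)) e) = .take m K ∧
    ∀ v, LocStar (K (ret v)) e :=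
  ⟨_, rfl, fun _ => .andThen_ret _ _⟩

theorem act_run_inp (s x : ℕ) (P : PiStop.Proc) :
    ∃ K, act (tRun S s (.inp x P)) = .look x K ∧
      ∀ m, LocStar (K (chan (var m))) (bind (takeMVar (var m)) (tRecv S s P)) :=
  ⟨_, rfl, fun _ => .head (act_unchan_chan (.bind .hole _) (.takeMVar .hole) _) (.refl _)⟩

theorem act_recv (s m : ℕ) (P : PiStop.Proc) :
    ∃ K, act (bind (takeMVar (var m)) (tRecv S s P)) = .take m K ∧
      ∀ y c, LocStar (K (ret (pair (var y) (var c))))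
        (andThen (takeMVar (var c)) (tRun S s (P.inst y))) := by
  refine ⟨_, rfl, fun y c => (LocStar.bind_ret _ _).trans ?_⟩
  refine LocStar.head ?_ (.refl _)
  rw [inst_one]
  refine ((EHead.case .pair (0 : Fin 1) (![var y, var c] : Fin 2 → Expr S)
    _).act_plug_plug (by simp) .hole (.eval .hole)).trans ?_
  simp only [Act.map, Function.comp, MCtx.plug, FCtx.plug, ECtx.plug, andThen_subst,
    subst, Act.loc.injEq, tRun, PiStop.Proc.inst, tauAux_proc_rename]
  rw [tauAux_subst (ρ' := consRen 0 fun i => i + 2) (s' := s + 2)]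
  · refine (andThen_subst _ _ _).trans (congrArg₂ andThen rfl (tauAux_subst _ ?_ rfl))
    rintro (_ | i) <;> rfl
  · rintro (_ | i) <;> rfl
  · rfl

theorem act_run_par (s : ℕ) (P Q : PiStop.Proc) :
    ∃ K, act (tRun S s (.par P Q)) = .fork (tRun S s Q) K ∧ LocStar (K (ret unit)) (tRun S s P) :=
  ⟨_, rfl, .andThen_ret _ _⟩

theorem act_run_nu (s : ℕ) (P : PiStop.Proc) :
    ∃ K, act (tRun S s (.nu P)) = .new bot K ∧ ∀ m, LocStar (K (ret (var m)))
      (andThen (takeMVar (var m)) (tBind S s m P)) := by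
  refine ⟨_, rfl, fun m => .bind_ret_of_eq ?_⟩
  rw [inst_one]
  simp only [andThen_subst, subst, chan_subst, tBind]
  rw [tauAux_subst (ρ' := consRen 0 fun i => i + 1) (s' := s + 1)]
  · rfl
  · rintro (_ | i) <;> rfl
  · rfl

theorem act_bindChan (s m : ℕ) (P : PiStop.Proc) : act (tBind S s m P) =
    .letrec 1 (fun _ => chan (var (m + 1))) (tauAux S (consRen 0 fun i => i + 1) (s + 1) P) id :=
  rfl

theorem inst_bindChan (s x : ℕ) (P : PiStop.Proc) :
    (tauAux S (consRen 0 fun i => i + 1) (s + 1) P).inst (fun _ : Fin 1 => var x) =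
      tRun S s (P.inst x) := by
  rw [inst_eq_subst, tRun, PiStop.Proc.inst, tauAux_proc_rename, tauAux_subst]
  · rintro (_ | i) <;> rfl
  · rfl

/-- The body of the recursion that translates a replication. -/
def tSpawn (S : Signature) (s f : ℕ) (P : PiStop.Proc) : Expr S :=
  andThen (fork (tRun S s P)) (var f)

theorem act_run_bang (s : ℕ) (P : PiStop.Proc) : ∃ b : Expr S,
    act (tRun S s (.bang P)) = .letrec 1 (fun _ => b) (var 0) id ∧
    ∀ f, b.inst (fun _ : Fin 1 => var f) = tSpawn S s f P := by
  refine ⟨_, rfl, fun f => ?_⟩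
  rw [inst_eq_subst]
  simp only [andThen_subst, subst, tSpawn, tRun]
  rw [tauAux_subst (ρ' := id) (s' := s)] <;> intros <;> rfl

theorem act_spawn (s f : ℕ) (P : PiStop.Proc) :
    ∃ K, act (tSpawn S s f P) = .fork (tRun S s P) K ∧ LocStar (K (ret unit)) (var f) :=
  ⟨_, rfl, .andThen_ret _ _⟩

end Translation

namespace Translation
open CH CH.Expr
variable {S : Signature}

/-! ### Configurations -/

/-- The parts of a reachable state of a translated process. The free names of the `π`-processes in
an item are variables of the state. The constructors follow the execution of the translation of
the prefixes, of restriction and of replication, and that of the main thread. -/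
inductive Item : Type
  /-- The channel `x` with its empty MVar `m`. -/
  | chan (x m : ℕ)
  /-- The channel `x` with the filled MVar `m`, and the sender that has filled it. -/
  | com (x m y c : ℕ) (P : PiStop.Proc)
  /-- A thread that runs the translation of `P`. -/
  | run (P : PiStop.Proc)
  /-- A sender that has created its MVar `c`. -/
  | send₁ (c x y : ℕ) (P : PiStop.Proc)
  /-- A sender that has looked up the MVar `m` of the channel. -/
  | send₂ (c m x y : ℕ) (P : PiStop.Proc)
  /-- A receiver that has looked up the MVar `m` of the channel. -/
  | recv (m x : ℕ) (P : PiStop.Proc)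
  /-- A sender and a receiver that has taken the message. -/
  | sync₁ (c : ℕ) (P Q : PiStop.Proc)
  /-- A sender whose message has been acknowledged. -/
  | sync₂ (c : ℕ) (P : PiStop.Proc)
  /-- The MVar of a sender that has finished. -/
  | dead (c : ℕ)
  /-- A restriction that has created the MVar `m`. -/
  | nu₁ (m : ℕ) (P : PiStop.Proc)
  /-- A restriction that has emptied the MVar `m`. -/
  | nu₂ (m : ℕ) (P : PiStop.Proc)
  /-- A replication that calls the recursive binding `f`. -/
  | bang₁ (f : ℕ) (P : PiStop.Proc)
  /-- A replication that executes the body of the recursive binding `f`. -/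
  | bang₂ (f : ℕ) (P : PiStop.Proc)
  /-- The main thread, waiting for `stop`. -/
  | main
  /-- The main thread, and a thread that has taken `stop`. -/
  | stopped
  /-- The main thread that has succeeded. -/
  | success

namespace Item

/-- The components of an item, where `s` is the MVar `stop`. -/
def comps (S : Signature) (s : ℕ) : Item → Multiset (Comp S)
  | chan x m => {.share x (.chan (var m))} + {.empty m}
  | com x m y c P => {.thread false (tAck S s c P)} + {.share x (.chan (var m))} +
      {.mvar m (pair (var y) (var c))} + {.mvar c unit}
  | run P => {.thread false (tRun S s P)}
  | send₁ c x y P => {.thread false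
      (andThen (putMVar (unchan (var x)) (pair (var y) (var c))) (tAck S s c P))} + {.mvar c unit}
  | send₂ c m _ y P => {.thread false
      (andThen (putMVar (var m) (pair (var y) (var c))) (tAck S s c P))} + {.mvar c unit}
  | recv m _ P => {.thread false (bind (takeMVar (var m)) (tRecv S s P))}
  | sync₁ c P Q => {.thread false (tAck S s c P)} +
      {.thread false (andThen (takeMVar (var c)) (tRun S s Q))} + {.mvar c unit}
  | sync₂ c P => {.thread false (tAck S s c P)} + {.empty c}
  | dead c => {.mvar c unit}
  | nu₁ m P => {.thread false (andThen (takeMVar (var m)) (tBind S s m P))} + {.mvar m bot}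
  | nu₂ m P => {.thread false (tBind S s m P)} + {.empty m}
  | bang₁ f P => {.thread false (var f)} + {.share f (tSpawn S s f P)}
  | bang₂ f P => {.thread false (tSpawn S s f P)} + {.share f (tSpawn S s f P)}
  | main => {.thread true (putMVar (var s) unit)} + {.mvar s unit}
  | stopped => {.thread true (putMVar (var s) unit)} + {.empty s} + {.thread false (ret unit)}
  | success => {.thread true (ret unit)} + {.mvar s unit} + {.thread false (ret unit)}

/-- The `π`-process that an item stands for. A sender counts as a prefix until a receiver has taken
its message. -/
def proc : Item → PiStop.Proc
  | chan _ _ => .zero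
  | com x _ y _ P => .out x y P
  | run P => P
  | send₁ _ x y P => .out x y P
  | send₂ _ _ x y P => .out x y P
  | recv _ x P => .inp x P
  | sync₁ _ P Q => .par P Q
  | sync₂ _ P => P
  | dead _ => .zero
  | nu₁ _ P => .nu P
  | nu₂ _ P => .nu P
  | bang₁ _ P => .bang P
  | bang₂ _ P => .bang P
  | main => .zero
  | stopped => .Stop
  | success => .Stop

/-- The channels that belong to an item. -/
def chans : Item → Finset ℕ
  | chan x _ => {x}
  | com x _ _ _ _ => {x}
  | _ => ∅

/-- Whether the item contains the main thread. -/
def isMain : Item → Bool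
  | main => true
  | stopped => true
  | success => true
  | _ => false

/-- Whether the item is a sender that has filled the MVar of a channel. -/
def isCom : Item → Bool
  | com _ _ _ _ _ => true
  | _ => false

/-- The item contains the channel `x` with the MVar `m`. -/
inductive Holds : Item → ℕ → ℕ → Prop
  | chan (x m) : Holds (chan x m) x m
  | com (x m y c P) : Holds (com x m y c P) x m

/-- The item has looked up the MVar `m` of the channel `x`. -/
inductive Uses : Item → ℕ → ℕ → Prop
  | send₂ (c m x y P) : Uses (send₂ c m x y P) x m
  | recv (m x P) : Uses (recv m x P) x m

end Item

/-- The components of several items. -/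
def allComps (S : Signature) (s : ℕ) (I : Multiset Item) : Multiset (Comp S) :=
  (I.map (Item.comps S s)).sum

/-- The channels of several items. -/
def allChans (I : Multiset Item) : Finset ℕ := (I.map Item.chans).sup

/-- The class of the `π`-process that several items stand for, with free channels. -/
def body (I : Multiset Item) : PiStop.Cls := (I.map fun i => PiStop.cls i.proc).sum

/-- The class of the `π`-process that several items stand for. -/
def decode (I : Multiset Item) : PiStop.Cls := (body I).close (allChans I)

section simps
variable (s : ℕ) (I J : Multiset Item) (i : Item)

@[simp] theorem allComps_zero : allComps S s 0 = 0 := rfl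
@[simp] theorem allComps_add : allComps S s (I + J) = allComps S s I + allComps S s J := by
  simp [allComps]
@[simp] theorem allComps_cons : allComps S s (i ::ₘ J) = i.comps S s + allComps S s J := by
  simp [allComps]
@[simp] theorem allComps_singleton : allComps S s {i} = i.comps S s := by simp [allComps]
@[simp] theorem allChans_zero : allChans 0 = ∅ := rfl
@[simp] theorem allChans_add : allChans (I + J) = allChans I ∪ allChans J := by
  simp [allChans]
@[simp] theorem allChans_cons : allChans (i ::ₘ J) = i.chans ∪ allChans J := by
  simp [allChans]
@[simp] theorem allChans_singleton : allChans {i} = i.chans := by simp [allChans]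
@[simp] theorem body_zero : body 0 = 0 := rfl
@[simp] theorem body_add : body (I + J) = body I + body J := by simp [body]
@[simp] theorem body_cons : body (i ::ₘ J) = PiStop.cls i.proc + body J := by simp [body]
@[simp] theorem body_singleton : body {i} = PiStop.cls i.proc := by simp [body]

end simps

theorem mem_allChans {I : Multiset Item} {x : ℕ} : x ∈ allChans I ↔ ∃ i ∈ I, x ∈ i.chans := by
  induction I using Multiset.induction_on with
  | empty => simp
  | cons i I ih => simp [ih]

theorem Item.mem_chans {i : Item} {x : ℕ} (h : x ∈ i.chans) : ∃ m, i.Holds x m := by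
  cases i <;> simp only [chans, Finset.notMem_empty, Finset.mem_singleton] at h
  · exact ⟨_, by subst h; exact Holds.chan _ _⟩
  · exact ⟨_, by subst h; exact Holds.com _ _ _ _ _⟩

/-- What the items do: `Move r N B N'` replaces the items `N` by `N'`, introducing the names `B`.
The moves with `r = true` are those that correspond to a reduction of the `π`-process. -/
inductive Move : Bool → Multiset Item → Finset ℕ → Multiset Item → Prop
  | out (c x y P) : Move false {.run (.out x y P)} {c} {.send₁ c x y P}
  | lookSend (c x y P) {m i} (h : i.Holds x m) :
      Move false ({.send₁ c x y P} + {i}) ∅ ({.send₂ c m x y P} + {i})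
  | put (c x y P m) : Move false ({.send₂ c m x y P} + {.chan x m}) ∅ {.com x m y c P}
  | lookRecv (x P) {m i} (h : i.Holds x m) :
      Move false ({.run (.inp x P)} + {i}) ∅ ({.recv m x P} + {i})
  | take (x m y c P Q) : Move true ({.recv m x P} + {.com x m y c Q}) ∅
      ({.sync₁ c Q (P.inst y)} + {.chan x m})
  | ack₁ (c P Q) : Move false {.sync₁ c P Q} ∅ ({.sync₂ c P} + {.run Q})
  | ack₂ (c P) : Move false {.sync₂ c P} ∅ ({.run P} + {.dead c})
  | par (P Q) : Move false {.run (.par P Q)} ∅ ({.run P} + {.run Q})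
  | nu₁ (m P) : Move false {.run (.nu P)} {m} {.nu₁ m P}
  | nu₂ (m P) : Move false {.nu₁ m P} ∅ {.nu₂ m P}
  | nu₃ (m x P) : Move false {.nu₂ m P} {x} ({.run (P.inst x)} + {.chan x m})
  | bang (f P) : Move false {.run (.bang P)} {f} {.bang₁ f P}
  | bang₁ (f P) : Move false {.bang₁ f P} ∅ {.bang₂ f P}
  | bang₂ (f P) : Move false {.bang₂ f P} ∅ ({.bang₁ f P} + {.run P})
  | halt : Move false ({.run .Stop} + {.main}) ∅ {.stopped}
  | success : Move false {.stopped} ∅ {.success}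

/-- A component and its counterpart in the components of an item: a thread may still have local
steps to do, except for the main thread that has succeeded. -/
inductive Sim : Comp S → Comp S → Prop
  | refl (c) : Sim c c
  | loc {m e e'} (h : LocStar e e') (hm : m = true → ∀ v, e' ≠ ret v) :
      Sim (.thread m e) (.thread m e')

theorem Sim.thread {e e' : Expr S} (h : LocStar e e') : Sim (.thread false e) (.thread false e') :=
  .loc h nofun

/-- The replacement of the components `L₁` of `N` by `L₁'` implements the move from `N` to `N'`, up
to local steps of one thread `c`, the one that has been active. -/
def Implements (s : ℕ) (N N' : Multiset Item) (L₁ L₁' : Multiset (Comp S)) : Prop :=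
  ∃ R K c c', allComps S s N = L₁ + R ∧ L₁' + R = {c} + K ∧ allComps S s N' = {c'} + K ∧ Sim c c'

section Implements
variable {s c x y m f : ℕ} {P Q : PiStop.Proc}

theorem implements_out {K : Expr S → Expr S} (hK : LocStar (K (ret (var c)))
      (andThen (putMVar (unchan (var x)) (pair (var y) (var c))) (tAck S s c P))) :
    Implements s {.run (.out x y P)} {.send₁ c x y P} {.thread false (tRun S s (.out x y P))}
      {.thread false (K (ret (var c))), .mvar c unit} :=
  ⟨0, {.mvar c unit}, _, _, by simp [Item.comps], by rw [add_zero]; rfl,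
    by simp only [allComps_singleton, Item.comps], .thread hK⟩

theorem implements_lookSend {K : Expr S → Expr S} {i : Item} (hi : i.Holds x m)
    (hK : LocStar (K (chan (var m)))
      (andThen (putMVar (var m) (pair (var y) (var c))) (tAck S s c P))) :
    Implements s ({.send₁ c x y P} + {i}) ({.send₂ c m x y P} + {i})
      {.thread false (andThen (putMVar (unchan (var x)) (pair (var y) (var c))) (tAck S s c P)),
        .share x (chan (var m))}
      {.thread false (K (chan (var m))), .share x (chan (var m))} := by
  cases hi with
  | chan =>
    refine ⟨{.mvar c unit} + {.empty m},
      {.share x (chan (var m))} + {.mvar c unit} + {.empty m}, _, _, ?_, ?_, ?_,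
      .thread hK⟩ <;>
    simp only [allComps_add, allComps_singleton, Item.comps, Multiset.insert_eq_cons,
      ← Multiset.singleton_add] <;> abel
  | com _ _ y' c' P' =>
    refine ⟨{.mvar c unit} + {.thread false (tAck S s c' P')} +
        {.mvar m (pair (var y') (var c'))} + {.mvar c' unit},
      {.share x (chan (var m))} + {.mvar c unit} + {.thread false (tAck S s c' P')} +
        {.mvar m (pair (var y') (var c'))} + {.mvar c' unit}, _, _, ?_, ?_, ?_,
      .thread hK⟩ <;>
    simp only [allComps_add, allComps_singleton, Item.comps, Multiset.insert_eq_cons,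
      ← Multiset.singleton_add] <;> abel

theorem implements_put {K : Expr S → Expr S} (hK : LocStar (K (ret unit)) (tAck S s c P)) :
    Implements s ({.send₂ c m x y P} + {.chan x m}) {.com x m y c P}
      {.thread false (andThen (putMVar (var m) (pair (var y) (var c))) (tAck S s c P)), .empty m}
      {.thread false (K (ret unit)), .mvar m (pair (var y) (var c))} := by
  refine ⟨{.mvar c unit} + {.share x (chan (var m))},
    {.share x (chan (var m))} + {.mvar m (pair (var y) (var c))} + {.mvar c unit}, _, _, ?_, ?_, ?_,
    .thread hK⟩ <;>
  simp only [allComps_add, allComps_singleton, Item.comps, Multiset.insert_eq_cons,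
    ← Multiset.singleton_add] <;> abel

theorem implements_lookRecv {K : Expr S → Expr S} {i : Item} (hi : i.Holds x m)
    (hK : LocStar (K (chan (var m))) (bind (takeMVar (var m)) (tRecv S s P))) :
    Implements s ({.run (.inp x P)} + {i}) ({.recv m x P} + {i})
      {.thread false (tRun S s (.inp x P)), .share x (chan (var m))}
      {.thread false (K (chan (var m))), .share x (chan (var m))} := by
  cases hi with
  | chan =>
    refine ⟨{.empty m}, {.share x (chan (var m))} + {.empty m}, _, _, ?_, ?_, ?_,
      .thread hK⟩ <;>
    simp only [allComps_add, allComps_singleton, Item.comps, Multiset.insert_eq_cons,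
      ← Multiset.singleton_add] <;> abel
  | com _ _ y' c' P' =>
    refine ⟨{.thread false (tAck S s c' P')} +
        {.mvar m (pair (var y') (var c'))} + {.mvar c' unit},
      {.share x (chan (var m))} + {.thread false (tAck S s c' P')} +
        {.mvar m (pair (var y') (var c'))} + {.mvar c' unit}, _, _, ?_, ?_, ?_,
      .thread hK⟩ <;>
    simp only [allComps_add, allComps_singleton, Item.comps, Multiset.insert_eq_cons,
      ← Multiset.singleton_add] <;> abel

theorem implements_take {K : Expr S → Expr S} (hK : LocStar (K (ret (pair (var y) (var c))))
      (andThen (takeMVar (var c)) (tRun S s (P.inst y)))) :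
    Implements s ({.recv m x P} + {.com x m y c Q}) ({.sync₁ c Q (P.inst y)} + {.chan x m})
      {.thread false (bind (takeMVar (var m)) (tRecv S s P)), .mvar m (pair (var y) (var c))}
      {.thread false (K (ret (pair (var y) (var c)))), .empty m} := by
  refine ⟨{.thread false (tAck S s c Q)} + {.share x (chan (var m))} + {.mvar c unit},
    {.thread false (tAck S s c Q)} + {.share x (chan (var m))} + {.mvar c unit} + {.empty m},
    _, _, ?_, ?_, ?_, .thread hK⟩ <;>
  simp only [allComps_add, allComps_singleton, Item.comps, Multiset.insert_eq_cons,
    ← Multiset.singleton_add] <;> abel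

theorem implements_ack₁ {K : Expr S → Expr S} (hK : LocStar (K (ret unit)) (tRun S s Q)) :
    Implements s {.sync₁ c P Q} ({.sync₂ c P} + {.run Q})
      {.thread false (andThen (takeMVar (var c)) (tRun S s Q)), .mvar c unit}
      {.thread false (K (ret unit)), .empty c} := by
  refine ⟨{.thread false (tAck S s c P)}, {.thread false (tAck S s c P)} + {.empty c},
    _, _, ?_, ?_, ?_, .thread hK⟩ <;>
  simp only [allComps_add, allComps_singleton, Item.comps, Multiset.insert_eq_cons,
    ← Multiset.singleton_add] <;> abel

theorem implements_ack₂ {K : Expr S → Expr S} (hK : LocStar (K (ret unit)) (tRun S s P)) :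
    Implements s {.sync₂ c P} ({.run P} + {.dead c}) {.thread false (tAck S s c P), .empty c}
      {.thread false (K (ret unit)), .mvar c unit} := by
  refine ⟨0, {.mvar c unit}, _, _, ?_, ?_, ?_, .thread hK⟩ <;>
  simp only [allComps_add, allComps_singleton, Item.comps, Multiset.insert_eq_cons,
    ← Multiset.singleton_add] <;> abel

theorem implements_par {K : Expr S → Expr S} (hK : LocStar (K (ret unit)) (tRun S s P)) :
    Implements s {.run (.par P Q)} ({.run P} + {.run Q}) {.thread false (tRun S s (.par P Q))}
      {.thread false (K (ret unit)), .thread false (tRun S s Q)} := by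
  refine ⟨0, {.thread false (tRun S s Q)}, _, _, ?_, ?_, ?_, .thread hK⟩ <;>
  simp only [allComps_add, allComps_singleton, Item.comps, Multiset.insert_eq_cons,
    ← Multiset.singleton_add] <;> abel

theorem implements_nu₁ {K : Expr S → Expr S} (hK : LocStar (K (ret (var m)))
      (andThen (takeMVar (var m)) (tBind S s m P))) :
    Implements s {.run (.nu P)} {.nu₁ m P} {.thread false (tRun S s (.nu P))}
      {.thread false (K (ret (var m))), .mvar m bot} := by
  refine ⟨0, {.mvar m bot}, _, _, ?_, ?_, ?_, .thread hK⟩ <;>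
  simp only [allComps_singleton, Item.comps, Multiset.insert_eq_cons,
    ← Multiset.singleton_add] <;> abel

theorem implements_nu₂ {K : Expr S → Expr S} (hK : LocStar (K (ret bot)) (tBind S s m P)) :
    Implements s {.nu₁ m P} {.nu₂ m P}
      {.thread false (andThen (takeMVar (var m)) (tBind S s m P)), .mvar m bot}
      {.thread false (K (ret bot)), .empty m} := by
  refine ⟨0, {.empty m}, _, _, ?_, ?_, ?_, .thread hK⟩ <;>
  simp only [allComps_singleton, Item.comps, Multiset.insert_eq_cons,
    ← Multiset.singleton_add] <;> abel

theorem implements_nu₃ : Implements s {.nu₂ m P} ({.run (P.inst x)} + {.chan x m})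
    {.thread false (tBind S s m P)}
    ({.thread false (tRun S s (P.inst x))} + {.share x (chan (var m))}) := by
  refine ⟨{.empty m}, {.share x (chan (var m))} + {.empty m}, _, _, ?_, ?_, ?_,
    .refl (.thread false (tRun S s (P.inst x)))⟩
  · rw [allComps_singleton, Item.comps]
  · abel
  · simp only [allComps_add, allComps_singleton, Item.comps]

theorem implements_bang : Implements s {.run (.bang P)} {.bang₁ f P}
    {.thread false (tRun S s (.bang P))}
    ({.thread false (var f)} + {.share f (tSpawn S s f P)}) := by
  refine ⟨0, {.share f (tSpawn S s f P)}, _, _, ?_, ?_, ?_, .refl (.thread false (var f))⟩ <;>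
  (try simp only [allComps_singleton, Item.comps]) <;> abel

theorem implements_bang₁ : Implements s {.bang₁ f P} {.bang₂ f P}
    {.thread false (var f), .share f (tSpawn S s f P)}
    {.thread false (tSpawn S s f P), .share f (tSpawn S s f P)} := by
  refine ⟨0, {.share f (tSpawn S s f P)}, _, _, ?_, ?_, ?_,
    .refl (.thread false (tSpawn S s f P))⟩ <;>
  simp only [allComps_singleton, Item.comps, Multiset.insert_eq_cons,
    ← Multiset.singleton_add] <;> abel

theorem implements_bang₂ {K : Expr S → Expr S} (hK : LocStar (K (ret unit)) (var f)) :
    Implements s {.bang₂ f P} ({.bang₁ f P} + {.run P}) {.thread false (tSpawn S s f P)}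
      {.thread false (K (ret unit)), .thread false (tRun S s P)} := by
  refine ⟨{.share f (tSpawn S s f P)}, {.thread false (tRun S s P)} + {.share f (tSpawn S s f P)},
    _, _, ?_, ?_, ?_, .thread hK⟩ <;>
  simp only [allComps_add, allComps_singleton, Item.comps, Multiset.insert_eq_cons,
    ← Multiset.singleton_add] <;> abel

theorem implements_halt : Implements (S := S) s ({.run .Stop} + {.main}) {.stopped}
    {.thread false (takeMVar (var s)), .mvar s unit} {.thread false (ret unit), .empty s} := by
  refine ⟨{.thread true (putMVar (var s) unit)},
    {.thread true (putMVar (var s) unit)} + {.empty s}, _, _, ?_, ?_, ?_,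
    .refl (.thread false (ret unit))⟩ <;>
  simp only [allComps_add, allComps_singleton, Item.comps, Multiset.insert_eq_cons, tRun, tauAux,
    ← Multiset.singleton_add] <;> abel

theorem implements_success : Implements (S := S) s {.stopped} {.success}
    {.thread true (putMVar (var s) unit), .empty s} {.thread true (ret unit), .mvar s unit} := by
  refine ⟨{.thread false (ret unit)}, {.mvar s unit} + {.thread false (ret unit)}, _, _, ?_, ?_, ?_,
    .refl (.thread true (ret unit))⟩ <;>
  simp only [allComps_singleton, Item.comps, Multiset.insert_eq_cons,
    ← Multiset.singleton_add] <;> abel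

end Implements

theorem shares_one (x : ℕ) (b : Expr S) : shares (fun _ : Fin 1 => x) (fun _ => b) =
    {.share x (b.inst fun _ : Fin 1 => var x)} := rfl

theorem nu₃_result (s m x : ℕ) (P : PiStop.Proc) :
    (.thread false ((tauAux S (consRen 0 fun i => i + 1) (s + 1) P).inst
      fun _ : Fin 1 => var x) ::ₘ shares (fun _ : Fin 1 => x) fun _ => chan (var (m + 1))) =
    ({.thread false (tRun S s (P.inst x))} + {.share x (chan (var m))} : Multiset (Comp S)) := by
  rw [inst_bindChan, shares_one, inst_eq_subst, chan_subst]
  rfl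

/-- Every move is implemented by a reduction. -/
theorem Move.implements {r : Bool} {N N' : Multiset Item} {B : Finset ℕ} (h : Move r N B N')
    (S : Signature) (s : ℕ) : ∃ L L', GStep (S := S) L B L' ∧ Implements s N N' L L' := by
  cases h with
  | out c x y P =>
    obtain ⟨K, hK, h⟩ := act_run_out (S := S) s x y P
    exact ⟨_, _, .new c hK, implements_out (h c)⟩
  | lookSend c x y P hi =>
    obtain ⟨K, hK, h⟩ := act_send_look (S := S) s c x y P
    exact ⟨_, _, .look _ hK, implements_lookSend hi (h _)⟩
  | put c x y P m =>
    obtain ⟨K, hK, h⟩ := act_put (S := S) m (pair (var y) (var c)) (tAck S s c P)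
    exact ⟨_, _, .put hK, implements_put h⟩
  | lookRecv x P hi =>
    obtain ⟨K, hK, h⟩ := act_run_inp (S := S) s x P
    exact ⟨_, _, .look _ hK, implements_lookRecv hi (h _)⟩
  | take x m y c P Q =>
    obtain ⟨K, hK, h⟩ := act_recv (S := S) s m P
    exact ⟨_, _, .take _ hK, implements_take (h y c)⟩
  | ack₁ c P Q =>
    obtain ⟨K, hK, h⟩ := act_take (S := S) c (tRun S s Q)
    exact ⟨_, _, .take _ hK, implements_ack₁ (h _)⟩
  | ack₂ c P =>
    obtain ⟨K, hK, h⟩ := act_put (S := S) c unit (tRun S s P)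
    exact ⟨_, _, .put hK, implements_ack₂ h⟩
  | par P Q =>
    obtain ⟨K, hK, h⟩ := act_run_par (S := S) s P Q
    exact ⟨_, _, .fork hK, implements_par h⟩
  | nu₁ m P =>
    obtain ⟨K, hK, h⟩ := act_run_nu (S := S) s P
    exact ⟨_, _, .new m hK, implements_nu₁ (h m)⟩
  | nu₂ m P =>
    obtain ⟨K, hK, h⟩ := act_take (S := S) m (tBind S s m P)
    exact ⟨_, _, .take _ hK, implements_nu₂ (h _)⟩
  | nu₃ m x P =>
    have h := GStep.letrec (m := false) (fun _ : Fin 1 => x) (fun _ _ _ => Subsingleton.elim _ _)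
      (act_bindChan (S := S) s m P)
    exact ⟨_, _, h, nu₃_result (S := S) s m x P ▸ implements_nu₃⟩
  | bang f P =>
    obtain ⟨b, hb, hf⟩ := act_run_bang (S := S) s P
    have h := GStep.letrec (m := false) (fun _ : Fin 1 => f) (fun _ _ _ => Subsingleton.elim _ _) hb
    rw [shares_one, hf] at h
    exact ⟨_, _, h, implements_bang⟩
  | bang₁ f P => exact ⟨_, _, .look (K := id) _ rfl, implements_bang₁⟩
  | bang₂ f P =>
    obtain ⟨K, hK, h⟩ := act_spawn (S := S) s f P
    exact ⟨_, _, .fork hK, implements_bang₂ h⟩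
  | halt => exact ⟨_, _, .take (K := id) unit rfl, implements_halt⟩
  | success => exact ⟨_, _, .put (K := id) rfl, implements_success⟩

end Translation

namespace Translation
open CH CH.Expr
variable {S : Signature} {s : ℕ}

/-! ### Names of components -/

theorem mem_names {L : Multiset (Comp S)} {x : ℕ} : x ∈ names L ↔ ∃ c ∈ L, c.name = some x := by
  simp [names]

theorem names_singleton (c : Comp S) : names {c} = c.name.elim 0 fun x => {x} := by
  cases c <;> rfl

/-- Different components have different names. -/
theorem cell_unique {L : Multiset (Comp S)} (hL : (names L).Nodup) {c c' : Comp S} {x : ℕ}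
    (hc : c ∈ L) (hc' : c' ∈ L) (h : c.name = some x) (h' : c'.name = some x) : c = c' := by
  by_contra hne
  obtain ⟨M, rfl⟩ := Multiset.exists_cons_of_mem hc
  rw [← Multiset.singleton_add, names_add, names_singleton, h] at hL
  have h1 : c' ∈ M := (Multiset.mem_cons.1 hc').resolve_left (Ne.symm hne)
  have h2 := (Multiset.nodup_cons.1 hL).1
  exact h2 (mem_names.2 ⟨c', h1, h'⟩)

theorem mem_allComps {I : Multiset Item} {c : Comp S} :
    c ∈ allComps S s I ↔ ∃ i ∈ I, c ∈ i.comps S s := by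
  induction I using Multiset.induction_on with
  | empty => simp
  | cons i I ih => simp [ih]

theorem Item.Holds.share_mem {i : Item} {x m : ℕ} (h : i.Holds x m) :
    Comp.share x (CH.Expr.chan (var m)) ∈ i.comps S s := by
  cases h <;> simp [comps]

theorem allChans_subset {I : Multiset Item} {x : ℕ} (h : x ∈ allChans I) :
    x ∈ names (allComps S s I) := by
  obtain ⟨i, hi, hx⟩ := mem_allChans.1 h
  obtain ⟨m, hm⟩ := i.mem_chans hx
  exact mem_names.2 ⟨_, mem_allComps.2 ⟨i, hi, hm.share_mem⟩, rfl⟩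

/-! ### Invariants of configurations -/

/-- The invariants of configurations, where `A` are the restricted names of the state. -/
structure Good (S : Signature) (s : ℕ) (A : Finset ℕ) (I : Multiset Item) : Prop where
  /-- The introduced variables are distinct: every channel and every MVar exists only once. -/
  nodup : (names (allComps S s I)).Nodup
  /-- The introduced variables are restricted. -/
  sub : ∀ a ∈ names (allComps S s I), a ∈ A
  /-- The `π`-processes refer to existing channels. -/
  fn : ∀ i ∈ I, i.proc.FN ⊆ allChans I
  /-- The MVars that have been looked up are those of existing channels. -/
  uses : ∀ i ∈ I, ∀ x m, i.Uses x m → ∃ j ∈ I, j.Holds x m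
  /-- There is exactly one main thread. -/
  main : I.countP (fun i => i.isMain) = 1

theorem Move.names {r : Bool} {N N' : Multiset Item} {B : Finset ℕ} (h : Move r N B N') :
    names (allComps S s N') = names (allComps S s N) + B.val := by
  cases h <;>
    simp only [allComps_add, allComps_singleton, Item.comps, names_add, names_singleton, Comp.name,
      Option.elim, zero_add, add_zero, Finset.empty_val, Finset.singleton_val] <;>
    (try abel)

theorem Move.main {r : Bool} {N N' : Multiset Item} {B : Finset ℕ} (h : Move r N B N') :
    N'.countP (fun i => i.isMain) = N.countP fun i => i.isMain := by
  cases h <;>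
    simp only [Multiset.countP_add, ← Multiset.cons_zero, Multiset.countP_cons,
      Multiset.countP_zero] <;>
    rfl

theorem Move.allChans_subset {r : Bool} {N N' : Multiset Item} {B : Finset ℕ}
    (h : Move r N B N') : allChans N ⊆ allChans N' := by
  cases h <;> simp [Item.chans]

theorem Move.holds {r : Bool} {N N' : Multiset Item} {B : Finset ℕ} (h : Move r N B N') {i : Item}
    {x m : ℕ} (hi : i ∈ N) (hx : i.Holds x m) : ∃ j ∈ N', j.Holds x m := by
  cases h <;>
    simp only [Multiset.mem_add, Multiset.mem_singleton] at hi ⊢ <;>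
    (try rcases hi with rfl | rfl) <;> (try cases hx) <;>
    first | exact ⟨_, .inr rfl, hx⟩ | exact ⟨_, .inr rfl, .chan _ _⟩
          | exact ⟨_, rfl, .com _ _ _ _ _⟩
          | exact ⟨_, .inr rfl, .com _ _ _ _ _⟩

theorem Move.uses {r : Bool} {N N' : Multiset Item} {B : Finset ℕ} (h : Move r N B N') {i : Item}
    {x m : ℕ} (hi : i ∈ N') (hx : i.Uses x m) :
    (∃ j ∈ N', j.Holds x m) ∨ ∃ j ∈ N, j.Uses x m := by
  cases h with
  | lookSend c x y P h =>
    rcases Multiset.mem_add.1 hi with hi | hi <;> rw [Multiset.mem_singleton] at hi <;> subst hi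
    · cases hx
      exact .inl ⟨_, by simp, h⟩
    · cases h <;> cases hx
  | lookRecv x P h =>
    rcases Multiset.mem_add.1 hi with hi | hi <;> rw [Multiset.mem_singleton] at hi <;> subst hi
    · cases hx
      exact .inl ⟨_, by simp, h⟩
    · cases h <;> cases hx
  | _ =>
    simp only [Multiset.mem_add, Multiset.mem_singleton] at hi
    (try rcases hi with rfl | rfl) <;> cases hx

open PiStop.Proc in
theorem Move.fn {r : Bool} {N N' : Multiset Item} {B : Finset ℕ} (h : Move r N B N')
    {X X' : Set ℕ} (hX : ∀ i ∈ N, i.proc.FN ⊆ X) (hX' : X ⊆ X') (hN : ↑(allChans N') ⊆ X') :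
    ∀ i ∈ N', i.proc.FN ⊆ X' := by
  have key : ∀ i ∈ N, i.proc.FN ⊆ X' := fun i hi => (hX i hi).trans hX'
  cases h with
  | take x m y c P Q =>
    simp only [Multiset.mem_add, Multiset.mem_singleton, forall_eq_or_imp, forall_eq, Item.proc,
      PiStop.Proc.FN] at key ⊢
    obtain ⟨h1, h2⟩ := key
    simp only [Set.union_subset_iff, Set.insert_subset_iff] at h1 h2
    refine ⟨Set.union_subset h2.2 ?_, by simp⟩
    rw [PiStop.Proc.inst, FN_rename]
    rintro _ ⟨_ | i, hi, rfl⟩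
    · exact h2.1.2 rfl
    · exact h1.2 hi
  | nu₃ m x P =>
    simp only [Multiset.mem_add, Multiset.mem_singleton, forall_eq_or_imp, forall_eq, Item.proc,
      PiStop.Proc.FN] at key ⊢
    refine ⟨?_, by simp⟩
    rw [PiStop.Proc.inst, FN_rename]
    rintro _ ⟨_ | i, hi, rfl⟩
    · exact hN (by simp [Item.chans])
    · exact key hi
  | lookSend | lookRecv =>
    simpa [Item.proc, PiStop.Proc.FN] using key
  | _ =>
    simp only [Multiset.mem_add, Multiset.mem_singleton, forall_eq_or_imp, forall_eq, Item.proc,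
      PiStop.Proc.FN, Set.empty_subset, and_true, Set.union_subset_iff] at key ⊢ <;>
    tauto

/-- The global names of the free variables of the initial process, namely the even numbers, so that
infinitely many names remain for restricted variables. -/
def free (i : ℕ) : ℕ := 2 * i

theorem coInf_range_free : CoInf (Set.range free) := by
  refine Set.infinite_of_injective_forall_mem (f := fun i : ℕ => 2 * i + 1) (fun i j h => ?_) ?_
  · simpa using h
  · rintro i ⟨j, hj⟩
    simp only [free] at hj
    omega

/-- A move within a configuration, with fresh names. -/
def MStep (r : Bool) (A : Finset ℕ) (I : Multiset Item) (A' : Finset ℕ) (I' : Multiset Item) :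
    Prop :=
  ∃ N B N' J, I = N + J ∧ I' = N' + J ∧ A' = A ∪ B ∧ Move r N B N' ∧
    ∀ b ∈ B, b ∉ A ∧ b ∉ Set.range free

/-- The moves preserve the invariants. -/
theorem Good.step {r : Bool} {A A' : Finset ℕ} {I I' : Multiset Item} (h : Good S s A I)
    (hm : MStep r A I A' I') : Good S s A' I' := by
  obtain ⟨N, B, N', J, rfl, rfl, rfl, hm, hB⟩ := hm
  obtain ⟨h1, h2, h3, h4, h5⟩ := h
  have hsub : allChans (N + J) ⊆ allChans (N' + J) := by
    simp only [allChans_add]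
    exact Finset.union_subset_union_left hm.allChans_subset
  refine ⟨?_, ?_, ?_, ?_, ?_⟩
  · simp only [allComps_add, names_add, hm.names] at h1 ⊢
    rw [add_right_comm]
    refine Multiset.nodup_add.2 ⟨h1, B.nodup, Multiset.disjoint_left.2 fun {a} ha hb => ?_⟩
    exact (hB a hb).1 (h2 a (by simpa using ha))
  · intro a ha
    simp only [allComps_add, names_add, hm.names, Multiset.mem_add, Finset.mem_val] at ha h2
    rw [Finset.mem_union]
    rcases ha with (ha | ha) | ha
    · exact .inl (h2 a (.inl ha))
    · exact .inr ha
    · exact .inl (h2 a (.inr ha))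
  · intro i hi
    rcases Multiset.mem_add.1 hi with hi | hi
    · refine hm.fn (X := allChans (N + J)) (fun i hi => h3 i (Multiset.mem_add.2 (.inl hi)))
        (Finset.coe_subset.2 hsub) ?_ i hi
      simp
    · exact (h3 i (Multiset.mem_add.2 (.inr hi))).trans (Finset.coe_subset.2 hsub)
  · have key : ∀ x m, (∃ j ∈ N + J, j.Holds x m) → ∃ j ∈ N' + J, j.Holds x m := by
      rintro x m ⟨j, hj, hx⟩
      rcases Multiset.mem_add.1 hj with hj | hj
      · obtain ⟨j, hj, hx⟩ := hm.holds hj hx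
        exact ⟨j, Multiset.mem_add.2 (.inl hj), hx⟩
      · exact ⟨j, Multiset.mem_add.2 (.inr hj), hx⟩
    intro i hi x m hx
    rcases Multiset.mem_add.1 hi with hi | hi
    · rcases hm.uses hi hx with ⟨j, hj, hx⟩ | ⟨j, hj, hx⟩
      · exact ⟨j, Multiset.mem_add.2 (.inl hj), hx⟩
      · exact key x m (h4 j (Multiset.mem_add.2 (.inl hj)) x m hx)
    · exact key x m (h4 i (Multiset.mem_add.2 (.inr hi)) x m hx)
  · rw [Multiset.countP_add] at h5 ⊢
    rw [hm.main, h5]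

/-! ### Moves and the `π`-calculus -/

open PiStop (cls Cls StepQ)

theorem body_FN {I : Multiset Item} {X : Set ℕ} (h : ∀ i ∈ I, i.proc.FN ⊆ X) :
    (body I).FN ⊆ X := by
  induction I using Multiset.induction_on with
  | empty => simp
  | cons i I ih =>
    rw [body_cons, Cls.FN_add]
    exact Set.union_subset (h i (Multiset.mem_cons_self i I))
      (ih fun j hj => h j (Multiset.mem_cons_of_mem hj))

theorem cls_nu_eq (P : PiStop.Proc) {x : ℕ} (h : x ∉ (PiStop.Proc.nu P).FN) :
    cls (.nu P) = Cls.nuN x (cls (P.inst x)) := by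
  have := PiStop.Cls.cls_rename_nu (P := P) (ρ := id) (a := x) (by rwa [PiStop.Proc.rename_id])
  rwa [PiStop.Proc.rename_id] at this

theorem cls_inp_toCls (x : ℕ) (P : PiStop.Proc) :
    (PiStop.Pre.inp x (cls P)).toCls = cls (.inp x P) := rfl

theorem cls_out_toCls (x y : ℕ) (P : PiStop.Proc) :
    (PiStop.Pre.out x y (cls P)).toCls = cls (.out x y P) := rfl

theorem cls_inst (P : PiStop.Proc) (y : ℕ) : (cls P).inst y = cls (P.inst y) := rfl

theorem cls_bang (P : PiStop.Proc) : cls (.bang P) = cls (.bang P) + cls P := by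
  rw [add_comm]
  exact PiStop.cls_eq.2 (.bang_unfold P)

/-- The moves that are not communications, except for the creation of a channel, do not change the
class even before the channels are restricted. -/
theorem Move.body_eq {N N' : Multiset Item} {B : Finset ℕ} (h : Move false N B N') :
    (allChans N' = allChans N ∧ body N' = body N) ∨
      ∃ m x P, N = {.nu₂ m P} ∧ B = {x} ∧ N' = {.run (P.inst x)} + {.chan x m} := by
  cases h with
  | nu₃ m x P => exact .inr ⟨m, x, P, rfl, rfl, rfl⟩
  | bang₂ f P => 
    left
    simp only [allChans_add, allChans_singleton, body_add, body_singleton, Item.proc, Item.chans]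
    exact ⟨rfl, (cls_bang P).symm⟩
  | _ =>
    left
    simp only [allChans_add, allChans_singleton, body_add, body_singleton, Item.proc, Item.chans,
      PiStop.Cls.cls_zero, PiStop.Cls.cls_par]
    simp [add_comm]

/-- The other moves than communications do not change the class. The move that creates a channel is
an extrusion of the scope of a restriction. -/
theorem decode_eq_of_mStep {A A' : Finset ℕ} {I I' : Multiset Item} (h : Good S s A I)
    (hm : MStep false A I A' I') : decode I' = decode I := by
  obtain ⟨N, B, N', J, rfl, rfl, rfl, hm, hB⟩ := hm
  rcases hm.body_eq with ⟨h1, h2⟩ | ⟨m, x, P, rfl, rfl, rfl⟩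
  · simp only [decode, allChans_add, body_add, h1, h2]
  · have hx : x ∉ allChans ({.nu₂ m P} + J) := fun hx =>
      (hB x (by simp)).1 (h.sub x (Translation.allChans_subset hx))
    have hP : (PiStop.Proc.nu P).FN ⊆ _ := h.fn (.nu₂ m P) (by simp)
    have hJ : (body J).FN ⊆ _ := body_FN fun i hi => h.fn i (Multiset.mem_add.2 (.inr hi))
    have hx' : x ∉ allChans J := by simpa [Item.chans] using hx
    have h1 : allChans ({.run (P.inst x)} + {.chan x m} + J) = insert x (allChans J) := by
      simp only [allChans_add, allChans_singleton, Item.chans, Finset.empty_union]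
      rfl
    have h2 : allChans ({.nu₂ m P} + J) = allChans J := by simp [Item.chans]
    rw [decode, decode, h1, h2, PiStop.Cls.close_insert hx', PiStop.Cls.nuN_close]
    simp only [body_add, body_singleton, Item.proc, PiStop.Cls.cls_zero, add_zero]
    rw [cls_nu_eq P fun hx'' => hx (hP hx''), add_comm, PiStop.Cls.nuN_add fun hx'' => hx (hJ hx''),
      add_comm]

/-- A communication is a reduction of the class. -/
theorem stepQ_of_mStep {A A' : Finset ℕ} {I I' : Multiset Item}
    (hm : MStep true A I A' I') : StepQ (decode I) (decode I') := by
  obtain ⟨N, B, N', J, rfl, rfl, rfl, hm, hB⟩ := hm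
  cases hm with
  | take x m y c P Q =>
    have h1 : allChans ({.sync₁ c Q (P.inst y)} + {.chan x m} + J) =
        allChans ({.recv m x P} + {.com x m y c Q} + J) := by simp [Item.chans]
    rw [decode, decode, h1]
    refine StepQ.close ?_ _
    simp only [body_add, body_singleton, Item.proc, PiStop.Cls.cls_zero, PiStop.Cls.cls_par,
      add_zero]
    rw [add_comm (cls Q), ← cls_inp_toCls, ← cls_out_toCls, ← cls_inst]
    exact (PiStop.StepQ.react x y _ _).add_right _

end Translation

namespace Translation
open CH CH.Expr
variable {S : Signature} {s : ℕ} {A A' : Finset ℕ} {I I' : Multiset Item}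

/-! ### States that represent a configuration -/

theorem LocStar.ret_eq {v e : Expr S} (h : LocStar (ret v) e) : e = ret v := by
  rcases Relation.ReflTransGen.cases_head h with h | ⟨e', h, -⟩
  · exact h.symm
  · cases h

theorem Sim.name {c c' : Comp S} (h : Sim c c') : c.name = c'.name := by
  cases h <;> rfl

theorem Sim.isMain {c c' : Comp S} (h : Sim c c') : c.isMain ↔ c'.isMain := by
  cases h <;> rfl

theorem Sim.ret {v : Expr S} {c : Comp S} (h : Sim (.thread true (ret v)) c) :
    c = .thread true (ret v) := by
  cases h with
  | refl => rfl
  | loc h hm => exact (hm rfl v h.ret_eq).elim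

theorem Sim.head {m : Bool} {e : Expr S} {c : Comp S} (h : Sim (.thread m e) c) :
    c = .thread m e ∨ ∃ e', act e = .loc e' ∧ Sim (.thread m e') c := by
  cases h with
  | refl => exact .inl rfl
  | loc h hm =>
    rcases Relation.ReflTransGen.cases_head h with rfl | ⟨e', h, h'⟩
    · exact .inl rfl
    · exact .inr ⟨e', h, .loc h' hm⟩

theorem Sim.cell {c c' : Comp S} (h : Sim c c') (hc : c.name ≠ none) : c' = c := by
  cases h with
  | refl => rfl
  | loc => exact (hc rfl).elim

theorem Sim.rel_refl (L : Multiset (Comp S)) : Multiset.Rel Sim L L :=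
  Multiset.rel_refl_of_refl_on fun c _ => .refl c

instance : IsTrans (Comp S) Sim where
  trans a b c h h' := by
    cases h with
    | refl => exact h'
    | loc h hm =>
      cases h' with
      | refl => exact .loc h hm
      | loc h' hm' => exact .loc (h.trans h') hm'

theorem Sim.rel_names {L L' : Multiset (Comp S)} (h : Multiset.Rel Sim L L') :
    names L = names L' := by
  induction h with
  | zero => rfl
  | cons h _ ih =>
    rw [← Multiset.singleton_add, ← Multiset.singleton_add, names_add, names_add, names_singleton,
      names_singleton, h.name, ih]

theorem Sim.rel_countP {L L' : Multiset (Comp S)} (h : Multiset.Rel Sim L L') :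
    L.countP Comp.isMain = L'.countP Comp.isMain := by
  induction h with
  | zero => rfl
  | cons h _ ih => simp only [Multiset.countP_cons, h.isMain, ih]

/-- The components of a well-formed process that is not successful. -/
structure Live (L : Multiset (Comp S)) : Prop where
  nodup : (names L).Nodup
  main : L.countP Comp.isMain ≤ 1
  ret : ∀ v, .thread true (ret v) ∉ L

theorem Live.of_rel {L L' : Multiset (Comp S)} (h : Multiset.Rel Sim L L') (hL : Live L') :
    Live L := by
  refine ⟨Sim.rel_names h ▸ hL.nodup, (Sim.rel_countP h).trans_le hL.main, fun v hv => ?_⟩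
  obtain ⟨c, hc, hs⟩ := Multiset.exists_mem_of_rel_of_mem h hv
  exact hL.ret v (hs.ret ▸ hc)

theorem Live.wellFormed {L : Multiset (Comp S)} (hL : Live L) {Q : CH.Proc S} {ρ : ℕ → ℕ}
    (h : Q.Open ρ A L) : Q.WellFormed :=
  h.wellFormed hL.nodup hL.main

theorem Live.not_successful {L : Multiset (Comp S)} (hL : Live L) {Q : CH.Proc S} {ρ : ℕ → ℕ}
    (h : Q.Open ρ A L) : ¬ Successful Q := fun hs =>
  let ⟨e, he⟩ := hs.ret_mem h
  hL.ret e he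

theorem Live.gStep {M N N' : Multiset (Comp S)} {B : Finset ℕ} (hL : Live (M + N))
    (hN : GStep N B N') {Q : CH.Proc S} {ρ : ℕ → ℕ} (h : Q.Open ρ A (M + N)) (hρ : EnvOK ρ A)
    (hB : Disjoint A B) : ∃ Q', Step Q Q' ∧ Q'.Open ρ (A ∪ B) (M + N') :=
  hN.step h hρ hB (hL.wellFormed h) (hL.not_successful h)

theorem Sim.steps {c c' : Comp S} (h : Sim c c') {M : Multiset (Comp S)} (hL : Live (M + {c'}))
    {Q : CH.Proc S} {ρ : ℕ → ℕ} (hQ : Q.Open ρ A (M + {c})) (hρ : EnvOK ρ A) :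
    ∃ Q', Relation.ReflTransGen Step Q Q' ∧ Q'.Open ρ A (M + {c'}) := by
  cases h with
  | refl => exact ⟨Q, .refl, hQ⟩
  | @loc m e e' h hm =>
    induction h using Relation.ReflTransGen.head_induction_on generalizing Q with
    | refl => exact ⟨Q, .refl, hQ⟩
    | head h h' ih =>
      have hL' : Live (M + {.thread m _}) := hL.of_rel
        ((Sim.rel_refl M).add (Multiset.rel_cons_left.2 ⟨_, 0, .loc (.head h h') hm, .zero, rfl⟩))
      obtain ⟨Q₁, h1, h2⟩ := hL'.gStep (.loc h) hQ hρ (Finset.disjoint_empty_right A)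
      rw [Finset.union_empty] at h2
      obtain ⟨Q₂, h3, h4⟩ := ih h2
      exact ⟨Q₂, .head h1 h3, h4⟩

/-- The local steps that separate a state from the components that it represents can be made. -/
theorem Sim.rel_steps {L L' : Multiset (Comp S)} (h : Multiset.Rel Sim L L')
    {M : Multiset (Comp S)} (hL : Live (M + L')) {Q : CH.Proc S} {ρ : ℕ → ℕ}
    (hQ : Q.Open ρ A (M + L)) (hρ : EnvOK ρ A) :
    ∃ Q', Relation.ReflTransGen Step Q Q' ∧ Q'.Open ρ A (M + L') := by
  induction h generalizing M Q with
  | zero => exact ⟨Q, .refl, hQ⟩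
  | @cons c c' L L' h hr ih =>
    rw [← Multiset.singleton_add, ← add_assoc] at hL hQ
    obtain ⟨Q₁, h1, h2⟩ := ih (M := M + {c})
      (hL.of_rel (((Sim.rel_refl M).add
        (Multiset.rel_cons_left.2 ⟨c', 0, h, .zero, rfl⟩)).add (Sim.rel_refl L'))) hQ
    rw [add_right_comm] at h2 hL
    obtain ⟨Q₂, h3, h4⟩ := h.steps hL h2 hρ
    refine ⟨Q₂, h1.trans h3, ?_⟩
    rwa [← Multiset.singleton_add, ← add_assoc, add_right_comm]

/-- The state `Q` with the restricted names `A` represents the items `I`, up to local steps. -/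
structure Conf (S : Signature) (s : ℕ) (Q : CH.Proc S) (A : Finset ℕ) (I : Multiset Item) :
    Prop where
  opened : ∃ L, Q.Open free A L ∧ Multiset.Rel Sim L (allComps S s I)
  good : Good S s A I
  env : EnvOK free A

theorem countP_allComps (S : Signature) (s : ℕ) (I : Multiset Item) :
    (allComps S s I).countP Comp.isMain = I.countP (fun i => i.isMain) := by
  induction I using Multiset.induction_on with
  | empty => rfl
  | cons i I ih =>
    rw [allComps_cons, Multiset.countP_add, ih, Multiset.countP_cons, add_comm]
    congr 1
    cases i <;>
      simp only [Item.comps, Item.isMain, Multiset.countP_add, ← Multiset.cons_zero,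
        Multiset.countP_cons, Multiset.countP_zero] <;>
      simp [Comp.isMain]

theorem Good.live (h : Good S s A I) (hI : .success ∉ I) : Live (allComps S s I) := by
  refine ⟨h.nodup, (countP_allComps S s I).trans_le h.main.le, fun v hv => ?_⟩
  obtain ⟨i, hi, hv⟩ := mem_allComps.1 hv
  cases i <;> simp [Item.comps] at hv
  exact hI hi

variable {Q : CH.Proc S}

theorem Conf.wellFormed (h : Conf S s Q A I) : Q.WellFormed := by
  obtain ⟨L, hQ, hL⟩ := h.opened
  refine hQ.wellFormed ?_ ?_
  · rw [Sim.rel_names hL]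
    exact h.good.nodup
  · rw [Sim.rel_countP hL, countP_allComps, h.good.main]

theorem Conf.not_successful (h : Conf S s Q A I) (hI : .success ∉ I) : ¬ Successful Q := by
  obtain ⟨L, hQ, hL⟩ := h.opened
  exact ((h.good.live hI).of_rel hL).not_successful hQ

theorem Conf.successful (h : Conf S s Q A I) (hI : .success ∈ I) : Successful Q := by
  obtain ⟨L, hQ, hL⟩ := h.opened
  have h1 : Comp.thread true (ret unit) ∈ allComps S s I :=
    mem_allComps.2 ⟨_, hI, by simp [Item.comps]⟩
  obtain ⟨c, hc, hs⟩ := Multiset.exists_mem_of_rel_of_mem (Multiset.rel_flip.2 hL) h1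
  refine hQ.successful h.wellFormed (e := unit) ?_
  cases hs with
  | refl => exact hc
  | loc _ hm => exact (hm rfl _ rfl).elim

theorem Implements.rel {N N' : Multiset Item} {L L' : Multiset (Comp S)}
    (h : Implements s N N' L L') :
    ∃ R, allComps S s N = L + R ∧ Multiset.Rel Sim (L' + R) (allComps S s N') := by
  obtain ⟨R, K, c, c', h1, h2, h3, h4⟩ := h
  refine ⟨R, h1, ?_⟩
  rw [h2, h3]
  exact Multiset.Rel.add (Multiset.rel_cons_left.2 ⟨c', 0, h4, .zero, rfl⟩) (Sim.rel_refl K)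

/-- The moves of a configuration are reductions of the states that represent it. -/
theorem Conf.forward {r : Bool} (h : Conf S s Q A I) (hI : .success ∉ I) (hm : MStep r A I A' I') :
    ∃ Q', Relation.ReflTransGen Step Q Q' ∧ Conf S s Q' A' I' := by
  have hg := h.good.step hm
  obtain ⟨L, hQ, hL⟩ := h.opened
  have hl := h.good.live hI
  obtain ⟨Q₁, h1, h2⟩ := Sim.rel_steps hL (M := 0) (by rwa [zero_add]) (by rwa [zero_add]) h.env
  rw [zero_add] at h2
  obtain ⟨N, B, N', J, rfl, rfl, rfl, hm, hB⟩ := hm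
  obtain ⟨L₁, L₁', h3, h4⟩ := hm.implements S s
  obtain ⟨R, h5, h6⟩ := h4.rel
  have h7 : allComps S s (N + J) = R + allComps S s J + L₁ := by
    rw [allComps_add, h5]
    abel
  rw [h7] at h2 hl
  have hd : Disjoint A B := Finset.disjoint_right.2 fun b hb => (hB b hb).1
  obtain ⟨Q₂, h8, h9⟩ := hl.gStep h3 h2 h.env hd
  refine ⟨Q₂, h1.tail h8, ⟨_, h9, ?_⟩, hg, h.env.1, fun a ha i hi => ?_⟩
  · rw [allComps_add, show R + allComps S s J + L₁' = L₁' + R + allComps S s J by abel]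
    exact h6.add (Sim.rel_refl _)
  · rcases Finset.mem_union.1 ha with ha | ha
    · exact h.env.2 a ha i hi
    · exact (hB a ha).2 ⟨i, hi⟩

/-! ### The reductions of a configuration -/

section inversion
variable {N N' : Multiset (Comp S)} {B : Finset ℕ} {m : Bool} {e : Expr S}

theorem _root_.CH.GStep.inv_look {x : ℕ} {K : Expr S → Expr S} (h : GStep N B N')
    (ht : .thread m e ∈ N) (ha : act e = .look x K) :
    ∃ d, N = {.thread m e, .share x d} ∧ B = ∅ ∧ N' = {.thread m (K d), .share x d} := by
  cases h <;> simp at ht <;> obtain ⟨rfl, rfl⟩ := ht <;> rename_i h <;> rw [ha] at h <;> cases h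
  exact ⟨_, rfl, rfl, rfl⟩

theorem _root_.CH.GStep.inv_new {v : Expr S} {K : Expr S → Expr S} (h : GStep N B N')
    (ht : .thread m e ∈ N) (ha : act e = .new v K) :
    ∃ a, N = {.thread m e} ∧ B = {a} ∧ N' = {.thread m (K (ret (var a))), .mvar a v} := by
  cases h <;> simp at ht <;> obtain ⟨rfl, rfl⟩ := ht <;> rename_i h <;> rw [ha] at h <;> cases h
  exact ⟨_, rfl, rfl, rfl⟩

theorem _root_.CH.GStep.inv_fork {d : Expr S} {K : Expr S → Expr S} (h : GStep N B N')
    (ht : .thread m e ∈ N) (ha : act e = .fork d K) :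
    N = {.thread m e} ∧ B = ∅ ∧ N' = {.thread m (K (ret unit)), .thread false d} := by
  cases h <;> simp at ht <;> obtain ⟨rfl, rfl⟩ := ht <;> rename_i h <;> rw [ha] at h <;> cases h
  exact ⟨rfl, rfl, rfl⟩

theorem _root_.CH.GStep.inv_letrec {b d : Expr S} {K : Expr S → Expr S} (h : GStep N B N')
    (ht : .thread m e ∈ N) (ha : act e = .letrec 1 (fun _ => b) d K) :
    ∃ x, N = {.thread m e} ∧ B = {x} ∧
      N' = .thread m (K (d.inst fun _ : Fin 1 => var x)) ::ₘ
        shares (fun _ : Fin 1 => x) fun _ => b := by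
  cases h <;> simp at ht <;> obtain ⟨rfl, rfl⟩ := ht <;> rename_i h <;> rw [ha] at h <;> cases h
  rename_i a _
  have : a = fun _ => a 0 := funext fun i => congrArg a (Subsingleton.elim i 0)
  refine ⟨a 0, rfl, rfl, ?_⟩
  rw [this]

/-- A thread that takes the contents of `x` needs a cell named `x`. -/
theorem _root_.CH.GStep.inv_take {x : ℕ} {K : Expr S → Expr S} (h : GStep N B N')
    (ht : .thread m e ∈ N) (ha : act e = .take x K) :
    (∃ d, .share x d ∈ N) ∨ ∃ v, N = {.thread m e, .mvar x v} ∧ B = ∅ ∧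
      N' = {.thread m (K (ret v)), .empty x} := by
  cases h <;> simp at ht <;> obtain ⟨rfl, rfl⟩ := ht <;> rename_i h <;> rw [ha] at h <;> cases h
  · exact .inl ⟨_, Multiset.mem_cons_of_mem (Multiset.mem_singleton_self _)⟩
  · exact .inr ⟨_, rfl, rfl, rfl⟩

/-- A thread that fills `x` needs a cell named `x`. -/
theorem _root_.CH.GStep.inv_put {x : ℕ} {v : Expr S} {K : Expr S → Expr S} (h : GStep N B N')
    (ht : .thread m e ∈ N) (ha : act e = .put x v K) :
    (∃ d, .share x d ∈ N) ∨ N = {.thread m e, .empty x} ∧ B = ∅ ∧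
      N' = {.thread m (K (ret unit)), .mvar x v} := by
  cases h <;> simp at ht <;> obtain ⟨rfl, rfl⟩ := ht <;> rename_i h <;> rw [ha] at h <;> cases h
  · exact .inl ⟨_, Multiset.mem_cons_of_mem (Multiset.mem_singleton_self _)⟩
  · exact .inr ⟨rfl, rfl, rfl⟩

theorem _root_.CH.GStep.inv_stuck (h : GStep N B N') (ht : .thread m e ∈ N) : act e ≠ .stuck := by
  intro ha
  cases h <;> simp at ht <;> obtain ⟨rfl, rfl⟩ := ht <;> rename_i h <;> rw [ha] at h <;> cases h

/-- If the components `N` represent `L` up to local steps, then a reduction of `N` is one of `L`, or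
it is one of these local steps. -/
theorem _root_.CH.GStep.of_rel (h : GStep N B N') {L : Multiset (Comp S)}
    (hr : Multiset.Rel Sim N L) :
    L = N ∨ B = ∅ ∧ Multiset.Rel Sim N' L := by
  have key : ∀ {m e c}, act e ≠ .stuck → (∀ e', act e ≠ .loc e') → Sim (S := S) (.thread m e) c →
      c = .thread m e := fun h1 h2 h3 => h3.head.resolve_right fun ⟨e', h4, _⟩ => h2 e' h4
  cases h with
  | loc h =>
    obtain ⟨c, L, hc, hr', rfl⟩ := Multiset.rel_cons_left.1 hr
    rw [Multiset.rel_zero_left] at hr'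
    subst hr'
    rcases hc.head with rfl | ⟨e', h', hc⟩
    · exact .inl rfl
    · rw [h] at h'
      cases h'
      exact .inr ⟨rfl, Multiset.rel_cons_left.2 ⟨_, _, hc, .zero, rfl⟩⟩
  | letrec | new | fork =>
    rename_i h
    obtain ⟨c, L, hc, hr', rfl⟩ := Multiset.rel_cons_left.1 hr
    rw [Multiset.rel_zero_left] at hr'
    rw [hr', key (by simp [h]) (by simp [h]) hc]
    exact .inl rfl
  | _ =>
    rename_i h
    obtain ⟨c, L, hc, hr', rfl⟩ := Multiset.rel_cons_left.1 hr
    obtain ⟨d, L, hd, hr'', rfl⟩ := Multiset.rel_cons_left.1 hr'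
    rw [Multiset.rel_zero_left] at hr''
    rw [hr'', key (by simp [h]) (by simp [h]) hc, hd.cell (by simp [Comp.name])]
    exact .inl rfl

theorem _root_.CH.GStep.thread (h : GStep N B N') : ∃ m e, .thread m e ∈ N := by
  cases h <;> exact ⟨_, _, Multiset.mem_cons_self _ _⟩

end inversion

/-- The items `I` have a move whose implementation replaces the components `N` by `N'`. -/
def Moves (s : ℕ) (I : Multiset Item) (N : Multiset (Comp S)) (B : Finset ℕ)
    (N' : Multiset (Comp S)) : Prop :=
  ∃ r N₀ N₀' J, I = N₀ + J ∧ Move r N₀ B N₀' ∧ Implements s N₀ N₀' N N'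

section moves
variable {N N' : Multiset (Comp S)} {B : Finset ℕ}

theorem Moves.one {r : Bool} {i : Item} {N₀' : Multiset Item} (hi : i ∈ I) (h : Move r {i} B N₀')
    (h' : Implements s {i} N₀' N N') : Moves s I N B N' := by
  obtain ⟨J, rfl⟩ := Multiset.exists_cons_of_mem hi
  exact ⟨r, _, _, J, (Multiset.singleton_add i J).symm, h, h'⟩

theorem Moves.two {r : Bool} {i j : Item} {N₀' : Multiset Item} (hi : i ∈ I) (hj : j ∈ I)
    (hij : i ≠ j) (h : Move r ({i} + {j}) B N₀') (h' : Implements s ({i} + {j}) N₀' N N') :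
    Moves s I N B N' := by
  obtain ⟨J, rfl⟩ := Multiset.exists_cons_of_mem hi
  obtain ⟨J, rfl⟩ := Multiset.exists_cons_of_mem ((Multiset.mem_cons.1 hj).resolve_left hij.symm)
  refine ⟨r, _, _, J, ?_, h, h'⟩
  rw [add_assoc, Multiset.singleton_add, Multiset.singleton_add]

/-- A reduction of the components of a configuration implements a move. The item that contains the
active thread determines its action, and the invariants determine the other component that is
involved. -/
theorem Good.moves (hg : Good S s A I) (hI : .success ∉ I) (h : GStep N B N')
    (hN : N ≤ allComps S s I) : Moves s I N B N' := by
  -- A component is determined by its name.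
  have uniq : ∀ {i c c' x}, i ∈ I → c ∈ i.comps S s → c.name = some x → c' ∈ N →
      c'.name = some x → c' = c := fun hi hc hx hc' hx' =>
    cell_unique hg.nodup (Multiset.mem_of_le hN hc') (mem_allComps.2 ⟨_, hi, hc⟩) hx' hx
  -- Every name that a `π`-process uses is an existing channel.
  have look : ∀ {i x}, i ∈ I → x ∈ i.proc.FN → ∃ j ∈ I, ∃ m, j.Holds x m := by
    intro i x hi hx
    obtain ⟨j, hj, hx⟩ := mem_allChans.1 (hg.fn i hi hx)
    exact ⟨j, hj, j.mem_chans hx⟩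
  obtain ⟨m, e, ht⟩ := h.thread
  obtain ⟨i, hi, he⟩ := mem_allComps.1 (Multiset.mem_of_le hN ht)
  cases i with
  | chan x m => simp [Item.comps] at he
  | com x m y c P =>
    simp [Item.comps] at he
    obtain ⟨rfl, rfl⟩ := he
    obtain ⟨K, hK, -⟩ := act_put (S := S) c unit (tRun S s P)
    have hc : Comp.mvar c unit ∈ (Item.com x m y c P).comps S s := by simp [Item.comps]
    rcases h.inv_put ht hK with ⟨d, hd⟩ | ⟨rfl, -⟩
    · cases uniq hi hc rfl hd rfl
    · cases uniq hi hc rfl (c' := .empty c) (by simp) rfl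
  | run P =>
    simp [Item.comps] at he
    obtain ⟨rfl, rfl⟩ := he
    cases P with
    | nu P =>
      obtain ⟨K, hK, hl⟩ := act_run_nu (S := S) s P
      obtain ⟨a, rfl, rfl, rfl⟩ := h.inv_new ht hK
      exact .one hi (.nu₁ a P) (implements_nu₁ (hl a))
    | out x y P =>
      obtain ⟨K, hK, hl⟩ := act_run_out (S := S) s x y P
      obtain ⟨a, rfl, rfl, rfl⟩ := h.inv_new ht hK
      exact .one hi (.out a x y P) (implements_out (hl a))
    | inp x P =>
      obtain ⟨K, hK, hl⟩ := act_run_inp (S := S) s x P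
      obtain ⟨d, rfl, rfl, rfl⟩ := h.inv_look ht hK
      obtain ⟨j, hj, m, hx⟩ := look (x := x) hi (by simp [Item.proc, PiStop.Proc.FN])
      cases uniq hj hx.share_mem rfl (c' := .share x d) (by simp) rfl
      exact .two hi hj (by rintro rfl; cases hx) (.lookRecv x P hx) (implements_lookRecv hx (hl m))
    | bang P =>
      obtain ⟨b, hK, hb⟩ := act_run_bang (S := S) s P
      obtain ⟨f, rfl, rfl, rfl⟩ := h.inv_letrec ht hK
      rw [shares_one, hb]
      exact .one hi (.bang f P) implements_bang
    | par P Q =>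
      obtain ⟨K, hK, hl⟩ := act_run_par (S := S) s P Q
      obtain ⟨rfl, rfl, rfl⟩ := h.inv_fork ht hK
      exact .one hi (.par P Q) (implements_par hl)
    | zero => exact (h.inv_stuck ht rfl).elim
    | Stop =>
      have hm : 0 < I.countP fun i => i.isMain := by rw [hg.main]; exact zero_lt_one
      obtain ⟨j, hj, hm⟩ := Multiset.countP_pos.1 hm
      have hK : act (tRun S s .Stop) = .take s id := rfl
      cases j <;> simp [Item.isMain] at hm
      · have hc : Comp.mvar s unit ∈ Item.main.comps S s := by simp [Item.comps]
        rcases h.inv_take ht hK with ⟨d, hd⟩ | ⟨v, rfl, rfl, rfl⟩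
        · cases uniq hj hc rfl hd rfl
        · cases uniq hj hc rfl (c' := .mvar s v) (by simp) rfl
          exact .two hi hj (by simp) .halt implements_halt
      · have hc : Comp.empty s ∈ Item.stopped.comps S s := by simp [Item.comps]
        rcases h.inv_take ht hK with ⟨d, hd⟩ | ⟨v, rfl, -⟩
        · cases uniq hj hc rfl hd rfl
        · cases uniq hj hc rfl (c' := .mvar s v) (by simp) rfl
      · exact (hI hj).elim
  | send₁ c x y P =>
    simp [Item.comps] at he
    obtain ⟨rfl, rfl⟩ := he
    obtain ⟨K, hK, hl⟩ := act_send_look (S := S) s c x y P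
    obtain ⟨d, rfl, rfl, rfl⟩ := h.inv_look ht hK
    obtain ⟨j, hj, m, hx⟩ := look (x := x) hi (by simp [Item.proc, PiStop.Proc.FN])
    cases uniq hj hx.share_mem rfl (c' := .share x d) (by simp) rfl
    exact .two hi hj (by rintro rfl; cases hx) (.lookSend c x y P hx)
      (implements_lookSend hx (hl m))
  | send₂ c m x y P =>
    simp [Item.comps] at he
    obtain ⟨rfl, rfl⟩ := he
    obtain ⟨K, hK, hl⟩ := act_put (S := S) m (pair (var y) (var c)) (tAck S s c P)
    obtain ⟨j, hj, hx⟩ := hg.uses _ hi x m (.send₂ c m x y P)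
    rcases h.inv_put ht hK with ⟨d, hd⟩ | ⟨rfl, rfl, rfl⟩
    · cases hx with
      | chan => cases uniq hj (c := .empty m) (by simp [Item.comps]) rfl hd rfl
      | com _ _ y' c' P' =>
        cases uniq hj (c := .mvar m (pair (var y') (var c'))) (by simp [Item.comps]) rfl hd rfl
    · cases hx with
      | chan => exact .two hi hj (by simp) (.put c x y P m) (implements_put hl)
      | com _ _ y' c' P' =>
        cases uniq hj (c := .mvar m (pair (var y') (var c'))) (by simp [Item.comps]) rfl
          (c' := .empty m) (by simp) rfl
  | recv m x P =>
    simp [Item.comps] at he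
    obtain ⟨rfl, rfl⟩ := he
    obtain ⟨K, hK, hl⟩ := act_recv (S := S) s m P
    obtain ⟨j, hj, hx⟩ := hg.uses _ hi x m (.recv m x P)
    rcases h.inv_take ht hK with ⟨d, hd⟩ | ⟨v, rfl, rfl, rfl⟩
    · cases hx with
      | chan => cases uniq hj (c := .empty m) (by simp [Item.comps]) rfl hd rfl
      | com _ _ y' c' P' =>
        cases uniq hj (c := .mvar m (pair (var y') (var c'))) (by simp [Item.comps]) rfl hd rfl
    · cases hx with
      | chan =>
        cases uniq hj (c := .empty m) (by simp [Item.comps]) rfl (c' := .mvar m v) (by simp) rfl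
      | com _ _ y' c' P' =>
        cases uniq hj (c := .mvar m (pair (var y') (var c'))) (by simp [Item.comps]) rfl
          (c' := .mvar m v) (by simp) rfl
        exact .two hi hj (by simp) (.take x m y' c' P P') (implements_take (hl y' c'))
  | sync₁ c P Q =>
    simp [Item.comps] at he
    have hc : Comp.mvar c unit ∈ (Item.sync₁ c P Q).comps S s := by simp [Item.comps]
    rcases he with ⟨rfl, rfl⟩ | ⟨rfl, rfl⟩
    · obtain ⟨K, hK, -⟩ := act_put (S := S) c unit (tRun S s P)
      rcases h.inv_put ht hK with ⟨d, hd⟩ | ⟨rfl, -⟩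
      · cases uniq hi hc rfl hd rfl
      · cases uniq hi hc rfl (c' := .empty c) (by simp) rfl
    · obtain ⟨K, hK, hl⟩ := act_take (S := S) c (tRun S s Q)
      rcases h.inv_take ht hK with ⟨d, hd⟩ | ⟨v, rfl, rfl, rfl⟩
      · cases uniq hi hc rfl hd rfl
      · cases uniq hi hc rfl (c' := .mvar c v) (by simp) rfl
        exact .one hi (.ack₁ c P Q) (implements_ack₁ (hl _))
  | sync₂ c P =>
    simp [Item.comps] at he
    obtain ⟨rfl, rfl⟩ := he
    have hc : Comp.empty c ∈ (Item.sync₂ c P).comps S s := by simp [Item.comps]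
    obtain ⟨K, hK, hl⟩ := act_put (S := S) c unit (tRun S s P)
    rcases h.inv_put ht hK with ⟨d, hd⟩ | ⟨rfl, rfl, rfl⟩
    · cases uniq hi hc rfl hd rfl
    · exact .one hi (.ack₂ c P) (implements_ack₂ hl)
  | dead c => simp [Item.comps] at he
  | nu₁ m P =>
    simp [Item.comps] at he
    obtain ⟨rfl, rfl⟩ := he
    have hc : Comp.mvar m bot ∈ (Item.nu₁ m P).comps S s := by simp [Item.comps]
    obtain ⟨K, hK, hl⟩ := act_take (S := S) m (tBind S s m P)
    rcases h.inv_take ht hK with ⟨d, hd⟩ | ⟨v, rfl, rfl, rfl⟩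
    · cases uniq hi hc rfl hd rfl
    · cases uniq hi hc rfl (c' := .mvar m v) (by simp) rfl
      exact .one hi (.nu₂ m P) (implements_nu₂ (hl _))
  | nu₂ m P =>
    simp [Item.comps] at he
    obtain ⟨rfl, rfl⟩ := he
    obtain ⟨x, rfl, rfl, rfl⟩ := h.inv_letrec ht (act_bindChan (S := S) s m P)
    rw [id, nu₃_result]
    exact .one hi (.nu₃ m x P) implements_nu₃
  | bang₁ f P =>
    simp [Item.comps] at he
    obtain ⟨rfl, rfl⟩ := he
    have hc : Comp.share f (tSpawn S s f P) ∈ (Item.bang₁ f P).comps S s := by simp [Item.comps]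
    obtain ⟨d, rfl, rfl, rfl⟩ := h.inv_look ht (x := f) (K := id) rfl
    cases uniq hi hc rfl (c' := .share f d) (by simp) rfl
    exact .one hi (.bang₁ f P) implements_bang₁
  | bang₂ f P =>
    simp [Item.comps] at he
    obtain ⟨rfl, rfl⟩ := he
    obtain ⟨K, hK, hl⟩ := act_spawn (S := S) s f P
    obtain ⟨rfl, rfl, rfl⟩ := h.inv_fork ht hK
    exact .one hi (.bang₂ f P) (implements_bang₂ hl)
  | main =>
    simp [Item.comps] at he
    obtain ⟨rfl, rfl⟩ := he
    have hc : Comp.mvar s unit ∈ Item.main.comps S s := by simp [Item.comps]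
    rcases h.inv_put ht (x := s) (v := unit) (K := id) rfl with ⟨d, hd⟩ | ⟨rfl, -⟩
    · cases uniq hi hc rfl hd rfl
    · cases uniq hi hc rfl (c' := .empty s) (by simp) rfl
  | stopped =>
    simp [Item.comps] at he
    have hc : Comp.empty s ∈ Item.stopped.comps S s := by simp [Item.comps]
    rcases he with ⟨rfl, rfl⟩ | ⟨rfl, rfl⟩
    · rcases h.inv_put ht (x := s) (v := unit) (K := id) rfl with ⟨d, hd⟩ | ⟨rfl, rfl, rfl⟩
      · cases uniq hi hc rfl hd rfl
      · exact .one hi .success implements_success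
    · exact (h.inv_stuck ht rfl).elim
  | success => exact (hI hi).elim

end moves

/-- Every reduction of a state that represents a configuration is a local step or comes from a move
of the configuration. -/
theorem Conf.backward (h : Conf S s Q A I) {Q' : CH.Proc S} (hQ : Step Q Q') :
    Conf S s Q' A I ∨ ∃ r A' I', MStep r A I A' I' ∧ Conf S s Q' A' I' := by
  have hI : .success ∉ I := fun hI => hQ.2.1 (h.successful hI)
  obtain ⟨L, hL, hr⟩ := h.opened
  obtain ⟨M, N, B, N', rfl, hN, hQ', hBA, hBW⟩ := hQ.gStep hL coInf_range_free
  obtain ⟨L₁, L₂, hr₁, hr₂, hc⟩ := Multiset.rel_add_left.1 hr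
  rcases hN.of_rel hr₂ with rfl | ⟨rfl, hr₂⟩
  · right
    obtain ⟨r, N₀, N₀', J, rfl, hm, hi⟩ := h.good.moves hI hN (hc ▸ Multiset.le_add_left ..)
    have hst : MStep r A (N₀ + J) (A ∪ B) (N₀' + J) :=
      ⟨_, B, _, J, rfl, rfl, rfl, hm, fun b hb => ⟨hBA b hb, hBW b hb⟩⟩
    obtain ⟨R, h1, h2⟩ := hi.rel
    rw [allComps_add, h1, add_assoc, add_comm L₁] at hc
    obtain rfl := add_left_cancel hc
    refine ⟨r, _, _, hst, ⟨_, hQ', ?_⟩, h.good.step hst, h.env.1, fun a ha i hi => ?_⟩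
    · have h3 := (h2.add (Sim.rel_refl (allComps S s J)))
      rw [← allComps_add, add_assoc] at h3
      rw [add_comm]
      exact Multiset.Rel.trans _ ((Sim.rel_refl _).add hr₁) h3
    · rcases Finset.mem_union.1 ha with ha | ha
      · exact h.env.2 a ha i hi
      · exact hBW a ha ⟨i, hi⟩
  · left
    rw [Finset.union_empty] at hQ'
    exact ⟨⟨_, hQ', hc ▸ hr₁.add hr₂⟩, h.good, h.env⟩

end Translation

namespace Translation
variable {S : CH.Signature} {s : ℕ} {A A' A₁ : Finset ℕ} {I I' I₁ J : Multiset Item}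

open PiStop (cls Cls StepQ SuccQ MayQ ShouldQ Exp Pre)

/-! ### Exposing prefixes by moves -/

/-- The number of senders that have filled the MVar of a channel. -/
def numCom (I : Multiset Item) : ℕ := I.countP fun i => i.isCom

@[simp] theorem numCom_add (I J : Multiset Item) : numCom (I + J) = numCom I + numCom J :=
  Multiset.countP_add ..

@[simp] theorem numCom_singleton (i : Item) : numCom {i} = if i.isCom then 1 else 0 := by
  rw [numCom, ← Multiset.cons_zero, Multiset.countP_cons]
  simp

@[simp] theorem numCom_cons (i : Item) (I : Multiset Item) :
    numCom (i ::ₘ I) = (if i.isCom then 1 else 0) + numCom I := by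
  rw [← Multiset.singleton_add, numCom_add, numCom_singleton]

/-- A configuration: the restricted names, and the items. -/
abbrev Config := Finset ℕ × Multiset Item

/-- A move that is not a reduction of the `π`-process and does not change the number of senders that
have filled the MVar of a channel. -/
def QStep (C C' : Config) : Prop := MStep false C.1 C.2 C'.1 C'.2 ∧ numCom C'.2 = numCom C.2

/-- A move of a configuration. -/
def AStep (C C' : Config) : Prop := ∃ r, MStep r C.1 C.2 C'.1 C'.2

/-- Any number of `QStep`s. -/
abbrev QSteps := Relation.ReflTransGen QStep

/-- Any number of moves. -/
abbrev ASteps := Relation.ReflTransGen AStep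

theorem QSteps.aSteps {C C' : Config} (h : QSteps C C') : ASteps C C' :=
  Relation.ReflTransGen.mono (fun _ _ h => ⟨false, h.1⟩) _ _ h

theorem Good.aSteps {C C' : Config} (hC : Good S s C.1 C.2) (h : ASteps C C') :
    Good S s C'.1 C'.2 := by
  induction h with
  | refl => exact hC
  | tail _ h ih => exact ih.step h.choose_spec

theorem QSteps.decode_eq {C C' : Config} (hC : Good S s C.1 C.2) (h : QSteps C C') :
    decode C'.2 = decode C.2 ∧ numCom C'.2 = numCom C.2 := by
  induction h with
  | refl => exact ⟨rfl, rfl⟩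
  | tail h h' ih =>
    exact ⟨(decode_eq_of_mStep (hC.aSteps (QSteps.aSteps h)) h'.1).trans ih.1, h'.2.trans ih.2⟩

/-- The names of `B` can still be created. -/
def Avail (B A : Finset ℕ) : Prop := ∀ b ∈ B, b ∉ A ∧ b ∉ Set.range free

theorem Avail.singleton {a : ℕ} (h : a ∉ A) (h' : a ∉ Set.range free) : Avail {a} A := by
  intro b hb
  rw [Finset.mem_singleton.1 hb]
  exact ⟨h, h'⟩

theorem Avail.union_singleton {B : Finset ℕ} {a : ℕ} (h : Avail B A) (ha : a ∉ B) :
    Avail B (A ∪ {a}) := by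
  intro b hb
  refine ⟨?_, (h b hb).2⟩
  rw [Finset.mem_union, Finset.mem_singleton, not_or]
  exact ⟨(h b hb).1, by rintro rfl; exact ha hb⟩

theorem QStep.of_move {N N' : Multiset Item} {B : Finset ℕ} (h : Move false N B N')
    (hB : Avail B A) (hc : numCom N' = numCom N) (K : Multiset Item) :
    QStep (A, N + K) (A ∪ B, N' + K) :=
  ⟨⟨N, B, N', K, rfl, rfl, rfl, h, hB⟩, by simp [hc]⟩

theorem QStep.of_move_empty {N N' : Multiset Item} (h : Move false N ∅ N')
    (hc : numCom N' = numCom N) (K : Multiset Item) : QStep (A, N + K) (A, N' + K) := by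
  simpa using QStep.of_move (A := A) h (by simp [Avail]) hc K

theorem QStep.frame (h : QStep (A, I) (A', I')) (K : Multiset Item) :
    QStep (A, I + K) (A', I' + K) := by
  obtain ⟨⟨N, B, N', J, h1, h2, h3, hm, hB⟩, hc⟩ := h
  simp only at h1 h2 h3 hc
  refine ⟨⟨N, B, N', J + K, ?_, ?_, h3, hm, hB⟩, by simp [hc]⟩
  · simp only [h1, add_assoc]
  · simp only [h2, add_assoc]

theorem QSteps.frame {C C' : Config} (h : QSteps C C') (K : Multiset Item) :
    QSteps (C.1, C.2 + K) (C'.1, C'.2 + K) := by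
  induction h with
  | refl => exact .refl
  | tail _ h ih => exact ih.tail (QStep.frame h K)

/-- Items that offer a prefix to their environment. An acknowledged sender (`sync₂`) is excluded: it
has to release its MVar before it continues. -/
inductive Ready : Item → Pre → Prop
  | inp {i x P} (h : i.proc = .inp x P) (hi : ∀ c P, i ≠ .sync₂ c P) : Ready i (.inp x (cls P))
  | out {i x z P} (h : i.proc = .out x z P) (hi : ∀ c P, i ≠ .sync₂ c P) :
      Ready i (.out x z (cls P))
  | halt {i} (h : i.proc = .Stop) (hi : ∀ c P, i ≠ .sync₂ c P) : Ready i .halt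

/-- In a state with the restricted names `A`, the items `I` can be driven to expose the prefixes `α`
while creating the channels `B`, and leave the residual `r`. The other names that are created are
not in `Z`, so that the names in `Z` remain available for channels that are created later. -/
def Drives (Z A : Finset ℕ) (I : Multiset Item) (B : Finset ℕ) (α : Multiset Pre) (r : Cls) :
    Prop :=
  ∃ A' E R, QSteps (A, I) (A', E + R) ∧ Multiset.Rel Ready E α ∧ body R = r ∧
    allChans (E + R) = allChans I ∪ B ∧ ∀ a ∈ A', a ∈ A ∨ a ∈ B ∨ a ∉ Z

section Drives
variable {Z B C : Finset ℕ} {α β : Multiset Pre} {r t : Cls}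

theorem Drives.rest (Z A : Finset ℕ) (I : Multiset Item) : Drives Z A I ∅ 0 (body I) :=
  ⟨A, 0, I, by rw [zero_add], .zero, rfl, by simp, fun a ha => .inl ha⟩

theorem Drives.ready {i : Item} {a : Pre} (h : Ready i a) : Drives Z A {i} ∅ {a} 0 :=
  ⟨A, {i}, 0, by rw [add_zero], Multiset.rel_cons_left.2 ⟨a, 0, h, .zero, rfl⟩, rfl, by simp,
    fun a ha => .inl ha⟩

theorem Drives.head (h : QSteps (A, I) (A₁, I₁)) (hc : allChans I₁ = allChans I ∪ B)
    (hA : ∀ a ∈ A₁, a ∈ A ∨ a ∈ B ∨ a ∉ Z) (h' : Drives Z A₁ I₁ C α r) :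
    Drives Z A I (B ∪ C) α r := by
  obtain ⟨A', E, R, h1, h2, h3, h4, h5⟩ := h'
  refine ⟨A', E, R, h.trans h1, h2, h3, by rw [h4, hc, Finset.union_assoc], fun a ha => ?_⟩
  rw [Finset.mem_union]
  rcases h5 a ha with h | h | h
  · rcases hA a h with h | h | h
    · exact .inl h
    · exact .inr (.inl (.inl h))
    · exact .inr (.inr h)
  · exact .inr (.inl (.inr h))
  · exact .inr (.inr h)

/-- Two groups of items can be driven one after the other. -/
theorem Drives.add (h : Drives Z A I B α r) (hd : Disjoint B C) (hC : C ⊆ Z)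
    (hA : ∀ c ∈ C, c ∉ A) (h' : ∀ A', (∀ c ∈ C, c ∉ A') → Drives Z A' J C β t) :
    Drives Z A (I + J) (B ∪ C) (α + β) (r + t) := by
  obtain ⟨A₁, E₁, R₁, h1, h2, rfl, h4, h5⟩ := h
  obtain ⟨A₂, E₂, R₂, k1, k2, rfl, k4, k5⟩ := h' A₁ fun c hc hc' => by
    rcases h5 c hc' with h | h | h
    · exact hA c hc h
    · exact Finset.disjoint_left.1 hd h hc
    · exact h (hC hc)
  refine ⟨A₂, E₁ + E₂, R₁ + R₂, ?_, h2.add k2, body_add _ _, ?_, fun a ha => ?_⟩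
  · have e1 := h1.frame J
    have e2 := QSteps.frame k1 (E₁ + R₁)
    rw [show E₁ + E₂ + (R₁ + R₂) = E₂ + R₂ + (E₁ + R₁) by abel]
    simp only [add_comm J] at e2
    exact e1.trans e2
  · simp only [allChans_add] at h4 k4 ⊢
    rw [Finset.union_union_union_comm, h4, k4, Finset.union_union_union_comm]
  · rw [Finset.mem_union]
    rcases k5 a ha with h | h | h
    · rcases h5 a h with h | h | h
      · exact .inl h
      · exact .inr (.inl (.inl h))
      · exact .inr (.inr h)
    · exact .inr (.inl (.inr h))
    · exact .inr (.inr h)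

end Drives

theorem exists_freshName (A Z : Finset ℕ) : ∃ a, a ∉ A ∧ a ∉ Z ∧ a ∉ Set.range free := by
  obtain ⟨a, ha⟩ := (coInf_range_free.union (A ∪ Z).finite_toSet).exists_notMem
  simp only [Set.mem_union, Finset.coe_union, not_or, Finset.mem_coe] at ha
  exact ⟨a, ha.2.1, ha.2.2, ha.1⟩

section Exp
variable {Z B : Finset ℕ} {α : Multiset Pre} {r : Cls}

theorem Drives.head_empty (h : QSteps (A, I) (A, I₁)) (hc : allChans I₁ = allChans I)
    (h' : Drives Z A I₁ B α r) : Drives Z A I B α r := by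
  simpa using Drives.head (B := ∅) h (by rw [hc, Finset.union_empty]) (fun a ha => .inl ha) h'

theorem Drives.add_rest (h : Drives Z A I B α r) (J : Multiset Item) :
    Drives Z A (I + J) B α (r + body J) := by
  simpa using h.add (C := ∅) (by simp) (by simp) (by simp) fun A' _ => Drives.rest Z A' J

/-- An acknowledged sender can release its MVar. -/
theorem Drives.of_not_sync₂ {Q : PiStop.Proc}
    (h : ∀ A i, i.proc = Q → (∀ c P, i ≠ .sync₂ c P) → Avail B A → Drives Z A {i} B α r) :
    ∀ A i, i.proc = Q → Avail B A → Drives Z A {i} B α r := by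
  intro A i hi hB
  by_cases hs : ∃ c P, i = .sync₂ c P
  · obtain ⟨c, P, rfl⟩ := hs
    have h1 := (h A (.run P) hi (by simp) hB).add_rest {.dead c}
    rw [body_singleton, Item.proc, Cls.cls_zero, add_zero] at h1
    exact h1.head_empty (.single (QStep.of_move_empty (.ack₂ c P) rfl 0)) rfl
  · push Not at hs
    exact h A i hi hs hB

/-- A process in a configuration can follow every exposure of prefixes: it executes parallel
compositions, restrictions and calls of replications until the prefixes are reached. -/
theorem _root_.PiStop.Exp.drives {P : PiStop.Proc} {ρ : ℕ → ℕ} (h : Exp false P ρ B α r)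
    (hBZ : B ⊆ Z) : ∀ A i, i.proc = P.rename ρ → Avail B A → Drives Z A {i} B α r := by
  induction h with
  | @leaf P ρ h =>
    intro A i hi _
    have := Drives.rest Z A {i}
    rwa [body_singleton, hi] at this
  | zero ρ =>
    intro A i hi _
    have := Drives.rest Z A {i}
    rwa [body_singleton, hi, PiStop.Proc.rename, Cls.cls_zero] at this
  | inp x P ρ => exact Drives.of_not_sync₂ fun A i hi hs _ => .ready (.inp hi hs)
  | out x z P ρ => exact Drives.of_not_sync₂ fun A i hi hs _ => .ready (.out hi hs)
  | halt ρ => exact Drives.of_not_sync₂ fun A i hi hs _ => .ready (.halt hi hs)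
  | @par P Q ρ B C α β r t hP hQ hd hB hC ih1 ih2 =>
    rw [Finset.union_subset_iff] at hBZ
    have key : ∀ A i j, i.proc = P.rename ρ → j.proc = Q.rename ρ → Avail (B ∪ C) A →
        Drives Z A ({i} + {j}) (B ∪ C) (α + β) (r + t) := by
      intro A i j hi hj hA
      refine (ih1 hBZ.1 A i hi fun b hb => hA b (Finset.mem_union_left _ hb)).add hd hBZ.2
        (fun c hc => (hA c (Finset.mem_union_right _ hc)).1) fun A' hA' => ih2 hBZ.2 A' j hj ?_
      exact fun c hc => ⟨hA' c hc, (hA c (Finset.mem_union_right _ hc)).2⟩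
    refine Drives.of_not_sync₂ fun A i hi hs hA => ?_
    cases i <;> simp only [Item.proc, PiStop.Proc.rename, reduceCtorEq] at hi
    · subst hi
      exact (key A (.run _) (.run _) rfl rfl hA).head_empty
        (.single (QStep.of_move_empty (.par _ _) rfl 0)) rfl
    · cases hi
      rename_i c
      exact (key A (.sync₂ c _) (.run _) rfl rfl hA).head_empty
        (.single (QStep.of_move_empty (.ack₁ c _ _) rfl 0)) rfl
    · exact (hs _ _ rfl).elim
  | @bang P ρ B C α β r t hP hQ hd hB hC ih1 ih2 =>
    rw [Finset.union_subset_iff] at hBZ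
    have key₂ : ∀ A f, Avail (B ∪ C) A →
        Drives Z A {.bang₂ f (P.rename ρ)} (B ∪ C) (α + β) (r + t) := by
      intro A f hA
      refine Drives.head_empty (.single (QStep.of_move_empty (.bang₂ f _) rfl 0)) rfl ?_
      rw [add_zero, add_comm]
      refine (ih1 hBZ.1 A _ rfl fun b hb => hA b (Finset.mem_union_left _ hb)).add hd hBZ.2
        (fun c hc => (hA c (Finset.mem_union_right _ hc)).1) fun A' hA' => ih2 hBZ.2 A' _ rfl ?_
      exact fun c hc => ⟨hA' c hc, (hA c (Finset.mem_union_right _ hc)).2⟩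
    have key₁ : ∀ A f, Avail (B ∪ C) A →
        Drives Z A {.bang₁ f (P.rename ρ)} (B ∪ C) (α + β) (r + t) := fun A f hA =>
      (key₂ A f hA).head_empty (.single (QStep.of_move_empty (.bang₁ f _) rfl 0)) rfl
    refine Drives.of_not_sync₂ fun A i hi hs hA => ?_
    cases i <;> simp only [Item.proc, PiStop.Proc.rename, reduceCtorEq] at hi
    · subst hi
      obtain ⟨f, h1, h2, h3⟩ := exists_freshName A Z
      have h4 := hA.union_singleton fun hb => h2 (Finset.union_subset hBZ.1 hBZ.2 hb)
      have := Drives.head (B := ∅) (A := A)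
        (.single (QStep.of_move (.bang f (P.rename ρ)) (.singleton h1 h3) rfl 0)) (by rfl)
        ?_ (key₁ _ f h4)
      · simpa using this
      · intro a ha
        rcases Finset.mem_union.1 ha with ha | ha
        · exact .inl ha
        · rw [Finset.mem_singleton.1 ha]
          exact .inr (.inr h2)
    · exact (hs _ _ rfl).elim
    · cases hi
      exact key₁ A _ hA
    · cases hi
      exact key₂ A _ hA
  | @nuOpen P ρ a B α r hP haB ha hk ih =>
    have hP' : ((P.rename (upRen 1 ρ)).inst a) = P.rename (consRen a ρ) := by
      rw [PiStop.Proc.inst, PiStop.Proc.rename_rename, consRen_comp_upRen]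
      rfl
    have key₂ : ∀ A m, Avail (insert a B) A →
        Drives Z A {.nu₂ m (P.rename (upRen 1 ρ))} (insert a B) α r := by
      intro A m hA
      have h1 := hA a (Finset.mem_insert_self a B)
      have h4 : Avail B (A ∪ {a}) :=
        Avail.union_singleton (fun b hb => hA b (Finset.mem_insert_of_mem hb)) haB
      have h5 := (ih ((Finset.subset_insert a B).trans hBZ) (A ∪ {a})
        (.run ((P.rename (upRen 1 ρ)).inst a)) hP' h4).add_rest {.chan a m}
      rw [body_singleton, Item.proc, Cls.cls_zero, add_zero] at h5
      refine Drives.head (B := {a})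
        (.single (QStep.of_move (.nu₃ m a _) (.singleton h1.1 h1.2) rfl 0)) rfl (fun b hb => ?_) h5
      rcases Finset.mem_union.1 hb with hb | hb
      · exact .inl hb
      · exact .inr (.inl hb)
    have key₁ : ∀ A m, Avail (insert a B) A →
        Drives Z A {.nu₁ m (P.rename (upRen 1 ρ))} (insert a B) α r := fun A m hA =>
      (key₂ A m hA).head_empty (.single (QStep.of_move_empty (.nu₂ m _) rfl 0)) rfl
    refine Drives.of_not_sync₂ fun A i hi hs hA => ?_
    cases i <;> simp only [Item.proc, PiStop.Proc.rename, reduceCtorEq] at hi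
    · subst hi
      obtain ⟨f, h1, h2, h3⟩ := exists_freshName A Z
      have h4 := hA.union_singleton fun hb => h2 (hBZ hb)
      have := Drives.head (B := ∅) (A := A)
        (.single (QStep.of_move (.nu₁ f (P.rename (upRen 1 ρ))) (.singleton h1 h3) rfl 0))
        (by rfl) ?_ (key₁ _ f h4)
      · simpa using this
      · intro a ha
        rcases Finset.mem_union.1 ha with ha | ha
        · exact .inl ha
        · rw [Finset.mem_singleton.1 ha]
          exact .inr (.inr h2)
    · exact (hs _ _ rfl).elim
    · cases hi
      exact key₁ A _ hA
    · cases hi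
      exact key₂ A _ hA
  | nuKeep _ _ _ hk => cases hk

/-- The items of a configuration can follow every exposure of prefixes. -/
theorem exists_drives (I : Multiset Item) : ∃ P, cls P = body I ∧ ∀ {B α r},
    Exp false P id B α r → ∀ Z A, B ⊆ Z → Avail B A → Drives Z A I B α r := by
  induction I using Multiset.induction_on with
  | empty =>
    refine ⟨.zero, Cls.cls_zero, fun h Z A _ _ => ?_⟩
    cases h with
    | leaf _ h => exact h.elim
    | zero => exact Drives.rest Z A 0
  | cons i I ih =>
    obtain ⟨P, hP, ih⟩ := ih
    refine ⟨.par i.proc P, by rw [Cls.cls_par, hP, body_cons], fun h Z A hBZ hA => ?_⟩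
    obtain ⟨B, C, α, β, r, t, h1, h2, hd, -, -, rfl, rfl, rfl⟩ := h.par_inv rfl
    rw [Finset.union_subset_iff] at hBZ
    rw [← Multiset.singleton_add]
    refine (h1.drives hBZ.1 A i (PiStop.Proc.rename_id _).symm
      fun b hb => hA b (Finset.mem_union_left _ hb)).add hd hBZ.2
        (fun c hc => (hA c (Finset.mem_union_right _ hc)).1) fun A' hA' => ih h2 Z A' hBZ.2 ?_
    exact fun c hc => ⟨hA' c hc, (hA c (Finset.mem_union_right _ hc)).2⟩

end Exp

end Translation

namespace Translation
variable {S : CH.Signature} {s : ℕ} {A A' A₁ : Finset ℕ} {I I' I₁ J R : Multiset Item}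

open PiStop (cls Cls StepQ SuccQ MayQ ShouldQ Exp Pre)

/-! ### Configurations simulate the `π`-calculus -/

/-- The moves from `C` lead either to the class `q`, or to some reduct of the class of `C` with
fewer senders that have filled the MVar of a channel. -/
def Reaches (C : Config) (q : Cls) : Prop :=
  ∃ C', ASteps C C' ∧ .main ∈ C'.2 ∧ numCom C'.2 ≤ numCom C.2 ∧
    (decode C'.2 = q ∨ StepQ (decode C.2) (decode C'.2) ∧ numCom C'.2 < numCom C.2)

theorem Reaches.head {C C' : Config} {q : Cls} (hC : Good S s C.1 C.2) (h : QSteps C C')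
    (h' : Reaches C' q) : Reaches C q := by
  obtain ⟨C'', h1, h2, h3, h4⟩ := h'
  obtain ⟨e1, e2⟩ := QSteps.decode_eq hC h
  rw [e1, e2] at h4
  exact ⟨C'', h.aSteps.trans h1, h2, e2 ▸ h3, h4⟩

/-- The class that results from the communication of `x(y).P` and `x̄z.Q`. -/
def result (z : ℕ) (P Q : PiStop.Proc) (X : Finset ℕ) (R : Multiset Item) : Cls :=
  (cls (P.inst z) + cls Q + body R).close X

/-- A channel has only one MVar. -/
theorem Good.holds_unique (h : Good S s A I) {i j : Item} {x m m' : ℕ} (hi : i ∈ I) (hj : j ∈ I)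
    (hx : i.Holds x m) (hx' : j.Holds x m') : m = m' := by
  have := cell_unique h.nodup (mem_allComps.2 ⟨i, hi, hx.share_mem⟩)
    (mem_allComps.2 ⟨j, hj, hx'.share_mem⟩) rfl rfl
  have h2 : (CH.Expr.chan (.var m) : CH.Expr S) = CH.Expr.chan (.var m') := by
    injection this
  have h3 := congrFun (eq_of_heq (CH.Expr.con.inj h2).2.2) (0 : Fin 1)
  injection h3

/-- A receiver takes the message of a sender that has filled the MVar. -/
theorem AStep.take (A : Finset ℕ) (m x y c : ℕ) (P Q : PiStop.Proc) (R : Multiset Item) :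
    MStep true A ({.recv m x P} + {.com x m y c Q} + R) A
      ({.sync₁ c Q (P.inst y)} + {.chan x m} + R) :=
  ⟨_, ∅, _, R, rfl, rfl, (Finset.union_empty A).symm, .take x m y c P Q, by simp⟩

theorem reaches_take {m x z c : ℕ} {P Q : PiStop.Proc} (hR : .main ∈ R) :
    Reaches (A, {.recv m x P} + {.com x m z c Q} + R)
      (result z P Q (allChans ({.recv m x P} + {.com x m z c Q} + R)) R) := by
  refine ⟨(A, _), .single ⟨true, AStep.take A m x z c P Q R⟩, by simp [hR], ?_, .inl ?_⟩
  · simp [Item.isCom]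
  · rw [decode, result]
    congr 1
    · simp [Item.chans]
    · simp only [body_add, body_singleton, Item.proc, Cls.cls_par, Cls.cls_zero, add_zero]
      rw [add_comm (cls Q)]

theorem reaches_send₂ {m x z c : ℕ} {P Q : PiStop.Proc} (hR : .main ∈ R) :
    Reaches (A, {.recv m x P} + {.send₂ c m x z Q} + ({.chan x m} + R))
      (result z P Q (allChans ({.recv m x P} + {.send₂ c m x z Q} + ({.chan x m} + R)))
        ({.chan x m} + R)) := by
  have h1 : MStep false A ({.recv m x P} + {.send₂ c m x z Q} + ({.chan x m} + R)) A
      ({.recv m x P} + {.com x m z c Q} + R) :=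
    ⟨_, ∅, _, {.recv m x P} + R, by abel, by rw [add_right_comm, add_comm],
      (Finset.union_empty A).symm, .put c x z Q m, by simp⟩
  refine ⟨(A, {.sync₁ c Q (P.inst z)} + {.chan x m} + R),
    .head (b := (A, {.recv m x P} + {.com x m z c Q} + R)) ⟨false, h1⟩
    (.single ⟨true, AStep.take A m x z c P Q R⟩), by simp [hR], ?_, .inl ?_⟩
  · simp [Item.isCom]
  · rw [decode, result]
    congr 1
    · simp [Item.chans]
    · simp only [body_add, body_singleton, Item.proc, Cls.cls_par, Cls.cls_zero, add_zero, zero_add]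
      rw [add_comm (cls Q)]

theorem reaches_send₁ {m x z c : ℕ} {P Q : PiStop.Proc}
    (h : Good S s A ({.recv m x P} + {.send₁ c x z Q} + ({.chan x m} + R))) (hR : .main ∈ R) :
    Reaches (A, {.recv m x P} + {.send₁ c x z Q} + ({.chan x m} + R))
      (result z P Q (allChans ({.recv m x P} + {.send₁ c x z Q} + ({.chan x m} + R)))
        ({.chan x m} + R)) := by
  have h1 : QStep (A, {.recv m x P} + {.send₁ c x z Q} + ({.chan x m} + R))
      (A, {.recv m x P} + {.send₂ c m x z Q} + ({.chan x m} + R)) := by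
    have h2 := QStep.of_move_empty (A := A) (Move.lookSend c x z Q (Item.Holds.chan x m)) rfl
      ({.recv m x P} + R)
    have h3 : ∀ I J K : Multiset Item, I + J + (K + R) = K + I + (J + R) := fun I J K => by abel
    rwa [h3, h3 {.send₂ c m x z Q}] at h2
  refine .head h (.single h1) ?_
  simpa [Item.chans] using reaches_send₂ (A := A) (z := z) (c := c) (P := P) (Q := Q) (m := m)
    (x := x) hR

theorem add_frame (I J K : Multiset Item) : J + (I + K) = I + J + K := by
  rw [add_left_comm, add_assoc]

theorem reaches_run_out {m x z : ℕ} {P Q : PiStop.Proc}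
    (h : Good S s A ({.recv m x P} + {.run (.out x z Q)} + ({.chan x m} + R))) (hR : .main ∈ R) :
    Reaches (A, {.recv m x P} + {.run (.out x z Q)} + ({.chan x m} + R))
      (result z P Q (allChans ({.recv m x P} + {.run (.out x z Q)} + ({.chan x m} + R)))
        ({.chan x m} + R)) := by
  obtain ⟨c, h1, -, h2⟩ := exists_freshName A ∅
  have h3 : QStep (A, {.recv m x P} + {.run (.out x z Q)} + ({.chan x m} + R))
      (A ∪ {c}, {.recv m x P} + {.send₁ c x z Q} + ({.chan x m} + R)) := by
    have := QStep.of_move (A := A) (.out c x z Q) (.singleton h1 h2) rfl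
      ({.recv m x P} + ({.chan x m} + R))
    rwa [add_frame {.recv m x P}, add_frame {.recv m x P}] at this
  have := reaches_send₁ (h.step h3.1) hR
  refine .head h (.single h3) ?_
  simpa [Item.chans] using this

/-- A receiver that has looked up its channel can communicate with any sender, unless another sender
has filled the MVar. -/
theorem reaches_recv {m x z : ℕ} {P Q : PiStop.Proc} {j : Item}
    (h : Good S s A ({.recv m x P} + {j} + R)) (hR : .main ∈ R) (hj : j.proc = .out x z Q)
    (hs : ∀ c P, j ≠ .sync₂ c P) :
    Reaches (A, {.recv m x P} + {j} + R) (result z P Q (allChans ({.recv m x P} + {j} + R)) R) := by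
  obtain ⟨k, hk, hx⟩ := h.uses (.recv m x P) (by simp) x m (.recv m x P)
  have hjm : j ∈ {.recv m x P} + {j} + R := by simp
  -- The case that the MVar of the channel is empty or filled by another sender.
  have key : (∀ R', R = {.chan x m} + R' → .main ∈ R' →
        Reaches (A, {.recv m x P} + {j} + R)
          (result z P Q (allChans ({.recv m x P} + {j} + R)) R)) →
      k ≠ j →
      Reaches (A, {.recv m x P} + {j} + R)
        (result z P Q (allChans ({.recv m x P} + {j} + R)) R) := by
    intro H hkj
    have hkR : k ∈ R := by
      rcases Multiset.mem_add.1 hk with hk | hk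
      · rcases Multiset.mem_add.1 hk with hk | hk
        · rw [Multiset.mem_singleton] at hk
          subst hk
          cases hx
        · exact (hkj (Multiset.mem_singleton.1 hk)).elim
      · exact hk
    obtain ⟨R', rfl⟩ := Multiset.exists_cons_of_mem hkR
    rw [← Multiset.singleton_add] at *
    cases hx with
    | chan => exact H R' rfl (by simpa using hR)
    | com _ _ y c P' =>
      -- The receiver is redirected to the sender that has filled the MVar.
      have h1 := AStep.take A m x y c P P' ({j} + R')
      have e1 : {.recv m x P} + {j} + ({.com x m y c P'} + R') =
        ({.recv m x P} + {.com x m y c P'} + ({j} + R') : Multiset Item) := by abel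
      rw [e1] at h ⊢
      have hlt : numCom ({.sync₁ c P' (P.inst y)} + {.chan x m} + ({j} + R')) <
          numCom ({.recv m x P} + {.com x m y c P'} + ({j} + R')) := by
        simp [Item.isCom]
      refine ⟨(A, _), .single ⟨true, h1⟩, ?_, hlt.le, .inr ⟨stepQ_of_mStep h1, hlt⟩⟩
      simp at hR ⊢
      exact .inr hR
  cases j <;> simp only [Item.proc, reduceCtorEq, PiStop.Proc.out.injEq] at hj
  · rename_i x' m' y c P'
    obtain ⟨rfl, rfl, rfl⟩ := hj
    obtain rfl := h.holds_unique hk hjm hx (.com _ _ _ _ _)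
    exact reaches_take hR
  · subst hj
    exact key (fun R' e hR' => by subst e; exact reaches_run_out h hR')
      (by rintro rfl; cases hx)
  · rename_i c _ _ _
    obtain ⟨rfl, rfl, rfl⟩ := hj
    exact key (fun R' e hR' => by subst e; exact reaches_send₁ h hR')
      (by rintro rfl; cases hx)
  · rename_i c m' _ _ _
    obtain ⟨rfl, rfl, rfl⟩ := hj
    obtain ⟨k', hk', hx'⟩ := h.uses _ hjm _ m' (.send₂ _ _ _ _ _)
    obtain rfl := h.holds_unique hk hk' hx hx'
    exact key (fun R' e hR' => by subst e; exact reaches_send₂ hR')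
      (by rintro rfl; cases hx)
  · exact (hs _ _ rfl).elim

/-- A ready receiver can communicate with a ready sender, unless another sender has filled the MVar
of the channel. -/
theorem reaches_ready {x z : ℕ} {P Q : PiStop.Proc} {i j : Item} (h : Good S s A ({i} + {j} + R))
    (hR : .main ∈ R) (hi : i.proc = .inp x P) (hsi : ∀ c P, i ≠ .sync₂ c P)
    (hj : j.proc = .out x z Q) (hs : ∀ c P, j ≠ .sync₂ c P) :
    Reaches (A, {i} + {j} + R) (result z P Q (allChans ({i} + {j} + R)) R) := by
  cases i <;> simp only [Item.proc, reduceCtorEq, PiStop.Proc.inp.injEq] at hi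
  · subst hi
    have hx : x ∈ allChans ({.run (.inp x P)} + {j} + R) :=
      h.fn (.run (.inp x P)) (by simp) (by simp [Item.proc, PiStop.Proc.FN])
    obtain ⟨k, hk, hx⟩ := mem_allChans.1 hx
    obtain ⟨m, hx⟩ := k.mem_chans hx
    rw [add_assoc] at hk
    have hk' := (Multiset.mem_add.1 hk).resolve_left (by
      rintro hk
      rw [Multiset.mem_singleton] at hk
      subst hk
      cases hx)
    obtain ⟨T, hT⟩ := Multiset.exists_cons_of_mem hk'
    have h3 : QStep (A, {.run (.inp x P)} + {j} + R) (A, {.recv m x P} + {j} + R) := by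
      have := QStep.of_move_empty (A := A) (.lookRecv x P hx) (by simp [Item.isCom]) T
      rwa [add_assoc, add_assoc _ _ T, Multiset.singleton_add k, ← hT, ← add_assoc,
        ← add_assoc] at this
    have := reaches_recv (h.step h3.1) hR hj hs
    refine .head h (.single h3) ?_
    simpa [Item.chans] using this
  · obtain ⟨rfl, rfl⟩ := hi
    exact reaches_recv h hR hj hs
  · exact (hsi _ _ rfl).elim

/-- Different forms of the main thread exclude each other. -/
theorem Good.not_mem_of_main {i j : Item} (h : Good S s A I) (hi : i ∈ I) (hI : i.isMain = true)
    (hj : j.isMain = true) (hij : i ≠ j) : j ∉ I := by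
  intro hjI
  obtain ⟨I, rfl⟩ := Multiset.exists_cons_of_mem hi
  obtain ⟨I, rfl⟩ := Multiset.exists_cons_of_mem ((Multiset.mem_cons.1 hjI).resolve_left hij.symm)
  have := h.main
  simp [hI, hj] at this

theorem Good.allChans_subset (h : Good S s A I) : allChans I ⊆ A := fun _ hx =>
  h.sub _ (Translation.allChans_subset hx)

theorem rel_singleton_right {α β : Type*} {r : α → β → Prop} {E : Multiset α} {b : β}
    (h : Multiset.Rel r E {b}) : ∃ a, E = {a} ∧ r a b := by
  obtain ⟨a, E', ha, h', rfl⟩ := Multiset.rel_cons_right.1 h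
  rw [Multiset.rel_zero_right] at h'
  exact ⟨a, by rw [h']; rfl, ha⟩

/-- A configuration can simulate every reduction of the `π`-process, unless some sender has filled
the MVar of the channel. -/
theorem Good.simulates (h : Good S s A I) (hI : .main ∈ I) {q : Cls} (hq : StepQ (decode I) q) :
    Reaches (A, I) q := by
  obtain ⟨q', hq', rfl⟩ := hq.of_close
  obtain ⟨K, rfl⟩ := Multiset.exists_cons_of_mem hI
  rw [← Multiset.singleton_add] at *
  obtain ⟨P, hP, hd⟩ := exists_drives K
  have e1 : body ({.main} + K) = cls P := by simp [Item.proc, hP, Cls.cls_zero]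
  rw [e1] at hq'
  obtain ⟨B, x, z, p, p', r, hE, rfl, hB⟩ := hq'.opens (coInf_range_free.union A.finite_toSet)
  have hA : Avail B A := fun b hb => ⟨fun h => hB b hb (.inr h), fun h => hB b hb (.inl h)⟩
  obtain ⟨A', E, R, h1, h2, rfl, h4, h5⟩ := hd hE B A subset_rfl hA
  obtain ⟨E₁, E₂, hE₁, hE₂, rfl⟩ := Multiset.rel_add_right.1 h2
  obtain ⟨i, rfl, hi⟩ := rel_singleton_right hE₁
  obtain ⟨j, rfl, hj⟩ := rel_singleton_right hE₂
  have h6 := QSteps.frame h1 {.main}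
  simp only at h6
  rw [add_comm K, add_assoc _ R] at h6
  have hg := h.aSteps (QSteps.aSteps h6)
  have hd : Disjoint (allChans ({.main} + K)) B := Finset.disjoint_right.2 fun b hb hb' =>
    (hA b hb).1 (h.allChans_subset hb')
  have e2 : allChans ({i} + {j} + (R + {.main})) = allChans ({.main} + K) ∪ B := by
    rw [← add_assoc, allChans_add, h4]
    simp [Item.chans]
  cases hi with | @inp _ P hi hsi =>
  cases hj with | @out _ _ Q hj hsj =>
  have := reaches_ready hg (by simp) hi hsi hj hsj
  refine .head h h6 ?_
  rw [result, e2, Cls.close_union hd, cls_inst] at *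
  simpa [Item.proc, Cls.cls_zero] using this

/-- A configuration whose class is successful can take `stop`. -/
theorem Good.simulates_succ (h : Good S s A I) (hI : .main ∈ I) (hq : SuccQ (decode I)) :
    ∃ C, ASteps (A, I) C ∧ .stopped ∈ C.2 := by
  replace hq := hq.of_close
  obtain ⟨K, rfl⟩ := Multiset.exists_cons_of_mem hI
  rw [← Multiset.singleton_add] at *
  obtain ⟨P, hP, hd⟩ := exists_drives K
  have e1 : body ({.main} + K) = cls P := by simp [Item.proc, hP, Cls.cls_zero]
  rw [e1] at hq
  obtain ⟨B, r, hE, hB⟩ := hq.opens (coInf_range_free.union A.finite_toSet)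
  have hA : Avail B A := fun b hb => ⟨fun h => hB b hb (.inr h), fun h => hB b hb (.inl h)⟩
  obtain ⟨A', E, R, h1, h2, rfl, h4, h5⟩ := hd hE B A subset_rfl hA
  obtain ⟨i, rfl, hi⟩ := rel_singleton_right h2
  have h6 := QSteps.frame h1 {.main}
  simp only at h6
  rw [add_comm K] at h6
  have hg := h.aSteps (QSteps.aSteps h6)
  have hm : ∀ j : Item, j.isMain = true → Item.main ≠ j → i ≠ j := fun j hj hij hij' =>
    hg.not_mem_of_main (i := .main) (by simp) rfl hj hij (by simp [hij'])
  have hi' : i = .run .Stop := by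
    cases hi with | halt hi hs =>
    cases i <;> simp only [Item.proc, reduceCtorEq] at hi
    · rw [hi]
    · exact (hs _ _ rfl).elim
    · exact (hm .stopped rfl (by simp) rfl).elim
    · exact (hm .success rfl (by simp) rfl).elim
  subst hi'
  have h7 : MStep false A' ({.run .Stop} + R + {.main}) A' ({.stopped} + R) :=
    ⟨_, ∅, _, R, add_right_comm _ _ _, rfl, (Finset.union_empty _).symm, .halt, by simp⟩
  exact ⟨(A', {.stopped} + R), (QSteps.aSteps h6).tail ⟨false, h7⟩, by simp⟩

/-- While no sender has filled the MVar of a channel, a configuration can simulate all reductions of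
the `π`-process. -/
theorem Good.simulates_all (h : Good S s A I) (hI : .main ∈ I) (hc : numCom I = 0) {q : Cls}
    (hq : Relation.ReflTransGen StepQ (decode I) q) :
    ∃ C, ASteps (A, I) C ∧ .main ∈ C.2 ∧ numCom C.2 = 0 ∧ decode C.2 = q := by
  induction hq with
  | refl => exact ⟨(A, I), .refl, hI, hc, rfl⟩
  | tail _ hq ih =>
    obtain ⟨C, h1, h2, h3, rfl⟩ := ih
    obtain ⟨C', k1, k2, k3, k4⟩ := (h.aSteps h1).simulates h2 hq
    rw [h3] at k3 k4
    exact ⟨C', h1.trans k1, k2, by omega, k4.resolve_right fun h => by omega⟩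

/-- A configuration whose class may converge can succeed, provided that either no sender has filled
the MVar of a channel, or the class should converge: then the choices of such senders do no harm.
The induction is on the number of these senders and, for a fixed number, on the length of a
successful computation of the class. -/
theorem Good.may (h : Good S s A I) (hI : .main ∈ I) (hm : MayQ (decode I))
    (hs : numCom I = 0 ∨ ShouldQ (decode I)) : ∃ C, ASteps (A, I) C ∧ .stopped ∈ C.2 := by
  induction hn : numCom I using Nat.strong_induction_on generalizing A I with
  | _ n ihn =>
    obtain ⟨q, hq, hsq⟩ := hm
    generalize hp : decode I = p at hq
    induction hq using Relation.ReflTransGen.head_induction_on generalizing A I with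
    | refl =>
      subst hp
      exact h.simulates_succ hI hsq
    | @head p p' hpp' hp' ih =>
      subst hp
      obtain ⟨C, h1, h2, h3, h4⟩ := h.simulates hI hpp'
      simp only at h3 h4
      have hg := h.aSteps h1
      rcases h4 with h4 | ⟨h4, hlt⟩
      · by_cases hlt : numCom C.2 < numCom I
        · have hs' : ShouldQ (decode I) := hs.resolve_left (by omega)
          obtain ⟨C', k1, k2⟩ := ihn _ (hn ▸ hlt) hg h2 (h4 ▸ ⟨q, hp', hsq⟩)
            (.inr fun q hq => hs' q (.head hpp' (h4 ▸ hq))) rfl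
          exact ⟨C', h1.trans k1, k2⟩
        · have he : numCom C.2 = numCom I := by omega
          obtain ⟨C', k1, k2⟩ := ih hg h2 (hs.imp (fun h => he.trans h) fun hs' q hq =>
            hs' q (.head hpp' (h4 ▸ hq))) (he.trans hn) h4
          exact ⟨C', h1.trans k1, k2⟩
      · have hs' : ShouldQ (decode I) := hs.resolve_left (by omega)
        obtain ⟨C', k1, k2⟩ := ihn _ (hn ▸ hlt) hg h2 (hs' _ (.single h4))
          (.inr fun q hq => hs' q (.head h4 hq)) rfl
        exact ⟨C', h1.trans k1, k2⟩

end Translation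

namespace Translation
open CH CH.Expr
variable {S : Signature} {s : ℕ} {A A' A₁ : Finset ℕ} {I I' I₁ J R : Multiset Item}
variable {Q Q' : CH.Proc S} {P : PiStop.Proc}

open PiStop (cls Cls StepQ SuccQ MayQ ShouldQ)

/-! ### Convergence of configurations -/

theorem MStep.success_mem {r : Bool} (h : MStep r A I A' I') (hI : .success ∈ I) :
    .success ∈ I' := by
  obtain ⟨N, B, N', J, rfl, rfl, rfl, hm, -⟩ := h
  rcases Multiset.mem_add.1 hI with hI | hI
  · cases hm with
    | lookSend c x y P h => cases h <;> simp at hI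
    | lookRecv x P h => cases h <;> simp at hI
    | _ => simp at hI
  · exact Multiset.mem_add.2 (.inr hI)

/-- The moves of a configuration can be made by the states that represent it. -/
theorem Conf.aSteps {C C' : Config} (h : ASteps C C') (hQ : Conf S s Q C.1 C.2)
    (hs : .success ∉ C'.2) :
    ∃ Q', Relation.ReflTransGen Step Q Q' ∧ Conf S s Q' C'.1 C'.2 := by
  induction h with
  | refl => exact ⟨Q, .refl, hQ⟩
  | tail _ h ih =>
    obtain ⟨r, h⟩ := h
    have hs' := fun h' => hs (h.success_mem h')
    obtain ⟨Q', h1, h2⟩ := ih hs'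
    obtain ⟨Q'', h3, h4⟩ := h2.forward hs' h
    exact ⟨Q'', h1.trans h3, h4⟩

/-- A computation of a state decodes to a computation of the class that it represents. -/
theorem Conf.steps (h : Conf S s Q A I) (hQ : Relation.ReflTransGen Step Q Q') :
    ∃ A' I', Conf S s Q' A' I' ∧ Relation.ReflTransGen StepQ (decode I) (decode I') := by
  induction hQ with
  | refl => exact ⟨A, I, h, .refl⟩
  | tail _ hQ ih =>
    obtain ⟨A', I', h1, h2⟩ := ih
    rcases h1.backward hQ with h3 | ⟨r, A'', I'', h3, h4⟩
    · exact ⟨A', I', h3, h2⟩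
    · refine ⟨A'', I'', h4, ?_⟩
      cases r
      · rwa [decode_eq_of_mStep h1.good h3]
      · exact h2.tail (stepQ_of_mStep h3)

theorem Conf.succQ (h : Conf S s Q A I) (hQ : Successful Q) : SuccQ (decode I) := by
  have hI : .success ∈ I := by
    by_contra hI
    exact h.not_successful hI hQ
  obtain ⟨J, rfl⟩ := Multiset.exists_cons_of_mem hI
  rw [decode, body_cons]
  exact .close_stop_add _ _

theorem Conf.mayQ (h : Conf S s Q A I) (hQ : MayConv Q) : MayQ (decode I) := by
  obtain ⟨-, Q', h1, h2⟩ := hQ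
  obtain ⟨A', I', h3, h4⟩ := h.steps h1
  exact ⟨_, h4, h3.succQ h2⟩

theorem Conf.mayConv_of_success (h : Conf S s Q A I) (hI : .success ∈ I) : MayConv Q :=
  ⟨h.wellFormed, Q, .refl, h.successful hI⟩

theorem _root_.CH.MayConv.of_steps (hQ : Q.WellFormed) (h : Relation.ReflTransGen Step Q Q')
    (h' : MayConv Q') : MayConv Q :=
  let ⟨_, Q'', h1, h2⟩ := h'
  ⟨hQ, Q'', h.trans h1, h2⟩

theorem Conf.mayConv_of_stopped (h : Conf S s Q A I) (hI : .stopped ∈ I) : MayConv Q := by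
  have hs : .success ∉ I := h.good.not_mem_of_main hI rfl rfl (by simp)
  obtain ⟨J, rfl⟩ := Multiset.exists_cons_of_mem hI
  have hm : MStep false A (.stopped ::ₘ J) A (.success ::ₘ J) :=
    ⟨_, ∅, _, J, (Multiset.singleton_add _ J).symm, (Multiset.singleton_add _ J).symm,
      (Finset.union_empty A).symm, .success, by simp⟩
  obtain ⟨Q', h1, h2⟩ := h.forward hs hm
  exact .of_steps h.wellFormed h1 (h2.mayConv_of_success (Multiset.mem_cons_self _ _))

/-- A state converges if the class that it represents does, provided that no sender is committed or
the class should converge. -/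
theorem Conf.mayConv (h : Conf S s Q A I) (hm : MayQ (decode I))
    (hs : numCom I = 0 ∨ ShouldQ (decode I)) : MayConv Q := by
  have h0 : 0 < I.countP fun i => i.isMain := by rw [h.good.main]; exact zero_lt_one
  obtain ⟨i, hi, him⟩ := Multiset.countP_pos.1 h0
  cases i <;> simp [Item.isMain] at him
  · obtain ⟨C, h1, h2⟩ := h.good.may hi hm hs
    have hg := h.good.aSteps h1
    obtain ⟨Q', h3, h4⟩ := h.aSteps h1 (hg.not_mem_of_main h2 rfl rfl (by simp))
    exact .of_steps h.wellFormed h3 (h4.mayConv_of_stopped h2)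
  · exact h.mayConv_of_stopped hi
  · exact h.mayConv_of_success hi

/-! ### The initial states -/

/-- The expression of the main thread, where the free name `i` is represented by `ρ i`. -/
def tStart (S : Signature) (ρ : ℕ → ℕ) (P : PiStop.Proc) : Expr S :=
  bind (newMVar unit) (lam
    (andThen (fork (tauAux S (fun i => ρ i + 1) 0 P)) (putMVar (var 0) unit)))

/-- The expression of the main thread after the MVar `s` for `stop` has been created. -/
def tFork (S : Signature) (s : ℕ) (P : PiStop.Proc) : Expr S :=
  andThen (fork (tRun S s P)) (putMVar (var s) unit)

theorem andThen_rename (e₁ e₂ : Expr S) (ρ : ℕ → ℕ) :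
    (andThen e₁ e₂).rename ρ = andThen (e₁.rename ρ) (e₂.rename ρ) := by
  rw [← subst_comp_var, andThen_subst, subst_comp_var, subst_comp_var]

theorem start_rename (ρ f : ℕ → ℕ) (P : PiStop.Proc) :
    (tStart S ρ P).rename f = tStart S (f ∘ ρ) P := by
  simp only [tStart, Expr.rename, andThen_rename, unit_rename, tauAux_rename]
  simp [Function.comp_def]

/-- The translation of a closed process does not depend on the names of its variables. -/
theorem tRun_eq (hP : P.Closed) (ρ : ℕ → ℕ) (s : ℕ) : tauAux S ρ s P = tRun S s P := by
  have := tauAux_proc_rename (S := S) P id s ρ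
  rw [PiStop.Proc.rename_of_closed hP] at this
  exact this.symm

theorem act_start (hP : P.Closed) (ρ : ℕ → ℕ) : ∃ K, act (tStart S ρ P) = .new unit K ∧
    ∀ s, LocStar (K (ret (var s))) (tFork S s P) := by
  refine ⟨_, rfl, fun s => .bind_ret_of_eq ?_⟩
  rw [inst_one]
  simp only [andThen_subst, subst, unit_subst, tFork]
  rw [tauAux_subst (ρ' := ρ) (s' := s), tRun_eq hP] <;> intros <;> rfl

theorem act_fork (s : ℕ) (P : PiStop.Proc) : ∃ K, act (tFork S s P) = .fork (tRun S s P) K ∧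
    LocStar (K (ret unit)) (putMVar (var s) unit) :=
  ⟨_, rfl, .andThen_ret _ _⟩

/-- The states before the translated process is started: the main thread creates the MVar for
`stop`, or it has done so and forks the translated process next. -/
inductive Init (P : PiStop.Proc) (Q : CH.Proc S) : Prop
  | start {A : Finset ℕ} (ρ : ℕ → ℕ) (hA : EnvOK free A)
      (h : Q.Open free A {.thread true (tStart S ρ P)})
  | fork {A : Finset ℕ} {s : ℕ} {L : Multiset (Comp S)} (hA : EnvOK free A) (hs : s ∈ A)
      (h : Q.Open free A L) (hL : Multiset.Rel Sim L {.thread true (tFork S s P), .mvar s unit})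

theorem live_start (ρ : ℕ → ℕ) (P : PiStop.Proc) : Live {.thread true (tStart S ρ P)} := by
  refine ⟨?_, ?_, fun v hv => ?_⟩
  · rw [names_singleton]
    simp [Comp.name]
  · exact (Multiset.countP_le_card _ _).trans (by simp)
  · simp [tStart] at hv

theorem live_fork (s : ℕ) (P : PiStop.Proc) :
    Live {.thread true (tFork S s P), .mvar s unit} := by
  refine ⟨?_, ?_, fun v hv => ?_⟩
  · rw [Multiset.insert_eq_cons, ← Multiset.singleton_add, names_add, names_singleton,
      names_singleton]
    simp [Comp.name]
  · rw [Multiset.insert_eq_cons, Multiset.countP_cons, ← Multiset.cons_zero, Multiset.countP_cons]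
    simp [Comp.isMain]
  · simp [tFork, andThen] at hv

theorem Init.wellFormed (h : Init P Q) : Q.WellFormed := by
  cases h with
  | start ρ hA h => exact (live_start ρ P).wellFormed h
  | fork hA hs h hL => exact ((live_fork _ P).of_rel hL).wellFormed h

theorem Init.not_successful (h : Init P Q) : ¬ Successful Q := by
  cases h with
  | start ρ hA h => exact (live_start ρ P).not_successful h
  | fork hA hs h hL => exact ((live_fork _ P).of_rel hL).not_successful h

theorem decode_init : decode ({.main} + {.run P}) = cls P := by
  simp [decode, Item.proc, Item.chans, Cls.cls_zero, Cls.close_empty]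

theorem good_init (hP : P.Closed) (hs : s ∈ A) : Good S s A ({.main} + {.run P}) := by
  have hn : names (allComps S s ({.main} + {.run P})) = {s} := by
    simp only [allComps_add, allComps_singleton, Item.comps, names_add, names_singleton, Comp.name,
      Option.elim, zero_add, add_zero]
  refine ⟨?_, ?_, ?_, ?_, rfl⟩
  · rw [hn]
    exact Multiset.nodup_singleton s
  · rw [hn]
    simpa using hs
  · intro i hi
    have : i.proc.FN = ∅ := by
      simp only [Multiset.mem_add, Multiset.mem_singleton] at hi
      rcases hi with rfl | rfl
      · rfl
      · exact hP
    rw [this]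
    exact Set.empty_subset _
  · intro i hi x m hx
    simp only [Multiset.mem_add, Multiset.mem_singleton] at hi
    rcases hi with rfl | rfl <;> cases hx

theorem Sim.thread_true {e e' : Expr S} (h : LocStar e e') (he : ∀ v, e' ≠ CH.Expr.ret v) :
    Sim (.thread true e) (.thread true e') := .loc h fun _ => he

theorem rel_init {K : Expr S → Expr S} (hK : LocStar (K (ret unit)) (putMVar (var s) unit))
    {M : Multiset (Comp S)} (hM : Multiset.Rel Sim M {.mvar s unit}) :
    Multiset.Rel Sim (M + {.thread true (K (ret unit)), .thread false (tRun S s P)})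
      (allComps S s ({.main} + {.run P})) := by
  have h1 := (hM.add (Multiset.rel_cons_left.2 ⟨_, 0, Sim.thread_true hK (by simp), .zero, rfl⟩ :
    Multiset.Rel Sim {_} _)).add (Sim.rel_refl {.thread false (tRun S s P)})
  rw [add_assoc] at h1
  have e : allComps S s ({.main} + {.run P}) = {.mvar s unit} +
      ({.thread true (putMVar (var s) unit)} + {.thread false (tRun S s P)}) := by
    rw [← add_assoc, add_comm {Comp.mvar s unit}]
    simp only [allComps_add, allComps_singleton]
    rfl
  rwa [e]

theorem envOK_insert {a : ℕ} (h : EnvOK free A) (ha : a ∉ Set.range free) :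
    EnvOK free (A ∪ {a}) := by
  refine ⟨h.1, fun b hb i hi => ?_⟩
  rcases Finset.mem_union.1 hb with hb | hb
  · exact h.2 b hb i hi
  · exact ha ⟨i, hi.trans (Finset.mem_singleton.1 hb)⟩

/-- A reduction of an initial state leads to an initial state, or to a state that represents the
configuration in which `P` is about to run. -/
theorem Init.backward (hP : P.Closed) (h : Init P Q) (hQ : Step Q Q') :
    Init P Q' ∨ ∃ s A, Conf S s Q' A ({.main} + {.run P}) := by
  cases h with
  | @start A ρ hA h =>
    obtain ⟨M, N, B, N', hL, hN, hQ', hBA, hBW⟩ := hQ.gStep h coInf_range_free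
    obtain ⟨K, hK, hl⟩ := act_start (S := S) hP ρ
    obtain ⟨m, e, ht⟩ := hN.thread
    have ht' : .thread m e ∈ M + N := Multiset.mem_add.2 (.inr ht)
    rw [← hL, Multiset.mem_singleton] at ht'
    rw [ht'] at ht
    obtain ⟨s, rfl, rfl, rfl⟩ := hN.inv_new ht hK
    have hM : M = 0 := by simpa using hL
    subst hM
    refine .inl (.fork (s := s) (envOK_insert hA (hBW s (by simp))) (by simp) hQ' ?_)
    rw [zero_add]
    exact Multiset.rel_cons_left.2 ⟨_, _, Sim.thread_true (hl s) (by simp [tFork, andThen]),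
      Sim.rel_refl _, rfl⟩
  | @fork A s L hA hs h hr =>
    obtain ⟨M, N, B, N', rfl, hN, hQ', hBA, hBW⟩ := hQ.gStep h coInf_range_free
    obtain ⟨L₁, L₂, hr₁, hr₂, hL⟩ := Multiset.rel_add_left.1 hr
    obtain ⟨K, hK, hl⟩ := act_fork (S := S) s P
    rcases hN.of_rel hr₂ with rfl | ⟨rfl, hr₂⟩
    · obtain ⟨m, e, ht⟩ := hN.thread
      have ht' : .thread m e ∈ L₁ + L₂ := Multiset.mem_add.2 (.inr ht)
      rw [← hL] at ht'
      simp at ht'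
      rw [ht'.1, ht'.2] at ht
      obtain ⟨rfl, rfl, rfl⟩ := hN.inv_fork ht hK
      have hM : L₁ = {.mvar s unit} := by
        rw [Multiset.insert_eq_cons, ← Multiset.singleton_add, add_comm L₁] at hL
        exact (add_left_cancel hL).symm
      subst hM
      rw [Finset.union_empty] at hQ'
      exact .inr ⟨s, A, ⟨_, hQ', rel_init hl hr₁⟩, good_init hP hs, hA⟩
    · rw [Finset.union_empty] at hQ'
      exact .inl (.fork hA hs hQ' (hL ▸ hr₁.add hr₂))

/-- The initial states can be executed up to the configuration in which `P` is about to run. -/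
theorem Init.forward (hP : P.Closed) (h : Init P Q) :
    ∃ Q' s A, Relation.ReflTransGen Step Q Q' ∧ Conf S s Q' A ({.main} + {.run P}) := by
  have key : ∀ {Q : CH.Proc S} {A s L}, EnvOK free A → s ∈ A → Q.Open free A L →
      Multiset.Rel Sim L {.thread true (tFork S s P), .mvar s unit} →
      ∃ Q' s A, Relation.ReflTransGen Step Q Q' ∧ Conf S s Q' A ({.main} + {.run P}) := by
    intro Q A s L hA hs h hL
    have hl := live_fork (S := S) s P
    obtain ⟨Q₁, h1, h2⟩ := Sim.rel_steps hL (M := 0) (by rwa [zero_add]) (by rwa [zero_add]) hA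
    obtain ⟨K, hK, hl'⟩ := act_fork (S := S) s P
    have e : ({.thread true (tFork S s P), .mvar s unit} : Multiset (Comp S)) =
        {.mvar s unit} + {.thread true (tFork S s P)} := by
      rw [Multiset.insert_eq_cons, ← Multiset.singleton_add, add_comm]
    rw [zero_add, e] at h2
    rw [e] at hl
    obtain ⟨Q₂, h3, h4⟩ := hl.gStep (.fork hK) h2 hA (Finset.disjoint_empty_right A)
    rw [Finset.union_empty] at h4
    exact ⟨Q₂, s, A, h1.tail h3, ⟨_, h4, rel_init hl' (Sim.rel_refl _)⟩, good_init hP hs, hA⟩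
  cases h with
  | @start A ρ hA h =>
    obtain ⟨K, hK, hl⟩ := act_start (S := S) hP ρ
    obtain ⟨s, hs, -, hs'⟩ := exists_freshName A ∅
    obtain ⟨Q₁, h1, h2⟩ := (live_start (S := S) ρ P).gStep (M := 0) (.new s hK) h hA
      (Finset.disjoint_singleton_right.2 hs)
    obtain ⟨Q', s', A', h3, h4⟩ := key (s := s) (envOK_insert hA hs') (by simp) h2 (by
      rw [zero_add]
      exact Multiset.rel_cons_left.2 ⟨_, _, Sim.thread_true (hl s) (by simp [tFork, andThen]),
        Sim.rel_refl _, rfl⟩)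
    exact ⟨Q', s', A', .head h1 h3, h4⟩
  | fork hA hs h hL => exact key hA hs h hL

theorem Init.steps (hP : P.Closed) (h : Init P Q) (hQ : Relation.ReflTransGen Step Q Q') :
    Init P Q' ∨ ∃ s A I, Conf S s Q' A I ∧ Relation.ReflTransGen StepQ (cls P) (decode I) := by
  induction hQ with
  | refl => exact .inl h
  | tail _ hQ ih =>
    rcases ih with ih | ⟨s, A, I, h1, h2⟩
    · rcases ih.backward hP hQ with h1 | ⟨s, A, h1⟩
      · exact .inl h1
      · refine .inr ⟨s, A, _, h1, ?_⟩
        rw [decode_init]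
    · obtain ⟨A', I', h3, h4⟩ := h1.steps (.single hQ)
      exact .inr ⟨s, A', I', h3, h2.trans h4⟩

theorem Init.mayConv (hP : P.Closed) (h : Init P Q) (hm : MayQ (cls P)) : MayConv Q := by
  obtain ⟨Q', s, A, h1, h2⟩ := h.forward hP
  exact .of_steps h.wellFormed h1 (h2.mayConv (by rwa [decode_init]) (.inl rfl))

/-- The translation preserves and reflects may-convergence. -/
theorem Init.mayConv_iff (hP : P.Closed) (h : Init P Q) : PiStop.MayConv P ↔ MayConv Q := by
  rw [← PiStop.mayQ_cls]
  refine ⟨h.mayConv hP, fun ⟨_, Q', h1, h2⟩ => ?_⟩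
  rcases h.steps hP h1 with h3 | ⟨s, A, I, h3, h4⟩
  · exact (h3.not_successful h2).elim
  · exact ⟨_, h4, h3.succQ h2⟩

/-- The translation preserves and reflects should-convergence. -/
theorem Init.shouldConv_iff (hP : P.Closed) (h : Init P Q) :
    PiStop.ShouldConv P ↔ ShouldConv Q := by
  rw [← PiStop.shouldQ_cls]
  refine ⟨fun hs => ⟨h.wellFormed, fun Q' hQ' => ?_⟩, fun ⟨_, hs⟩ p hp => ?_⟩
  · rcases h.steps hP hQ' with h1 | ⟨s, A, I, h1, h2⟩
    · exact h1.mayConv hP (hs _ .refl)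
    · exact h1.mayConv (hs _ h2) (.inr fun q hq => hs q (h2.trans hq))
  · obtain ⟨Q', s, A, h1, h2⟩ := h.forward hP
    rw [← decode_init] at hp
    obtain ⟨C, h3, h4, -, rfl⟩ := h2.good.simulates_all (by simp) rfl hp
    have hg := h2.good.aSteps h3
    obtain ⟨Q'', h5, h6⟩ := h2.aSteps h3 (hg.not_mem_of_main h4 rfl rfl (by simp))
    exact h6.mayQ (hs Q'' (h1.trans h5))

/-- The outer restriction of `stop` in `Cout` is vacuous. -/
theorem Cout_tau_eq (P : PiStop.Proc) :
    Cout (tau S P) = .nu (.thread true (tStart S Nat.succ P)) := by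
  rw [Cout, tau, tauAux_rename]
  rfl

theorem init_tau0 (P : PiStop.Proc) : Init P (tau0 S P) :=
  .start (free ∘ id) ⟨fun i j h => by simpa [free] using h, by simp⟩
    ⟨rfl, by rw [← start_rename]; rfl⟩

theorem init_Cout (P : PiStop.Proc) : Init P (Cout (tau S P)) := by
  obtain ⟨a, -, -, ha⟩ := exists_freshName ∅ ∅
  refine .start (A := {a}) (consRen a free ∘ Nat.succ) ⟨fun i j h => by simpa [free] using h,
    fun b hb i hi => ha ⟨i, hi.trans (Finset.mem_singleton.1 hb)⟩⟩ ?_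
  rw [Cout_tau_eq]
  exact ⟨a, ∅, by simp, rfl, rfl, by rw [← start_rename]⟩

end Translation

theorem mainTheorem1 (S : CH.Signature) (P : PiStop.Proc) (hP : P.Closed) :
    (PiStop.MayConv P ↔ CH.MayConv (Translation.tau0 S P)) ∧
    (PiStop.ShouldConv P ↔ CH.ShouldConv (Translation.tau0 S P)) ∧
    (PiStop.MayConv P ↔ Translation.MayConv0 (Translation.tau S P)) ∧
    (PiStop.ShouldConv P ↔ Translation.ShouldConv0 (Translation.tau S P)) :=
  ⟨(Translation.init_tau0 P).mayConv_iff hP, (Translation.init_tau0 P).shouldConv_iff hP,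
    (Translation.init_Cout P).mayConv_iff hP, (Translation.init_Cout P).shouldConv_iff hP⟩
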